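/- **Localisation of the parabolic Anderson model with partially duplicated Pareto potential.** Let $\alpha>1$ and $p\in(0,1)$. Let $(\xi_0(z))_{z\in\mathbb Z}$ be independent Pareto random variables with parameter $\alpha$, i.e. with distribution function $F(x)=1-x^{-\alpha}$, $x\ge 1$. Define the random potential $\xi:\mathbb Z\to[1,\infty)$ by $\xi(n)=\xi_0(n)$ for $n\ge 0$ and, for each $n\ge 1$, independently of everything else, $\xi(-n)=\xi_0(n)$ with probability $p$ and $\xi(-n)=\xi_0(-n)$ with probability $1-p$. Let $\mathrm{Prob}$ denote the law of the potential. Let $(X_s)_{s\ge 0}$ be the continuous-time random walk on $\mathbb Z$ started at $0$ with generator $\Delta$, $(\Delta f)(z)=f(z+1)+f(z-1)-2f(z)$, independent of $\xi$, with expectation $\mathbb E$ for fixed $\xi$, and for $t\ge 0$, $z\in\mathbb Z$ put $$u(t,z)=\mathbb E\Big[\exp\Big\{\int_0^t\xi(X_s)\,ds\Big\}\mathbf 1\{X_t=z\}\Big],\qquad U(t)=\sum_{z\in\mathbb Z}u(t,z).$$ For $t>0$ let $\Psi_t(z)=\xi(z)-\frac{|z|}{t}\log\xi(z)$, let $\Omega_t\subseteq\mathbb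 Z$ be the set of maximisers of $\Psi_t$, and let $\mathfrak D_t=\{|\Omega_t|=2\}$. Then, almost surely, $u$ is finite and solves the parabolic Anderson model $\partial_t u(t,z)=\Delta u(t,z)+\xi(z)u(t,z)$ on $(0,\infty)\times\mathbb Z$ with $u(0,z)=\mathbf 1_{\{0\}}(z)$; as $t\to\infty$, $$\frac1{U(t)}\sum_{z\in\Omega_t}u(t,z)\to 1\quad\text{in probability};$$ and, as $t\to\infty$, $$\mathrm{Prob}(\mathfrak D_t)\to\frac{p}{2-p}.$$ -/

import Mathlib

open MeasureTheory ProbabilityTheory Filter Topology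
open scoped ENNReal

noncomputable section

namespace PAM

/-! ### The partially duplicated potential -/

/-- The potential `ξ` built from an auxiliary field `ξ₀` and a sequence of switches `B`:
`ξ(n) = ξ₀(n)` for `n ≥ 0`; for `n ≥ 1` the value `ξ(-n)` is `ξ₀(n)` if the switch of the pair
`{-n, n}` is on and `ξ₀(-n)` otherwise. The pair `{-(n+1), n+1}` is governed by `B n`
(recall that `Int.negSucc n = -(n+1)`). -/
def potential (ξ₀ : ℤ → ℝ) (B : ℕ → Bool) : ℤ → ℝ
  | Int.ofNat n => ξ₀ (n : ℤ)
  | Int.negSucc n => if B n = true then ξ₀ ((n : ℤ) + 1) else ξ₀ (-((n : ℤ) + 1))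

/-! ### The continuous-time simple random walk on `ℤ` with generator `Δ`, started at `0`

The walk jumps from each site to each of its two neighbours at rate `1`: it waits independent
exponential times of rate `2` and then makes an independent symmetric `±1` step. -/

/-- The law of a symmetric `±1` step. -/
def coinLaw : Measure ℤ :=
  (2⁻¹ : ℝ≥0∞) • Measure.dirac 1 + (2⁻¹ : ℝ≥0∞) • Measure.dirac (-1)

instance : IsProbabilityMeasure coinLaw := by
  constructor
  simp [coinLaw, ENNReal.inv_two_add_inv_two]

instance : IsProbabilityMeasure (expMeasure 2) := isProbabilityMeasure_expMeasure two_pos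

/-- The law of the i.i.d. sequence of pairs (waiting time, step) that drives the walk. -/
def walkLaw : Measure (ℕ → ℝ × ℤ) :=
  Measure.infinitePi fun _ : ℕ => (expMeasure 2).prod coinLaw

instance : IsProbabilityMeasure walkLaw := by
  unfold walkLaw; infer_instance

/-- The time of the jump number `i` (counted from `0`). -/
def jumpTime (w : ℕ → ℝ × ℤ) (i : ℕ) : ℝ := ∑ j ∈ Finset.range (i + 1), (w j).1

/-- The number of jumps up to time `s`. -/
def jumpCount (w : ℕ → ℝ × ℤ) (s : ℝ) : ℕ := {i : ℕ | jumpTime w i ≤ s}.ncard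

/-- The position `X_s` of the walk at time `s`. -/
def walk (w : ℕ → ℝ × ℤ) (s : ℝ) : ℤ := ∑ j ∈ Finset.range (jumpCount w s), (w j).2

/-! ### The solution of the parabolic Anderson model -/

/-- The Feynman–Kac formula `u(t,z) = 𝔼[exp(∫₀ᵗ ξ(X_s) ds) 1{X_t = z}]`, as an extended
nonnegative number. -/
def solution (ξ : ℤ → ℝ) (t : ℝ) (z : ℤ) : ℝ≥0∞ :=
  ∫⁻ w, {w' | walk w' t = z}.indicator
    (fun w' => ENNReal.ofReal (Real.exp (∫ s in (0 : ℝ)..t, ξ (walk w' s)))) w ∂walkLaw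

/-- The total mass `U(t) = ∑_z u(t,z)`. -/
def totalMass (ξ : ℤ → ℝ) (t : ℝ) : ℝ≥0∞ := ∑' z : ℤ, solution ξ t z

/-- The discrete Laplacian on `ℤ`. -/
def laplacian (f : ℤ → ℝ) (z : ℤ) : ℝ := (f (z + 1) - f z) + (f (z - 1) - f z)

/-- `u` solves the Cauchy problem `∂_t u = Δu + ξu` on `(0,∞) × ℤ`, `u(0,·) = 1_{0}`. -/
structure IsCauchySolution (ξ : ℤ → ℝ) (u : ℝ → ℤ → ℝ) : Prop where
  initial : ∀ z, u 0 z = if z = 0 then 1 else 0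
  continuous_zero : ∀ z, ContinuousWithinAt (fun t => u t z) (Set.Ici 0) 0
  equation : ∀ t, 0 < t → ∀ z,
    HasDerivAt (fun s => u s z) (laplacian (u t) z + ξ z * u t z) t

/-! ### The maximisers of the functional `Ψ_t` -/

/-- `Ψ_t(z) = ξ(z) - (|z|/t) log ξ(z)`. -/
def Psi (ξ : ℤ → ℝ) (t : ℝ) (z : ℤ) : ℝ := ξ z - |(z : ℝ)| / t * Real.log (ξ z)

/-- The set `Ω_t` of maximisers of `Ψ_t`. -/
def maximisers (ξ : ℤ → ℝ) (t : ℝ) : Set ℤ := {z | ∀ y, Psi ξ t y ≤ Psi ξ t z}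

/-- The share of the total mass carried by `Ω_t`. -/
def localisedShare (ξ : ℤ → ℝ) (t : ℝ) : ℝ≥0∞ :=
  (∑' z : maximisers ξ t, solution ξ t z) / totalMass ξ t

end PAM

end

noncomputable section

namespace PAM

/-! ### The driving sequence of the walk -/

/-! The proof has an analytic half, deterministic in the potential, and a probabilistic half, joined
by `IsGoodField`, a list of properties that the auxiliary field has at time `t` with probability
close to one.

Analytic half. Splitting the Feynman–Kac expectation by the number `n` of jumps turns it into a
series of iterated convolutions of exponentials (`solution_eq_tsum`). Summing over `n` gives
Duhamel's formula, hence the Cauchy problem. If the potential is at most `q` within distance `n`,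
the paths with `n` jumps have mass at most `(2/l)^n exp((q+l)t)` for every `l > 0`
(`tsum_killedKernel_le`). With `ξ(z) = O(|z|^β)` and `β < 1` this makes everything finite. For
localisation let `W` be the set of maximisers, on which `ξ` has a common value `M`. Mass that has
visited `W` and left it is at most `4/d` of the mass on `W` when the nearby sites off `W` have
potential at most `M - d`. The remaining paths obey the bound above with `l` of order `d`
(`massOn_compl_le`). The straight path to a maximiser gives mass about `exp(t Ψ_t)` (`le_solution`).
Taking `d` to be a small multiple of the scale `a = (t/log t)^(1/(α-1))`, the jump factor `(2/d)^n`
cancels the term `|z| log ξ(z)` up to a lower order, and a gap of order `a` in `Ψ_t` off `W` wins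
(`massOn_compl_le_of_gap`).

Probabilistic half. The spatial scale is `r = a^α`. A site `z` can have `Ψ` of order `a` only if its
value is at least of order `a(1+|z|/r)`, and these probabilities have a bounded sum over `z`.
First-moment bounds then show that high levels exist, that distinct auxiliary sites do not nearly
tie, and that `x` and `-x` are not both high (`exists_eventually_measure_not_isGoodField_le`). Thus
ties between maximisers come only from duplication.

The constant `p/(2-p)`. For a pair `{n+1, -(n+1)}` consider the event that the auxiliary value at
one given site of the pair beats everything outside the pair. It does not involve the pair's own
switch, and by exchangeability it is equally likely for both sites. Let `w` be its sum over `n`.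
Duplicated pairs win with total probability `p w`, the others with about `2(1-p) w`, and together
these make up almost all the probability. So `w` is close to `1/(2-p)`, and `p w` is the limit. -/

/-- Prepend a (waiting time, step) pair to a driving sequence. -/
def consPath (q : (ℝ × ℤ) × (ℕ → ℝ × ℤ)) : ℕ → ℝ × ℤ
  | 0 => q.1
  | i + 1 => q.2 i

/-- Drop the first (waiting time, step) pair of a driving sequence. -/
def tailPath (w : ℕ → ℝ × ℤ) : ℕ → ℝ × ℤ := fun i => w (i + 1)

@[simp] lemma consPath_zero (q : (ℝ × ℤ) × (ℕ → ℝ × ℤ)) : consPath q 0 = q.1 := rfl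

@[simp] lemma tailPath_consPath (q : (ℝ × ℤ) × (ℕ → ℝ × ℤ)) : tailPath (consPath q) = q.2 := rfl

lemma measurable_consPath : Measurable consPath := by
  refine measurable_pi_lambda _ fun i => ?_
  cases i with
  | zero => exact measurable_fst
  | succ i => exact (measurable_pi_apply i).comp measurable_snd

lemma measurable_tailPath : Measurable tailPath :=
  measurable_pi_lambda _ fun i => measurable_pi_apply (i + 1)

/-- An i.i.d. sequence with an independent copy prepended is again i.i.d. This is the renewal
property on which every first-jump computation rests. -/
lemma map_consPath_walkLaw :
    (((expMeasure 2).prod coinLaw).prod walkLaw).map consPath = walkLaw := by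
  classical
  refine Measure.eq_infinitePi _ fun s t ht => ?_
  obtain ⟨N, hN⟩ : ∃ N, s ⊆ Finset.range (N + 1) :=
    ⟨s.sup id, fun i hi => Finset.mem_range_succ_iff.2 (Finset.le_sup (f := id) hi)⟩
  -- Padding the cylinder with full factors makes its index set an initial segment, from which
  -- coordinate `0` can be split off.
  set t' : ℕ → Set (ℝ × ℤ) := fun i => if i ∈ s then t i else Set.univ with ht'
  have hmeas : ∀ i, MeasurableSet (t' i) := by
    intro i; simp only [ht']; split_ifs
    · exact ht i
    · exact MeasurableSet.univ
  have h1 : Set.pi (s : Set ℕ) t = Set.pi (Finset.range (N + 1) : Set ℕ) t' := by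
    ext w
    simp only [Set.mem_pi, Finset.mem_coe, ht']
    constructor
    · intro h i _
      by_cases hi : i ∈ s
      · simpa [hi] using h i hi
      · simp [hi]
    · intro h i hi
      simpa [hi] using h i (hN hi)
  have h2 : ∏ i ∈ s, ((expMeasure 2).prod coinLaw) (t i)
      = ∏ i ∈ Finset.range (N + 1), ((expMeasure 2).prod coinLaw) (t' i) := by
    rw [← Finset.prod_subset hN]
    · exact Finset.prod_congr rfl fun i hi => by simp [ht', hi]
    · intro i _ hi; simp [ht', hi]
  rw [h1, h2, Measure.map_apply measurable_consPath
    (MeasurableSet.pi (Finset.countable_toSet _) fun i _ => hmeas i)]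
  have h3 : consPath ⁻¹' Set.pi (Finset.range (N + 1) : Set ℕ) t'
      = t' 0 ×ˢ Set.pi (Finset.range N : Set ℕ) (fun i => t' (i + 1)) := by
    ext q
    simp only [Set.mem_preimage, Set.mem_pi, Finset.mem_coe, Finset.mem_range, Set.mem_prod]
    constructor
    · intro h
      exact ⟨h 0 (Nat.succ_pos _), fun i hi => h (i + 1) (by omega)⟩
    · rintro ⟨h0, h⟩ i hi
      cases i with
      | zero => exact h0
      | succ i => exact h i (by omega)
  rw [h3, Measure.prod_prod, walkLaw, Measure.infinitePi_pi _ (fun i _ => hmeas (i + 1)),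
    Finset.prod_range_succ', mul_comm]

lemma lintegral_walkLaw_eq {f : (ℕ → ℝ × ℤ) → ℝ≥0∞} (hf : Measurable f) :
    ∫⁻ w, f w ∂walkLaw
      = ∫⁻ q, ∫⁻ w, f (consPath (q, w)) ∂walkLaw ∂((expMeasure 2).prod coinLaw) := by
  conv_lhs => rw [← map_consPath_walkLaw]
  rw [lintegral_map hf measurable_consPath]
  exact lintegral_prod _ (hf.comp measurable_consPath).aemeasurable

lemma expMeasure_eq : expMeasure 2 = volume.withDensity (exponentialPDF 2) := rfl

lemma measurable_exponentialPDF : Measurable (exponentialPDF 2) :=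
  (measurable_exponentialPDFReal 2).ennreal_ofReal

lemma expMeasure_Iic_zero : expMeasure 2 (Set.Iic 0) = 0 := by
  rw [expMeasure_eq, withDensity_apply _ measurableSet_Iic, ← setLIntegral_congr Iio_ae_eq_Iic]
  exact lintegral_exponentialPDF_of_nonpos le_rfl

lemma expMeasure_Ioi {t : ℝ} (ht : 0 ≤ t) :
    expMeasure 2 (Set.Ioi t) = ENNReal.ofReal (Real.exp (-2 * t)) := by
  have h := cdf_expMeasure_eq (two_pos : (0 : ℝ) < 2) t
  rw [cdf_eq_real, if_pos ht] at h
  have h2 := prob_compl_eq_one_sub (μ := expMeasure 2) (measurableSet_Iic (a := t))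
  rw [Set.compl_Iic] at h2
  rw [h2, ← ENNReal.ofReal_toReal (measure_ne_top (expMeasure 2) (Set.Iic t)), ← measureReal_def, h,
    ← ENNReal.ofReal_one, ← ENNReal.ofReal_sub _ (by simpa using ht)]
  congr 1; ring_nf

lemma lintegral_exp_neg_lt_one : ∫⁻ x, ENNReal.ofReal (Real.exp (-x)) ∂(expMeasure 2) < 1 := by
  have hpos : ∀ᵐ x ∂(expMeasure 2), 0 < x := by
    rw [ae_iff]
    convert expMeasure_Iic_zero using 2
    ext; simp
  have h1 : ∫⁻ x, (1 : ℝ≥0∞) ∂(expMeasure 2) = 1 := by simp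
  conv_rhs => rw [← h1]
  refine lintegral_strict_mono (IsProbabilityMeasure.ne_zero _) aemeasurable_const ?_ ?_
  · refine ne_top_of_le_ne_top (b := 1) ENNReal.one_ne_top ?_
    rw [← h1]
    refine lintegral_mono_ae ?_
    filter_upwards [hpos] with x hx
    rw [← ENNReal.ofReal_one]
    exact ENNReal.ofReal_le_ofReal (Real.exp_le_one_iff.2 (by linarith))
  · filter_upwards [hpos] with x hx
    rw [ENNReal.ofReal_lt_one]
    exact Real.exp_lt_one_iff.2 (by linarith)

lemma jumpTime_zero (w : ℕ → ℝ × ℤ) : jumpTime w 0 = (w 0).1 := by simp [jumpTime]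

lemma jumpTime_succ (w : ℕ → ℝ × ℤ) (i : ℕ) :
    jumpTime w (i + 1) = (w 0).1 + jumpTime (tailPath w) i := by
  rw [jumpTime, Finset.sum_range_succ', add_comm]; rfl

lemma measurable_jumpTime (i : ℕ) : Measurable fun w => jumpTime w i :=
  Finset.measurable_sum _ fun j _ => (measurable_pi_apply j).fst

lemma lintegral_exp_neg_jumpTime (n : ℕ) :
    ∫⁻ w, ENNReal.ofReal (Real.exp (-jumpTime w n)) ∂walkLaw
      = (∫⁻ x, ENNReal.ofReal (Real.exp (-x)) ∂(expMeasure 2)) ^ (n + 1) := by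
  have hm : ∀ n, Measurable fun w => ENNReal.ofReal (Real.exp (-jumpTime w n)) := fun n =>
    (Real.measurable_exp.comp (measurable_jumpTime n).neg).ennreal_ofReal
  have hq : ∫⁻ q : ℝ × ℤ, ENNReal.ofReal (Real.exp (-q.1)) ∂((expMeasure 2).prod coinLaw)
      = ∫⁻ x, ENNReal.ofReal (Real.exp (-x)) ∂(expMeasure 2) := by
    rw [lintegral_prod _ (by fun_prop)]
    simp
  induction n with
  | zero =>
    rw [lintegral_walkLaw_eq (hm 0)]
    simp [jumpTime_zero, hq]
  | succ n ih =>
    rw [lintegral_walkLaw_eq (hm _)]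
    have : ∀ q : ℝ × ℤ, ∫⁻ w, ENNReal.ofReal (Real.exp (-jumpTime (consPath (q, w)) (n + 1))) ∂walkLaw
        = ENNReal.ofReal (Real.exp (-q.1)) *
          (∫⁻ x, ENNReal.ofReal (Real.exp (-x)) ∂(expMeasure 2)) ^ (n + 1) := by
      intro q
      rw [← ih, ← lintegral_const_mul _ (hm n)]
      refine lintegral_congr fun w => ?_
      rw [jumpTime_succ, ← ENNReal.ofReal_mul (Real.exp_pos _).le, ← Real.exp_add]
      simp [add_comm]
    simp_rw [this]
    rw [lintegral_mul_const _ (by fun_prop), hq, pow_succ' _ (n + 1)]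

/-- The driving sequences with positive waiting times and no explosion. -/
structure IsValidPath (w : ℕ → ℝ × ℤ) : Prop where
  pos : ∀ i, 0 < (w i).1
  exists_lt : ∀ s : ℝ, ∃ i, s < jumpTime w i

/-- No explosion: by Markov's inequality the `n`-th jump time stays below `s` with probability at
most `e^s ρ^(n+1)`, where `ρ < 1` is the Laplace transform of a waiting time at `1`. -/
lemma ae_isValidPath : ∀ᵐ w ∂walkLaw, IsValidPath w := by
  have hpos : ∀ᵐ w ∂walkLaw, ∀ i, 0 < (w i).1 := by
    rw [ae_all_iff]
    intro i
    have hmp := measurePreserving_eval_infinitePi (fun _ : ℕ => (expMeasure 2).prod coinLaw) i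
    have h1 : ∀ᵐ q ∂((expMeasure 2).prod coinLaw), 0 < q.1 := by
      rw [ae_iff]
      have : {q : ℝ × ℤ | ¬ 0 < q.1} = Set.Iic 0 ×ˢ Set.univ := by ext; simp
      rw [this, Measure.prod_prod, expMeasure_Iic_zero, zero_mul]
    exact hmp.quasiMeasurePreserving.ae h1
  have hnat : ∀ᵐ w ∂walkLaw, ∀ s : ℕ, ∃ i, (s : ℝ) < jumpTime w i := by
    rw [ae_all_iff]
    intro s
    rw [ae_iff]
    set ρ := ∫⁻ x, ENNReal.ofReal (Real.exp (-x)) ∂(expMeasure 2)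
    have hle : ∀ n : ℕ, walkLaw {w | ¬ ∃ i, (s : ℝ) < jumpTime w i}
        ≤ ENNReal.ofReal (Real.exp s) * ρ ^ (n + 1) := by
      intro n
      rw [← lintegral_exp_neg_jumpTime, ← lintegral_const_mul' _ _ ENNReal.ofReal_ne_top]
      have hms : MeasurableSet {w : ℕ → ℝ × ℤ | ¬ ∃ i, (s : ℝ) < jumpTime w i} := by
        simp only [not_exists, not_lt, Set.ofPred_forall]
        exact MeasurableSet.iInter fun i => measurableSet_le (measurable_jumpTime i) measurable_const
      rw [← lintegral_indicator_one hms]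
      refine lintegral_mono fun w => ?_
      by_cases hw : w ∈ {w : ℕ → ℝ × ℤ | ¬ ∃ i, (s : ℝ) < jumpTime w i}
      · rw [Set.indicator_of_mem hw]
        simp only [Set.mem_ofPred_eq, not_exists, not_lt] at hw
        rw [← ENNReal.ofReal_mul (Real.exp_pos _).le, ← Real.exp_add, Pi.one_apply]
        exact ENNReal.one_le_ofReal.2 (Real.one_le_exp (by linarith [hw n]))
      · rw [Set.indicator_of_notMem hw]; exact zero_le
    have hlim : Tendsto (fun n : ℕ => ENNReal.ofReal (Real.exp s) * ρ ^ (n + 1)) atTop (𝓝 0) := by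
      have := ENNReal.Tendsto.const_mul (a := ENNReal.ofReal (Real.exp s))
        ((ENNReal.tendsto_pow_atTop_nhds_zero_of_lt_one lintegral_exp_neg_lt_one).comp
          (tendsto_add_atTop_nat 1)) (Or.inr ENNReal.ofReal_ne_top)
      simpa using this
    exact le_antisymm (ge_of_tendsto' hlim hle) zero_le
  filter_upwards [hpos, hnat] with w h1 h2
  refine ⟨h1, fun s => ?_⟩
  obtain ⟨n, hn⟩ := exists_nat_ge s
  obtain ⟨i, hi⟩ := h2 n
  exact ⟨i, hn.trans_lt hi⟩

/-! ### First jump decomposition of the walk -/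

lemma IsValidPath.tail {w : ℕ → ℝ × ℤ} (hw : IsValidPath w) : IsValidPath (tailPath w) := by
  refine ⟨fun i => hw.pos (i + 1), fun s => ?_⟩
  obtain ⟨i, hi⟩ := hw.exists_lt (s + (w 0).1)
  cases i with
  | zero =>
    refine ⟨0, ?_⟩
    rw [jumpTime_zero] at hi ⊢
    have := hw.pos 1
    have h2 : 0 < (tailPath w 0).1 := this
    linarith
  | succ i => exact ⟨i, by rw [jumpTime_succ] at hi; linarith⟩

lemma IsValidPath.strictMono {w : ℕ → ℝ × ℤ} (hw : IsValidPath w) : StrictMono (jumpTime w) := by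
  refine strictMono_nat_of_lt_succ fun n => ?_
  rw [jumpTime, jumpTime, Finset.sum_range_succ _ (n + 1)]
  linarith [hw.pos (n + 1)]

lemma IsValidPath.finite {w : ℕ → ℝ × ℤ} (hw : IsValidPath w) (s : ℝ) :
    {i : ℕ | jumpTime w i ≤ s}.Finite := by
  obtain ⟨n, hn⟩ := hw.exists_lt s
  refine (Set.finite_Iio n).subset fun i hi => ?_
  by_contra h
  have h1 : jumpTime w n ≤ jumpTime w i := hw.strictMono.monotone (not_lt.1 h)
  have h2 : jumpTime w i ≤ s := hi
  linarith

lemma IsValidPath.jumpCount_mono {w : ℕ → ℝ × ℤ} (hw : IsValidPath w) : Monotone (jumpCount w) :=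
  fun _ t hst => Set.ncard_le_ncard (fun _ hi => le_trans hi hst) (hw.finite t)

lemma IsValidPath.walk_of_lt {w : ℕ → ℝ × ℤ} (hw : IsValidPath w) {t : ℝ} (ht : t < (w 0).1) :
    walk w t = 0 := by
  have : {i : ℕ | jumpTime w i ≤ t} = ∅ := by
    ext i
    simp only [Set.mem_ofPred_eq, Set.mem_empty_iff_false, iff_false, not_le]
    refine ht.trans_le ?_
    rw [← jumpTime_zero]
    exact hw.strictMono.monotone (Nat.zero_le i)
  simp [walk, jumpCount, this]

lemma IsValidPath.walk_of_le {w : ℕ → ℝ × ℤ} (hw : IsValidPath w) {t : ℝ} (ht : (w 0).1 ≤ t) :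
    walk w t = (w 0).2 + walk (tailPath w) (t - (w 0).1) := by
  have h1 : {i : ℕ | jumpTime w i ≤ t}
      = insert 0 (Nat.succ '' {i : ℕ | jumpTime (tailPath w) i ≤ t - (w 0).1}) := by
    ext i
    cases i with
    | zero => simpa [jumpTime_zero] using ht
    | succ i => simp [jumpTime_succ, le_sub_iff_add_le']
  have h2 : jumpCount w t = jumpCount (tailPath w) (t - (w 0).1) + 1 := by
    rw [jumpCount, h1, Set.ncard_insert_of_notMem (by simp) ((hw.tail.finite _).image _),
      Set.ncard_image_of_injective _ Nat.succ_injective, jumpCount]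
  rw [walk, h2, Finset.sum_range_succ', add_comm]
  rfl

lemma IsValidPath.intervalIntegrable {w : ℕ → ℝ × ℤ} (hw : IsValidPath w) (ξ : ℤ → ℝ) (x : ℤ)
    (a b : ℝ) : IntervalIntegrable (fun s => ξ (x + walk w s)) volume a b := by
  wlog hab : a ≤ b generalizing a b
  · exact (this b a (not_le.1 hab).le).symm
  rw [intervalIntegrable_iff_integrableOn_Ioc_of_le hab]
  set f : ℕ → ℝ := fun n => ξ (x + ∑ j ∈ Finset.range n, (w j).2) with hf
  have hmeas : Measurable fun s => ξ (x + walk w s) :=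
    (Measurable.of_discrete (f := f)).comp hw.jumpCount_mono.measurable
  refine Measure.integrableOn_of_bounded (M := ∑ n ∈ Finset.range (jumpCount w b + 1), |f n|)
    (by simp) hmeas.aestronglyMeasurable ?_
  rw [ae_restrict_iff' measurableSet_Ioc]
  refine ae_of_all _ fun s hs => ?_
  have : jumpCount w s ∈ Finset.range (jumpCount w b + 1) :=
    Finset.mem_range_succ_iff.2 (hw.jumpCount_mono hs.2)
  exact Finset.single_le_sum (f := fun n => |f n|) (fun _ _ => abs_nonneg _) this

lemma IsValidPath.integral_of_lt {w : ℕ → ℝ × ℤ} (hw : IsValidPath w) (ξ : ℤ → ℝ) (x : ℤ)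
    {t : ℝ} (h0 : 0 ≤ t) (ht : t ≤ (w 0).1) :
    ∫ s in (0 : ℝ)..t, ξ (x + walk w s) = ξ x * t := by
  have : ∫ s in (0 : ℝ)..t, ξ (x + walk w s) = ∫ s in (0 : ℝ)..t, ξ x := by
    rw [intervalIntegral.integral_of_le h0, intervalIntegral.integral_of_le h0,
      integral_Ioc_eq_integral_Ioo, integral_Ioc_eq_integral_Ioo]
    refine setIntegral_congr_fun measurableSet_Ioo fun s hs => ?_
    simp [hw.walk_of_lt (hs.2.trans_le ht)]
  rw [this, intervalIntegral.integral_const, sub_zero, smul_eq_mul, mul_comm]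

lemma IsValidPath.integral_of_le {w : ℕ → ℝ × ℤ} (hw : IsValidPath w) (ξ : ℤ → ℝ) (x : ℤ)
    {t : ℝ} (ht : (w 0).1 ≤ t) :
    ∫ s in (0 : ℝ)..t, ξ (x + walk w s) = ξ x * (w 0).1 +
      ∫ s in (0 : ℝ)..(t - (w 0).1), ξ (x + (w 0).2 + walk (tailPath w) s) := by
  rw [← intervalIntegral.integral_add_adjacent_intervals (hw.intervalIntegrable ξ x 0 (w 0).1)
    (hw.intervalIntegrable ξ x (w 0).1 t), hw.integral_of_lt ξ x (hw.pos 0).le le_rfl]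
  congr 1
  have h := intervalIntegral.integral_comp_sub_right (a := (w 0).1) (b := t)
    (fun s => ξ (x + (w 0).2 + walk (tailPath w) s)) (w 0).1
  rw [sub_self] at h
  rw [← h]
  refine intervalIntegral.integral_congr fun s hs => ?_
  rw [Set.uIcc_of_le ht] at hs
  rw [hw.walk_of_le hs.1, add_assoc]

/-- The Feynman–Kac integrand of the walk started at `x`. -/
def fkIntegrand (ξ : ℤ → ℝ) (z x : ℤ) (w : ℕ → ℝ × ℤ) (t : ℝ) : ℝ≥0∞ :=
  if x + walk w t = z then ENNReal.ofReal (Real.exp (∫ s in (0 : ℝ)..t, ξ (x + walk w s))) else 0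

/-- The Feynman–Kac integrand of the walk started at `x`, restricted to exactly `n` jumps. -/
def jumpTerm (ξ : ℤ → ℝ) (z : ℤ) : ℕ → ℤ → (ℕ → ℝ × ℤ) → ℝ → ℝ≥0∞
  | 0, x, w, t => if 0 ≤ t ∧ t < (w 0).1 ∧ x = z then ENNReal.ofReal (Real.exp (ξ x * t)) else 0
  | n + 1, x, w, t => if 0 ≤ (w 0).1 ∧ (w 0).1 ≤ t then
      ENNReal.ofReal (Real.exp (ξ x * (w 0).1)) *
        jumpTerm ξ z n (x + (w 0).2) (tailPath w) (t - (w 0).1) else 0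

lemma jumpTerm_zero_consPath (ξ : ℤ → ℝ) (z x : ℤ) (q : ℝ × ℤ) (w : ℕ → ℝ × ℤ) (t : ℝ) :
    jumpTerm ξ z 0 x (consPath (q, w)) t
      = if 0 ≤ t ∧ t < q.1 ∧ x = z then ENNReal.ofReal (Real.exp (ξ x * t)) else 0 := rfl

lemma jumpTerm_succ_consPath (ξ : ℤ → ℝ) (z : ℤ) (n : ℕ) (x : ℤ) (q : ℝ × ℤ) (w : ℕ → ℝ × ℤ)
    (t : ℝ) : jumpTerm ξ z (n + 1) x (consPath (q, w)) t
      = if 0 ≤ q.1 ∧ q.1 ≤ t then ENNReal.ofReal (Real.exp (ξ x * q.1)) *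
        jumpTerm ξ z n (x + q.2) w (t - q.1) else 0 := rfl

lemma measurable_jumpTerm (ξ : ℤ → ℝ) (z : ℤ) (n : ℕ) :
    Measurable fun q : ℤ × (ℕ → ℝ × ℤ) × ℝ => jumpTerm ξ z n q.1 q.2.1 q.2.2 := by
  have hw : Measurable fun q : ℤ × (ℕ → ℝ × ℤ) × ℝ => q.2.1 0 :=
    (measurable_pi_apply 0).comp measurable_snd.fst
  have ht : Measurable fun q : ℤ × (ℕ → ℝ × ℤ) × ℝ => q.2.2 := measurable_snd.snd
  have hx : Measurable fun q : ℤ × (ℕ → ℝ × ℤ) × ℝ => ξ q.1 :=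
    (Measurable.of_discrete (f := ξ)).comp measurable_fst
  induction n with
  | zero =>
    simp only [jumpTerm]
    refine Measurable.ite ?_ (Real.measurable_exp.comp (hx.mul ht)).ennreal_ofReal measurable_const
    exact (measurableSet_le measurable_const ht).inter
      ((measurableSet_lt ht hw.fst).inter (measurable_fst (measurableSet_singleton z)))
  | succ n ih =>
    simp only [jumpTerm]
    refine Measurable.ite ?_ ((Real.measurable_exp.comp (hx.mul hw.fst)).ennreal_ofReal.mul ?_)
      measurable_const
    · exact (measurableSet_le measurable_const hw.fst).inter (measurableSet_le hw.fst ht)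
    · exact ih.comp ((measurable_fst.add hw.snd).prodMk
        ((measurable_tailPath.comp measurable_snd.fst).prodMk (ht.sub hw.fst)))

lemma jumpTerm_of_neg (ξ : ℤ → ℝ) (z : ℤ) (n : ℕ) (x : ℤ) (w : ℕ → ℝ × ℤ) {t : ℝ} (ht : t < 0) :
    jumpTerm ξ z n x w t = 0 := by
  cases n with
  | zero => simp [jumpTerm, not_le.2 ht]
  | succ n =>
    rw [jumpTerm, if_neg]
    rintro ⟨h1, h2⟩
    linarith

/-- Only the term whose index is the actual number of jumps survives. The index `i` bounds that
number, and the induction peels off the first jump; it changes the starting point, the path and the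
time, so all three are quantified. -/
lemma IsValidPath.fkIntegrand_eq_tsum (ξ : ℤ → ℝ) (z : ℤ) (i : ℕ) :
    ∀ (x : ℤ) {w : ℕ → ℝ × ℤ} (_ : IsValidPath w) {t : ℝ} (_ : 0 ≤ t) (_ : t < jumpTime w i),
      fkIntegrand ξ z x w t = ∑' n, jumpTerm ξ z n x w t := by
  have hlt : ∀ (x : ℤ) {w : ℕ → ℝ × ℤ} (_ : IsValidPath w) {t : ℝ} (_ : 0 ≤ t) (_ : t < (w 0).1),
      fkIntegrand ξ z x w t = ∑' n, jumpTerm ξ z n x w t := by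
    intro x w hw t ht hi
    rw [tsum_eq_zero_add' (f := fun n => jumpTerm ξ z n x w t) ENNReal.summable]
    have : ∀ n, jumpTerm ξ z (n + 1) x w t = 0 := by
      intro n; rw [jumpTerm, if_neg]; rintro ⟨_, h⟩; linarith
    simp_rw [this]
    simp [jumpTerm, fkIntegrand, hw.walk_of_lt hi, hw.integral_of_lt ξ x ht hi.le, ht, hi]
  induction i with
  | zero => intro x w hw t ht hi; rw [jumpTime_zero] at hi; exact hlt x hw ht hi
  | succ i ih =>
    intro x w hw t ht hi
    rcases lt_or_ge t (w 0).1 with h | h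
    · exact hlt x hw ht h
    · rw [tsum_eq_zero_add' (f := fun n => jumpTerm ξ z n x w t) ENNReal.summable]
      have h0 : jumpTerm ξ z 0 x w t = 0 := by
        rw [jumpTerm, if_neg]; rintro ⟨_, h', _⟩; linarith
      have h1 : ∀ n, jumpTerm ξ z (n + 1) x w t = ENNReal.ofReal (Real.exp (ξ x * (w 0).1)) *
          jumpTerm ξ z n (x + (w 0).2) (tailPath w) (t - (w 0).1) := by
        intro n; rw [jumpTerm, if_pos ⟨(hw.pos 0).le, h⟩]
      rw [h0, zero_add]
      simp_rw [h1]
      rw [ENNReal.tsum_mul_left, ← ih (x + (w 0).2) hw.tail (sub_nonneg.2 h)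
        (by rw [jumpTime_succ] at hi; linarith), fkIntegrand, fkIntegrand, hw.walk_of_le h,
        hw.integral_of_le ξ x h, Real.exp_add, ENNReal.ofReal_mul (Real.exp_pos _).le]
      simp [add_assoc]

/-! ### The kernels with a given number of jumps -/

/-- The exponential kernel `s ↦ exp (c s)` on `[0, ∞)`, extended by `0`. -/
def expKer (c : ℝ) : ℝ → ℝ≥0∞ :=
  (Set.Ici 0).indicator fun s => ENNReal.ofReal (Real.exp (c * s))

@[fun_prop]
lemma measurable_expKer (c : ℝ) : Measurable (expKer c) :=
  Measurable.indicator (by fun_prop) measurableSet_Ici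

/-- The contribution of the paths from `x` to `z` with `n` jumps to the Feynman–Kac formula. -/
def jumpKernel (ξ : ℤ → ℝ) (z : ℤ) : ℕ → ℤ → ℝ → ℝ≥0∞
  | 0, x => if x = z then expKer (ξ x - 2) else 0
  | n + 1, x => expKer (ξ x - 2) ⋆ₗ (jumpKernel ξ z n (x + 1) + jumpKernel ξ z n (x - 1))

@[fun_prop]
lemma measurable_jumpKernel (ξ : ℤ → ℝ) (z : ℤ) (n : ℕ) (x : ℤ) :
    Measurable (jumpKernel ξ z n x) := by
  induction n generalizing x with
  | zero =>
    rw [jumpKernel]; split_ifs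
    · fun_prop
    · exact measurable_const
  | succ n ih =>
    rw [jumpKernel]
    exact measurable_lconvolution _ (by fun_prop) ((ih _).add (ih _))

lemma lintegral_coinLaw (f : ℤ → ℝ≥0∞) : ∫⁻ y, f y ∂coinLaw = 2⁻¹ * (f 1 + f (-1)) := by
  rw [coinLaw, lintegral_add_measure, lintegral_smul_measure, lintegral_smul_measure,
    lintegral_dirac, lintegral_dirac, mul_add]
  rfl

/-- Jump rate `2` times step probability `1/2` gives rate `1` to each neighbour, so convolution with
both neighbours carries no constant. The density factor `exp(-2s)` is what shifts `ξ x` to `ξ x -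
2`. -/
lemma lintegral_jumpTerm (ξ : ℤ → ℝ) (z : ℤ) (n : ℕ) (x : ℤ) (t : ℝ) :
    ∫⁻ w, jumpTerm ξ z n x w t ∂walkLaw = jumpKernel ξ z n x t := by
  have hm : ∀ n x t, Measurable fun w => jumpTerm ξ z n x w t := fun n x t =>
    (measurable_jumpTerm ξ z n).comp (measurable_const.prodMk (measurable_id.prodMk measurable_const))
  induction n generalizing x t with
  | zero =>
    rw [lintegral_walkLaw_eq (hm 0 x t)]
    simp only [jumpTerm_zero_consPath, lintegral_const, measure_univ, mul_one]
    by_cases hxz : x = z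
    swap
    · simp [hxz, jumpKernel]
    rcases lt_or_ge t 0 with ht | ht
    · simp [not_le.2 ht, jumpKernel, hxz, expKer]
    have h1 : ∀ q : ℝ × ℤ, (if 0 ≤ t ∧ t < q.1 ∧ x = z then ENNReal.ofReal (Real.exp (ξ x * t))
        else 0) = (Set.Ioi t ×ˢ (Set.univ : Set ℤ)).indicator
          (fun _ => ENNReal.ofReal (Real.exp (ξ x * t))) q := by
      intro q; simp [Set.indicator_apply, ht, hxz]
    simp_rw [h1]
    rw [lintegral_indicator_const (measurableSet_Ioi.prod MeasurableSet.univ), Measure.prod_prod,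
      expMeasure_Ioi ht, measure_univ, mul_one, ← ENNReal.ofReal_mul (Real.exp_pos _).le,
      ← Real.exp_add]
    simp only [jumpKernel, hxz, if_true, expKer]
    rw [Set.indicator_of_mem (by exact ht)]
    congr 2; ring
  | succ n ih =>
    rw [lintegral_walkLaw_eq (hm _ x t)]
    have h1 : ∀ q : ℝ × ℤ, ∫⁻ w, jumpTerm ξ z (n + 1) x (consPath (q, w)) t ∂walkLaw
        = if 0 ≤ q.1 ∧ q.1 ≤ t then ENNReal.ofReal (Real.exp (ξ x * q.1)) *
          jumpKernel ξ z n (x + q.2) (t - q.1) else 0 := by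
      intro q
      simp only [jumpTerm_succ_consPath]
      split_ifs
      · rw [lintegral_const_mul _ (hm _ _ _), ih]
      · simp
    simp_rw [h1]
    have hk : Measurable fun p : ℤ × ℝ => jumpKernel ξ z n p.1 p.2 :=
      measurable_from_prod_countable_right fun y => measurable_jumpKernel ξ z n y
    have hmeas : Measurable fun q : ℝ × ℤ => if 0 ≤ q.1 ∧ q.1 ≤ t then
        ENNReal.ofReal (Real.exp (ξ x * q.1)) * jumpKernel ξ z n (x + q.2) (t - q.1) else 0 := by
      refine Measurable.ite ((measurableSet_le measurable_const measurable_fst).inter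
        (measurableSet_le measurable_fst measurable_const)) ?_ measurable_const
      refine Measurable.mul (by fun_prop) ?_
      exact hk.comp ((measurable_const.add measurable_snd).prodMk (measurable_const.sub measurable_fst))
    rw [lintegral_prod _ hmeas.aemeasurable]
    simp_rw [lintegral_coinLaw]
    rw [expMeasure_eq, lintegral_withDensity_eq_lintegral_mul _ measurable_exponentialPDF
      (by
        refine Measurable.const_mul (Measurable.add ?_ ?_) _
        · exact hmeas.comp (measurable_id.prodMk measurable_const)
        · exact hmeas.comp (measurable_id.prodMk measurable_const))]
    rw [jumpKernel, lconvolution_def]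
    refine lintegral_congr fun s => ?_
    rw [Pi.mul_apply, expKer, Set.indicator_apply]
    rcases lt_or_ge s 0 with hs | hs
    · simp [exponentialPDF_of_neg hs, not_le.2 hs]
    rw [if_pos (show s ∈ Set.Ici 0 from hs)]
    rcases lt_or_ge t s with hst | hst
    · have hneg : -s + t < 0 := by linarith
      have h0 : ∀ y, jumpKernel ξ z n y (-s + t) = 0 := by
        intro y
        rw [← ih]
        simp [jumpTerm_of_neg ξ z n y _ hneg]
      simp [not_le.2 hst, h0]
    simp only [hs, hst, and_self, if_true, Pi.add_apply]
    rw [exponentialPDF_of_nonneg hs, ← sub_eq_neg_add t s, ← sub_eq_add_neg, ← mul_add]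
    have h2 : ENNReal.ofReal (2 * Real.exp (-(2 * s))) * (2⁻¹ * ENNReal.ofReal (Real.exp (ξ x * s)))
        = ENNReal.ofReal (Real.exp ((ξ x - 2) * s)) := by
      have : (2⁻¹ : ℝ≥0∞) = ENNReal.ofReal (2⁻¹) := by
        rw [ENNReal.ofReal_inv_of_pos two_pos]; simp
      rw [this, ← ENNReal.ofReal_mul (by norm_num), ← ENNReal.ofReal_mul (by positivity)]
      congr 1
      rw [show (ξ x - 2) * s = -(2 * s) + ξ x * s by ring, Real.exp_add]
      ring
    rw [← h2]
    ring

lemma solution_eq_tsum_jumpKernel (ξ : ℤ → ℝ) {t : ℝ} (ht : 0 ≤ t) (z : ℤ) :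
    solution ξ t z = ∑' n, jumpKernel ξ z n 0 t := by
  have h : solution ξ t z = ∫⁻ w, ∑' n, jumpTerm ξ z n 0 w t ∂walkLaw := by
    refine lintegral_congr_ae ?_
    filter_upwards [ae_isValidPath] with w hw
    obtain ⟨i, hi⟩ := hw.exists_lt t
    rw [← IsValidPath.fkIntegrand_eq_tsum ξ z i 0 hw ht hi]
    simp [fkIntegrand, Set.indicator_apply]
  rw [h, lintegral_tsum]
  · simp_rw [lintegral_jumpTerm]
  · intro n
    exact ((measurable_jumpTerm ξ z n).comp
      (measurable_const.prodMk (measurable_id.prodMk measurable_const))).aemeasurable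

lemma lconvolution_add_right {f g h : ℝ → ℝ≥0∞} (hf : Measurable f) (hg : Measurable g) :
    f ⋆ₗ (g + h) = f ⋆ₗ g + f ⋆ₗ h := by
  ext t
  simp only [lconvolution_def, Pi.add_apply, mul_add]
  exact lintegral_add_left (by fun_prop) _

lemma lconvolution_add_left {f g h : ℝ → ℝ≥0∞} (hf : Measurable f) (hh : Measurable h) :
    (f + g) ⋆ₗ h = f ⋆ₗ h + g ⋆ₗ h := by
  ext t
  simp only [lconvolution_def, Pi.add_apply, add_mul]
  exact lintegral_add_left (by fun_prop) _

/-- The last jump decomposition. -/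
lemma jumpKernel_succ' (ξ : ℤ → ℝ) (z : ℤ) (n : ℕ) (x : ℤ) :
    jumpKernel ξ z (n + 1) x
      = (jumpKernel ξ (z + 1) n x + jumpKernel ξ (z - 1) n x) ⋆ₗ expKer (ξ z - 2) := by
  induction n generalizing x with
  | zero =>
    have e1 : x + 1 = z ↔ x = z - 1 := by omega
    have e2 : x - 1 = z ↔ x = z + 1 := by omega
    simp only [jumpKernel, e1, e2]
    by_cases h1 : x = z - 1
    · have h2 : x ≠ z + 1 := by omega
      have h3 : z - 1 ≠ z + 1 := by omega
      simp [h1, h3]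
    · by_cases h2 : x = z + 1
      · have h3 : z + 1 ≠ z - 1 := by omega
        simp [h2, h3]
      · simp [h1, h2]
  | succ n ih =>
    rw [jumpKernel, ih, ih, jumpKernel, jumpKernel, ← lconvolution_add_left (by fun_prop) (by fun_prop),
      lconvolution_assoc (by fun_prop) (by fun_prop) (by fun_prop)]
    congr 1
    rw [lconvolution_add_right (by fun_prop) (by fun_prop), lconvolution_add_right (by fun_prop) (by fun_prop),
      lconvolution_add_right (by fun_prop) (by fun_prop), lconvolution_add_right (by fun_prop) (by fun_prop),
      lconvolution_add_right (by fun_prop) (by fun_prop)]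
    abel

/-! ### Kernels of the walk killed outside a set -/

lemma lconvolution_expKer {g : ℝ → ℝ≥0∞} (hg : ∀ s < 0, g s = 0) (c t : ℝ) :
    (g ⋆ₗ expKer c) t
      = ∫⁻ s in Set.Icc 0 t, g s * ENNReal.ofReal (Real.exp (c * (t - s))) := by
  rw [lconvolution_def, ← lintegral_indicator measurableSet_Icc]
  refine lintegral_congr fun s => ?_
  rw [expKer, Set.indicator_apply, Set.indicator_apply, ← sub_eq_neg_add]
  rcases lt_or_ge s 0 with hs | hs
  · simp [hg s hs]
  · simp [hs]

/-- The contribution to the Feynman–Kac formula of the paths from `0` to `z` with `n` jumps that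
stay in `A`. -/
def killedKernel (ξ : ℤ → ℝ) (A : Set ℤ) : ℕ → ℤ → ℝ → ℝ≥0∞
  | 0 => A.indicator fun z => if z = 0 then expKer (ξ z - 2) else 0
  | n + 1 => A.indicator fun z =>
      (killedKernel ξ A n (z + 1) + killedKernel ξ A n (z - 1)) ⋆ₗ expKer (ξ z - 2)

@[fun_prop]
lemma measurable_killedKernel (ξ : ℤ → ℝ) (A : Set ℤ) (n : ℕ) (z : ℤ) :
    Measurable (killedKernel ξ A n z) := by
  classical
  induction n generalizing z with
  | zero =>
    rw [killedKernel, Set.indicator_apply]; split_ifs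
    · fun_prop
    · exact measurable_const
    · exact measurable_const
  | succ n ih =>
    rw [killedKernel, Set.indicator_apply]; split_ifs
    · exact measurable_lconvolution _ ((ih _).add (ih _)) (by fun_prop)
    · exact measurable_const

lemma killedKernel_of_neg (ξ : ℤ → ℝ) (A : Set ℤ) (n : ℕ) (z : ℤ) {t : ℝ} (ht : t < 0) :
    killedKernel ξ A n z t = 0 := by
  classical
  induction n generalizing z t with
  | zero =>
    rw [killedKernel, Set.indicator_apply]; split_ifs
    · simp [expKer, ht]
    · rfl
    · rfl
  | succ n ih =>
    rw [killedKernel, Set.indicator_apply]; split_ifs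
    · rw [lconvolution_def]
      refine (lintegral_congr fun s => ?_).trans lintegral_zero
      rcases lt_or_ge s 0 with hs | hs
      · simp [ih _ hs]
      · simp [expKer, show ¬ s ≤ t by linarith]
    · rfl

lemma killedKernel_of_notMem (ξ : ℤ → ℝ) {A : Set ℤ} (n : ℕ) {z : ℤ} (hz : z ∉ A) :
    killedKernel ξ A n z = 0 := by
  cases n <;> rw [killedKernel, Set.indicator_of_notMem hz]

lemma killedKernel_of_lt (ξ : ℤ → ℝ) (A : Set ℤ) {n : ℕ} {z : ℤ} (hz : n < z.natAbs) :
    killedKernel ξ A n z = 0 := by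
  classical
  induction n generalizing z with
  | zero =>
    have : z ≠ 0 := by omega
    rw [killedKernel, Set.indicator_apply]; simp [this]
  | succ n ih =>
    rw [killedKernel, Set.indicator_apply, ih (by omega), ih (by omega)]
    simp

lemma killedKernel_univ (ξ : ℤ → ℝ) (n : ℕ) (z : ℤ) :
    killedKernel ξ Set.univ n z = jumpKernel ξ z n 0 := by
  induction n generalizing z with
  | zero =>
    rw [killedKernel, Set.indicator_univ, jumpKernel]
    rcases eq_or_ne z 0 with rfl | h
    · rfl
    · simp [h, h.symm]
  | succ n ih => rw [killedKernel, Set.indicator_univ, jumpKernel_succ', ih, ih]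

lemma killedKernel_succ_apply (ξ : ℤ → ℝ) {A : Set ℤ} (n : ℕ) {z : ℤ} (hz : z ∈ A) (t : ℝ) :
    killedKernel ξ A (n + 1) z t = ∫⁻ s in Set.Icc 0 t,
      (killedKernel ξ A n (z + 1) s + killedKernel ξ A n (z - 1) s) *
        ENNReal.ofReal (Real.exp ((ξ z - 2) * (t - s))) := by
  rw [killedKernel, Set.indicator_of_mem hz, lconvolution_expKer]
  · rfl
  · intro s hs
    simp [killedKernel_of_neg ξ A n _ hs]

lemma solution_eq_tsum (ξ : ℤ → ℝ) {t : ℝ} (ht : 0 ≤ t) (z : ℤ) :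
    solution ξ t z = ∑' n, killedKernel ξ Set.univ n z t := by
  simp_rw [killedKernel_univ]
  exact solution_eq_tsum_jumpKernel ξ ht z

/-! ### Mass bounds -/

lemma tsum_neighbours (f : ℤ → ℝ≥0∞) : ∑' z, (f (z + 1) + f (z - 1)) = 2 * ∑' z, f z := by
  have h1 : ∑' z, f (z + 1) = ∑' z, f z := (Equiv.addRight (1 : ℤ)).tsum_eq f
  have h2 : ∑' z, f (z - 1) = ∑' z, f z := (Equiv.subRight (1 : ℤ)).tsum_eq f
  rw [ENNReal.tsum_add, h1, h2, two_mul]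

/-- One jump: the mass doubles, having two neighbours to go to, and then grows at rate at most `q -
2`. The second alternative in `hq` excuses sites too far away to be reached, where `ξ` may exceed
`q`. -/
lemma tsum_convolution_le {ξ : ℤ → ℝ} {A : Set ℤ} {q : ℝ} {f : ℤ → ℝ → ℝ≥0∞}
    (hf : ∀ z, Measurable (f z)) (hq : ∀ z ∈ A, ξ z ≤ q ∨ (f (z + 1) = 0 ∧ f (z - 1) = 0)) (t : ℝ) :
    ∑' z, A.indicator (fun z => ∫⁻ s in Set.Icc 0 t, (f (z + 1) s + f (z - 1) s) *
        ENNReal.ofReal (Real.exp ((ξ z - 2) * (t - s)))) z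
      ≤ ∫⁻ s in Set.Icc 0 t, 2 * (∑' z, f z s) *
        ENNReal.ofReal (Real.exp ((q - 2) * (t - s))) := by
  calc _ ≤ ∑' z, ∫⁻ s in Set.Icc 0 t, (f (z + 1) s + f (z - 1) s) *
        ENNReal.ofReal (Real.exp ((q - 2) * (t - s))) := by
        refine ENNReal.tsum_le_tsum fun z => ?_
        by_cases hz : z ∈ A
        swap
        · rw [Set.indicator_of_notMem hz]; exact zero_le
        rw [Set.indicator_of_mem hz]
        refine setLIntegral_mono' measurableSet_Icc fun s hs => ?_
        rcases hq z hz with h | ⟨h1, h2⟩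
        · gcongr
          linarith [hs.2]
        · simp [h1, h2]
    _ = _ := by
        rw [← lintegral_tsum fun z => by fun_prop]
        refine lintegral_congr fun s => ?_
        rw [ENNReal.tsum_mul_right, tsum_neighbours fun z => f z s]

lemma lintegral_exp_mul_exp_le {c μ : ℝ} (h : c < μ) (t : ℝ) :
    ∫⁻ s in Set.Icc 0 t, ENNReal.ofReal (Real.exp (μ * s)) * ENNReal.ofReal (Real.exp (c * (t - s)))
      ≤ ENNReal.ofReal (Real.exp (μ * t) / (μ - c)) := by
  rcases lt_or_ge t 0 with ht | ht
  · simp [ht]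
  have h1 : ∀ s, ENNReal.ofReal (Real.exp (μ * s)) * ENNReal.ofReal (Real.exp (c * (t - s)))
      = ENNReal.ofReal (Real.exp (c * t) * Real.exp ((μ - c) * s)) := by
    intro s
    rw [← ENNReal.ofReal_mul (Real.exp_pos _).le, ← Real.exp_add, ← Real.exp_add]
    congr 2; ring
  simp_rw [h1]
  have hInteg : ∫ s in (0 : ℝ)..t, Real.exp ((μ - c) * s)
      = (Real.exp ((μ - c) * t) - 1) / (μ - c) := by
    rw [intervalIntegral.integral_comp_mul_left (fun x => Real.exp x) (sub_pos.2 h).ne', integral_exp]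
    simp [div_eq_inv_mul]
  rw [← ofReal_integral_eq_lintegral_ofReal]
  · apply ENNReal.ofReal_le_ofReal
    rw [integral_Icc_eq_integral_Ioc, ← intervalIntegral.integral_of_le ht,
      intervalIntegral.integral_const_mul, hInteg, ← mul_div_assoc, mul_sub, ← Real.exp_add]
    have : c * t + (μ - c) * t = μ * t := by ring
    rw [this]
    have : 0 < μ - c := sub_pos.2 h
    gcongr
    linarith [Real.exp_pos (c * t)]
  · exact Continuous.integrableOn_Icc (by fun_prop)
  · exact ae_of_all _ fun s => by positivity

/-- Convolving `exp((q+l)s)` with `exp(qs)` costs a factor `1/l`, so each jump contributes `2/l`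
once the growth rate is raised from `q` to `q + l`. The parameter `l` trades decay in the number of
jumps against growth in time. A path with `n ≤ N` jumps sees only sites with `|z| ≤ N`. -/
lemma tsum_killedKernel_le {ξ : ℤ → ℝ} {A : Set ℤ} {N : ℕ} {q l : ℝ} (hl : 0 < l)
    (hq : ∀ z ∈ A, z.natAbs ≤ N → ξ z ≤ q) {n : ℕ} (hn : n ≤ N) {t : ℝ} (ht : 0 ≤ t) :
    ∑' z, killedKernel ξ A n z t ≤ ENNReal.ofReal ((2 / l) ^ n * Real.exp ((q + l) * t)) := by
  classical
  induction n generalizing t with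
  | zero =>
    rw [tsum_eq_single 0 fun z hz => by rw [killedKernel_of_lt ξ A (by omega)]; rfl]
    rw [killedKernel, Set.indicator_apply]
    split_ifs with h
    · rw [expKer, Set.indicator_of_mem (by exact ht)]
      apply ENNReal.ofReal_le_ofReal
      have := hq 0 h (Nat.zero_le _)
      rw [pow_zero, one_mul]
      gcongr
      linarith
    · exact zero_le
    · exact zero_le
  | succ n ih =>
    have h1 : ∀ z, killedKernel ξ A (n + 1) z t = A.indicator (fun z => ∫⁻ s in Set.Icc 0 t,
        (killedKernel ξ A n (z + 1) s + killedKernel ξ A n (z - 1) s) *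
        ENNReal.ofReal (Real.exp ((ξ z - 2) * (t - s)))) z := by
      intro z
      rw [Set.indicator_apply]
      split_ifs with h
      · exact killedKernel_succ_apply ξ n h t
      · rw [killedKernel_of_notMem ξ _ h]; rfl
    simp_rw [h1]
    refine (tsum_convolution_le (q := q) (fun z => measurable_killedKernel ξ A n z) ?_ t).trans ?_
    · intro z hz
      rcases le_or_gt z.natAbs N with h | h
      · exact Or.inl (hq z hz h)
      · exact Or.inr ⟨killedKernel_of_lt ξ A (by omega), killedKernel_of_lt ξ A (by omega)⟩
    calc _ ≤ ∫⁻ s in Set.Icc 0 t, ENNReal.ofReal (2 * (2 / l) ^ n) *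
          (ENNReal.ofReal (Real.exp ((q + l) * s)) * ENNReal.ofReal (Real.exp (q * (t - s)))) := by
          refine setLIntegral_mono' measurableSet_Icc fun s hs => ?_
          have h2 := ih (by omega) hs.1
          have h3 : Real.exp ((q - 2) * (t - s)) ≤ Real.exp (q * (t - s)) := by
            gcongr
            · linarith [hs.2]
            · linarith
          calc _ ≤ 2 * ENNReal.ofReal ((2 / l) ^ n * Real.exp ((q + l) * s))
                * ENNReal.ofReal (Real.exp (q * (t - s))) := by gcongr
            _ = _ := by
              rw [ENNReal.ofReal_mul (p := 2) zero_le_two, ENNReal.ofReal_mul (by positivity)]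
              simp only [ENNReal.ofReal_ofNat]
              ring
      _ = ENNReal.ofReal (2 * (2 / l) ^ n) * ∫⁻ s in Set.Icc 0 t,
          (ENNReal.ofReal (Real.exp ((q + l) * s)) * ENNReal.ofReal (Real.exp (q * (t - s)))) :=
          lintegral_const_mul _ (by fun_prop)
      _ ≤ ENNReal.ofReal (2 * (2 / l) ^ n) * ENNReal.ofReal (Real.exp ((q + l) * t) / (q + l - q)) := by
          gcongr
          exact lintegral_exp_mul_exp_le (by linarith) t
      _ = _ := by
          rw [← ENNReal.ofReal_mul (by positivity)]
          congr 1
          rw [add_sub_cancel_left, pow_succ]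
          ring

lemma totalMass_eq_tsum (ξ : ℤ → ℝ) {t : ℝ} (ht : 0 ≤ t) :
    totalMass ξ t = ∑' n, ∑' z, killedKernel ξ Set.univ n z t := by
  rw [totalMass, ENNReal.tsum_comm]
  exact tsum_congr fun z => solution_eq_tsum ξ ht z

/-- Sublinear growth dominated by linear growth. -/
lemma exists_rpow_le_add {β : ℝ} (hβ0 : 0 ≤ β) (hβ1 : β < 1) (D : ℝ) {e : ℝ} (he : 0 < e) :
    ∃ E : ℝ, ∀ x : ℝ, 0 ≤ x → D * (1 + x) ^ β ≤ e * x + E := by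
  rcases le_or_gt D 0 with hD | hD
  · refine ⟨0, fun x hx => ?_⟩
    have h1 : 0 ≤ (1 + x) ^ β := Real.rpow_nonneg (by linarith) _
    nlinarith [mul_nonneg he.le hx]
  have h1 : ∀ᶠ y : ℝ in atTop, y ^ (-(1 - β)) < e / D :=
    (tendsto_rpow_neg_atTop (sub_pos.2 hβ1)).eventually_lt_const (by positivity)
  obtain ⟨Y, hY⟩ := eventually_atTop.1 h1
  refine ⟨e + D * (max Y 1) ^ β, fun x hx => ?_⟩
  have hx1 : 0 < 1 + x := by linarith
  have hpos : 0 ≤ D * (max Y 1) ^ β := by positivity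
  rcases le_or_gt Y (1 + x) with h | h
  · have h2 : (1 + x) ^ β = (1 + x) ^ (-(1 - β)) * (1 + x) := by
      rw [← Real.rpow_add_one hx1.ne']; congr 1; ring
    have h3 := (lt_div_iff₀ hD).1 (hY (1 + x) h)
    rw [h2]
    nlinarith
  · have h2 : (1 + x) ^ β ≤ (max Y 1) ^ β := by
      gcongr
      exact h.le.trans (le_max_left _ _)
    nlinarith [mul_nonneg he.le hx]

/-- The choice `l = 2e` gives a factor `e^(-n)` to the paths with `n` jumps, while sublinearity
bounds the gain `T C (1+n)^β` by `n/2 + E`. What remains is a geometric series. -/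
lemma exists_totalMass_le {ξ : ℤ → ℝ} {β C : ℝ} (hβ0 : 0 ≤ β) (hβ1 : β < 1) (hC : 0 ≤ C)
    (hξ : ∀ z : ℤ, ξ z ≤ C * (1 + |(z : ℝ)|) ^ β) (T : ℝ) :
    ∃ K : ℝ≥0∞, K ≠ ∞ ∧ ∀ t, 0 ≤ t → t ≤ T → totalMass ξ t ≤ K := by
  rcases lt_or_ge T 0 with hT | hT
  · exact ⟨0, by simp, fun t h1 h2 => by linarith⟩
  obtain ⟨E, hE⟩ := exists_rpow_le_add hβ0 hβ1 (T * C) (e := 1 / 2) (by norm_num)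
  set l : ℝ := 2 * Real.exp 1
  have hl : 0 < l := by positivity
  refine ⟨∑' n : ℕ, ENNReal.ofReal (Real.exp (E + l * T) * Real.exp (-1 / 2) ^ n), ?_, ?_⟩
  · rw [← ENNReal.ofReal_tsum_of_nonneg (fun n => by positivity)]
    · exact ENNReal.ofReal_ne_top
    · exact (summable_geometric_of_lt_one (Real.exp_pos _).le
        (Real.exp_lt_one_iff.2 (by norm_num))).mul_left _
  · intro t h0 h1
    rw [totalMass_eq_tsum ξ h0]
    refine ENNReal.tsum_le_tsum fun n => ?_
    refine (tsum_killedKernel_le (N := n) (q := C * (1 + n) ^ β) hl ?_ le_rfl h0).trans ?_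
    · intro z _ hz
      refine (hξ z).trans ?_
      have : |(z : ℝ)| ≤ n := by
        rw [← Int.cast_abs, Int.abs_eq_natAbs]; exact_mod_cast hz
      gcongr
    · apply ENNReal.ofReal_le_ofReal
      have h2 : (2 / l) = Real.exp (-1) := by
        simp only [l]; rw [Real.exp_neg]; field_simp
      rw [h2, ← Real.exp_nat_mul, ← Real.exp_nat_mul, ← Real.exp_add, ← Real.exp_add]
      apply Real.exp_le_exp.2
      have h3 := hE n (Nat.cast_nonneg n)
      have h4 : (C * (1 + (n : ℝ)) ^ β + l) * t ≤ (C * (1 + (n : ℝ)) ^ β + l) * T := by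
        gcongr
      nlinarith

/-! ### The Cauchy problem -/

/-- The Duhamel formula for the Feynman–Kac solution. -/
lemma solution_duhamel (ξ : ℤ → ℝ) {t : ℝ} (ht : 0 ≤ t) (z : ℤ) :
    solution ξ t z = (if z = 0 then ENNReal.ofReal (Real.exp ((ξ z - 2) * t)) else 0) +
      ∫⁻ s in Set.Icc 0 t, (solution ξ s (z + 1) + solution ξ s (z - 1)) *
        ENNReal.ofReal (Real.exp ((ξ z - 2) * (t - s))) := by
  rw [solution_eq_tsum ξ ht, tsum_eq_zero_add' ENNReal.summable]
  congr 1
  · rw [killedKernel, Set.indicator_univ]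
    split_ifs
    · rw [expKer, Set.indicator_of_mem (by exact ht)]
    · rfl
  · simp_rw [fun n => killedKernel_succ_apply ξ n (Set.mem_univ z) t]
    rw [← lintegral_tsum fun n => by fun_prop]
    refine setLIntegral_congr_fun measurableSet_Icc fun s hs => ?_
    rw [ENNReal.tsum_mul_right, ENNReal.tsum_add, solution_eq_tsum ξ hs.1, solution_eq_tsum ξ hs.1]

lemma solution_le_totalMass (ξ : ℤ → ℝ) (t : ℝ) (z : ℤ) : solution ξ t z ≤ totalMass ξ t :=
  ENNReal.le_tsum z

/-- Duhamel's formula bootstraps regularity: local boundedness makes the source integrable, so each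
`u(·,z)` is continuous; then the source is continuous and `u(·,z)` is differentiable. -/
theorem isCauchySolution_of_totalMass_le {ξ : ℤ → ℝ}
    (hb : ∀ T, ∃ K : ℝ≥0∞, K ≠ ∞ ∧ ∀ t, 0 ≤ t → t ≤ T → totalMass ξ t ≤ K) :
    IsCauchySolution ξ (fun t z => (solution ξ t z).toReal) := by
  have hfin : ∀ t, 0 ≤ t → ∀ z, solution ξ t z ≠ ∞ := by
    intro t ht z
    obtain ⟨K, hK, h⟩ := hb t
    exact ne_top_of_le_ne_top hK ((solution_le_totalMass ξ t z).trans (h t ht le_rfl))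
  -- The kernel series represents the solution, and gives its measurability in time, only for `t ≥
  -- 0`; hence the truncation.
  set v : ℤ → ℝ → ℝ := fun z => (Set.Ici 0).indicator fun t => (solution ξ t z).toReal with hv
  have hv_of : ∀ z t, 0 ≤ t → v z t = (solution ξ t z).toReal := fun z t ht =>
    Set.indicator_of_mem (by exact ht) _
  have hvm : ∀ z, Measurable (v z) := by
    intro z
    have : v z = (Set.Ici 0).indicator fun t => (∑' n, killedKernel ξ Set.univ n z t).toReal := by
      ext t
      simp only [hv, Set.indicator_apply]
      split_ifs with h
      · rw [solution_eq_tsum ξ h]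
      · rfl
    rw [this]
    exact Measurable.indicator (by fun_prop) measurableSet_Ici
  have hvi : ∀ z a b, IntervalIntegrable (v z) volume a b := by
    intro z a b
    obtain ⟨K, hK, h⟩ := hb (max a b)
    rw [intervalIntegrable_iff]
    refine Measure.integrableOn_of_bounded (M := K.toReal) (by simp) (hvm z).aestronglyMeasurable ?_
    rw [ae_restrict_iff' measurableSet_uIoc]
    refine ae_of_all _ fun s hs => ?_
    rcases lt_or_ge s 0 with h0 | h0
    · simp [hv, h0]
    · rw [hv_of z s h0, Real.norm_of_nonneg ENNReal.toReal_nonneg]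
      exact ENNReal.toReal_mono hK ((solution_le_totalMass ξ s z).trans (h s h0 hs.2))
  set g : ℤ → ℝ → ℝ := fun z s => (v (z + 1) s + v (z - 1) s) * Real.exp (-((ξ z - 2) * s)) with hg
  have hgi : ∀ z a b, IntervalIntegrable (g z) volume a b := fun z a b =>
    ((hvi _ a b).add (hvi _ a b)).mul_continuousOn (by fun_prop)
  have hgn : ∀ z s, 0 ≤ s → 0 ≤ g z s := by
    intro z s hs
    simp only [hg]
    rw [hv_of _ _ hs, hv_of _ _ hs]
    positivity
  set V : ℤ → ℝ → ℝ := fun z t =>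
    Real.exp ((ξ z - 2) * t) * ((if z = 0 then 1 else 0) + ∫ s in (0 : ℝ)..t, g z s) with hV
  have hVc : ∀ z, Continuous (V z) := fun z =>
    (by fun_prop : Continuous fun t : ℝ => Real.exp ((ξ z - 2) * t)).mul
      (continuous_const.add (intervalIntegral.continuous_primitive (hgi z) 0))
  have hVe : ∀ z t, 0 ≤ t → (solution ξ t z).toReal = V z t := by
    intro z t ht
    have h1 : ∫⁻ s in Set.Icc 0 t, (solution ξ s (z + 1) + solution ξ s (z - 1)) *
        ENNReal.ofReal (Real.exp ((ξ z - 2) * (t - s)))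
        = ENNReal.ofReal (Real.exp ((ξ z - 2) * t) * ∫ s in (0 : ℝ)..t, g z s) := by
      rw [← intervalIntegral.integral_const_mul, intervalIntegral.integral_of_le ht,
        ← integral_Icc_eq_integral_Ioc, ofReal_integral_eq_lintegral_ofReal]
      · refine setLIntegral_congr_fun measurableSet_Icc fun s hs => ?_
        simp only [hg]
        rw [hv_of _ _ hs.1, hv_of _ _ hs.1, mul_comm (Real.exp _), mul_assoc, ← Real.exp_add,
          ENNReal.ofReal_mul (by positivity), ENNReal.ofReal_add (by positivity) (by positivity),
          ENNReal.ofReal_toReal (hfin s hs.1 _), ENNReal.ofReal_toReal (hfin s hs.1 _)]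
        congr 3; ring
      · rw [← IntegrableOn, integrableOn_Icc_iff_integrableOn_Ioc,
          ← intervalIntegrable_iff_integrableOn_Ioc_of_le ht]
        exact (hgi z 0 t).const_mul _
      · rw [EventuallyLE, ae_restrict_iff' measurableSet_Icc]
        exact ae_of_all _ fun s hs => mul_nonneg (Real.exp_pos _).le (hgn z s hs.1)
    have h2 : 0 ≤ ∫ s in (0 : ℝ)..t, g z s :=
      intervalIntegral.integral_nonneg ht fun s hs => hgn z s hs.1
    rw [solution_duhamel ξ ht, h1, ENNReal.toReal_add (by split_ifs <;> simp) ENNReal.ofReal_ne_top,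
      ENNReal.toReal_ofReal (by positivity)]
    simp only [hV]
    split_ifs
    · rw [ENNReal.toReal_ofReal (Real.exp_pos _).le]; ring
    · simp
  refine ⟨fun z => ?_, fun z => ?_, fun t ht z => ?_⟩
  · rw [hVe z 0 le_rfl]; simp [hV]
  · exact (hVc z).continuousWithinAt.congr (fun s hs => hVe z s hs) (hVe z 0 le_rfl)
  · have hcont : ∀ y, ContinuousAt (v y) t := by
      intro y
      refine (hVc y).continuousAt.congr ?_
      filter_upwards [Ioi_mem_nhds ht] with s hs
      rw [hv_of y s (le_of_lt hs), hVe y s (le_of_lt hs)]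
    have hgc : ContinuousAt (g z) t := ((hcont _).add (hcont _)).mul (by fun_prop)
    have hd1 : HasDerivAt (fun t => ∫ s in (0 : ℝ)..t, g z s) (g z t) t :=
      intervalIntegral.integral_hasDerivAt_right (hgi z 0 t)
        (((hvm _).add (hvm _)).mul (by fun_prop)).stronglyMeasurable.stronglyMeasurableAtFilter hgc
    have hd2 : HasDerivAt (fun t : ℝ => Real.exp ((ξ z - 2) * t))
        (Real.exp ((ξ z - 2) * t) * (ξ z - 2)) t := by
      simpa using ((hasDerivAt_id t).const_mul (ξ z - 2)).exp
    have hd := hd2.mul (hd1.const_add (if z = 0 then 1 else 0))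
    have hd' := hd.congr_of_eventuallyEq (f₁ := fun s => (solution ξ s z).toReal) (by
      filter_upwards [Ioi_mem_nhds ht] with s hs
      exact hVe z s (le_of_lt hs))
    refine hd'.congr_deriv ?_
    rw [laplacian, hVe z t ht.le]
    simp only [hV, hg]
    rw [hv_of _ t ht.le, hv_of _ t ht.le]
    have hexp : Real.exp ((ξ z - 2) * t) * Real.exp (-((ξ z - 2) * t)) = 1 := by
      rw [← Real.exp_add]; simp
    linear_combination ((solution ξ t (z + 1)).toReal + (solution ξ t (z - 1)).toReal) * hexp

/-! ### Mass away from a set of high sites -/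

/-- The contribution to the Feynman–Kac formula of the paths from `0` to `z ∉ W` with `n` jumps
that visit `W`. -/
def hitKernel (ξ : ℤ → ℝ) (W : Set ℤ) : ℕ → ℤ → ℝ → ℝ≥0∞
  | 0 => 0
  | n + 1 => Wᶜ.indicator fun z =>
      ((hitKernel ξ W n (z + 1) + W.indicator (killedKernel ξ Set.univ n) (z + 1)) +
        (hitKernel ξ W n (z - 1) + W.indicator (killedKernel ξ Set.univ n) (z - 1)))
        ⋆ₗ expKer (ξ z - 2)

@[fun_prop]
lemma measurable_indicator_killedKernel (ξ : ℤ → ℝ) (W : Set ℤ) (n : ℕ) (z : ℤ) :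
    Measurable (W.indicator (killedKernel ξ Set.univ n) z) := by
  classical
  rw [Set.indicator_apply]; split_ifs
  · fun_prop
  · exact measurable_const

@[fun_prop]
lemma measurable_hitKernel (ξ : ℤ → ℝ) (W : Set ℤ) (n : ℕ) (z : ℤ) :
    Measurable (hitKernel ξ W n z) := by
  classical
  induction n generalizing z with
  | zero => exact measurable_const
  | succ n ih =>
    rw [hitKernel, Set.indicator_apply]; split_ifs
    · exact measurable_lconvolution _ (((ih _).add (by fun_prop)).add ((ih _).add (by fun_prop)))
        (by fun_prop)
    · exact measurable_const

/-- A path either avoids `W`, or visits it and ends outside, or ends in it. For an endpoint outside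
`W`, conditioning on the last jump reproduces the same trichotomy at the neighbours. -/
lemma killedKernel_univ_eq_add (ξ : ℤ → ℝ) (W : Set ℤ) (n : ℕ) (z : ℤ) :
    killedKernel ξ Set.univ n z = killedKernel ξ Wᶜ n z +
      (hitKernel ξ W n z + W.indicator (killedKernel ξ Set.univ n) z) := by
  induction n generalizing z with
  | zero =>
    by_cases hz : z ∈ W
    · rw [killedKernel_of_notMem ξ (A := Wᶜ) 0 (by simpa using hz), Set.indicator_of_mem hz, hitKernel]
      simp
    · rw [Set.indicator_of_notMem hz, hitKernel, killedKernel, killedKernel, Set.indicator_univ,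
        Set.indicator_of_mem (by simpa using hz)]
      simp
  | succ n ih =>
    by_cases hz : z ∈ W
    · rw [killedKernel_of_notMem ξ (A := Wᶜ) _ (by simpa using hz), Set.indicator_of_mem hz, hitKernel,
        Set.indicator_of_notMem (by simpa using hz)]
      simp
    · have hz' : z ∈ Wᶜ := hz
      rw [Set.indicator_of_notMem hz, hitKernel, Set.indicator_of_mem hz', add_zero, killedKernel,
        killedKernel, Set.indicator_univ, Set.indicator_of_mem hz',
        ← lconvolution_add_left (by fun_prop) (by fun_prop)]
      congr 1
      conv_lhs => rw [ih (z + 1), ih (z - 1)]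
      abel

lemma hitKernel_of_lt (ξ : ℤ → ℝ) (W : Set ℤ) {n : ℕ} {z : ℤ} (hz : n < z.natAbs) :
    hitKernel ξ W n z + W.indicator (killedKernel ξ Set.univ n) z = 0 := by
  have h := killedKernel_univ_eq_add ξ W n z
  rw [killedKernel_of_lt ξ _ hz, killedKernel_of_lt ξ _ hz, zero_add] at h
  exact h.symm

lemma hitKernel_of_neg (ξ : ℤ → ℝ) (W : Set ℤ) (n : ℕ) (z : ℤ) {t : ℝ} (ht : t < 0) :
    (hitKernel ξ W n z + W.indicator (killedKernel ξ Set.univ n) z) t = 0 := by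
  have h := congrFun (killedKernel_univ_eq_add ξ W n z) t
  rw [Pi.add_apply, killedKernel_of_neg ξ _ _ _ ht, killedKernel_of_neg ξ _ _ _ ht, zero_add] at h
  exact h.symm

/-- The mass of the solution on `W`. -/
def massOn (ξ : ℤ → ℝ) (W : Set ℤ) (t : ℝ) : ℝ≥0∞ := ∑' z, W.indicator (solution ξ t) z

/-- The walk may simply stay at `x` during `[s,t]`, which has weight `exp((ξ x - 2)(t-s))`. So
`exp(-(ξ x - 2)t) u(t,x)` is nondecreasing, and earlier mass on `W` is controlled by the mass at the
final time. -/
lemma solution_le_exp_mul (ξ : ℤ → ℝ) {s t : ℝ} (hs : 0 ≤ s) (hst : s ≤ t) (x : ℤ) :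
    solution ξ s x ≤ ENNReal.ofReal (Real.exp ((ξ x - 2) * (s - t))) * solution ξ t x := by
  rw [solution_duhamel ξ hs, solution_duhamel ξ (hs.trans hst), mul_add]
  have hexp : ∀ r : ℝ, ENNReal.ofReal (Real.exp ((ξ x - 2) * (s - t))) *
      ENNReal.ofReal (Real.exp ((ξ x - 2) * (t - r)))
      = ENNReal.ofReal (Real.exp ((ξ x - 2) * (s - r))) := by
    intro r
    rw [← ENNReal.ofReal_mul (Real.exp_pos _).le, ← Real.exp_add]
    congr 2; ring
  gcongr
  · split_ifs
    · have := hexp 0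
      rw [sub_zero, sub_zero] at this
      rw [this]
    · exact zero_le
  · rw [← lintegral_const_mul' _ _ ENNReal.ofReal_ne_top]
    refine (lintegral_mono_set (Set.Icc_subset_Icc_right hst)).trans' ?_
    refine lintegral_mono fun r => ?_
    rw [mul_left_comm, hexp]

lemma massOn_le_exp_mul {ξ : ℤ → ℝ} {W : Set ℤ} {M : ℝ} (hM : ∀ x ∈ W, ξ x = M) {s t : ℝ}
    (hs : 0 ≤ s) (hst : s ≤ t) :
    massOn ξ W s ≤ ENNReal.ofReal (Real.exp ((M - 2) * (s - t))) * massOn ξ W t := by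
  rw [massOn, massOn, ← ENNReal.tsum_mul_left]
  refine ENNReal.tsum_le_tsum fun z => ?_
  by_cases hz : z ∈ W
  · rw [Set.indicator_of_mem hz, Set.indicator_of_mem hz, ← hM z hz]
    exact solution_le_exp_mul ξ hs hst z
  · rw [Set.indicator_of_notMem hz]; exact zero_le

lemma sum_tsum_indicator_killedKernel_le (ξ : ℤ → ℝ) (W : Set ℤ) (m : ℕ) {s : ℝ} (hs : 0 ≤ s) :
    ∑ n ∈ Finset.range m, ∑' z, W.indicator (killedKernel ξ Set.univ n) z s ≤ massOn ξ W s := by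
  refine (ENNReal.sum_le_tsum _).trans ?_
  rw [ENNReal.tsum_comm, massOn]
  refine ENNReal.tsum_le_tsum fun z => ?_
  by_cases hz : z ∈ W
  · simp_rw [Set.indicator_of_mem hz]
    rw [solution_eq_tsum ξ hs]
  · simp_rw [Set.indicator_of_notMem hz]
    simp

/-- Mass that leaves `W` grows at a rate smaller by `d` than mass on `W`, so integrating over the
time of the last jump yields `1/d`. The `4` is two neighbours times two sources: mass sitting on
`W`, and mass that left it earlier, which by induction and `4 ≤ d` is no larger. The weight at time
`s` is kept in the bound because the induction integrates over `s`. -/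
lemma sum_tsum_hitKernel_le {ξ : ℤ → ℝ} {W : Set ℤ} {M d : ℝ} (hM : ∀ x ∈ W, ξ x = M) (hd : 4 ≤ d)
    {t : ℝ} {m : ℕ} (hm : ∀ z : ℤ, z.natAbs ≤ m → z ∉ W → ξ z ≤ M - d) {s : ℝ} (hs : 0 ≤ s)
    (hst : s ≤ t) :
    ∑ n ∈ Finset.range (m + 1), ∑' z, hitKernel ξ W n z s
      ≤ ENNReal.ofReal (4 / d) *
        (ENNReal.ofReal (Real.exp ((M - 2) * (s - t))) * massOn ξ W t) := by
  have hd0 : 0 < d := by linarith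
  induction m generalizing s with
  | zero => simp [hitKernel]
  | succ m ih =>
    rw [Finset.sum_range_succ']
    have h0 : ∑' z, hitKernel ξ W 0 z s = 0 := by simp [hitKernel]
    rw [h0, add_zero]
    set f : ℕ → ℤ → ℝ → ℝ≥0∞ := fun n z =>
      hitKernel ξ W n z + W.indicator (killedKernel ξ Set.univ n) z with hf
    have hfm : ∀ n z, Measurable (f n z) := fun n z => by simp only [hf]; fun_prop
    have hstep : ∀ n ∈ Finset.range (m + 1), ∑' z, hitKernel ξ W (n + 1) z s
        ≤ ∫⁻ r in Set.Icc 0 s, 2 * (∑' z, f n z r) *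
          ENNReal.ofReal (Real.exp ((M - d - 2) * (s - r))) := by
      intro n hn
      have hn' : n ≤ m := Finset.mem_range_succ_iff.1 hn
      refine le_trans (le_of_eq ?_) (tsum_convolution_le (ξ := ξ) (A := Wᶜ) (q := M - d)
        (hfm n) ?_ s)
      · refine tsum_congr fun z => ?_
        by_cases hz : z ∈ Wᶜ
        · rw [hitKernel, Set.indicator_of_mem hz, Set.indicator_of_mem hz, lconvolution_expKer]
          · rfl
          · intro r hr
            rw [Pi.add_apply, hitKernel_of_neg ξ W n _ hr, hitKernel_of_neg ξ W n _ hr, add_zero]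
        · rw [hitKernel, Set.indicator_of_notMem hz, Set.indicator_of_notMem hz]; rfl
      · intro z hz
        rcases le_or_gt z.natAbs (m + 1) with h | h
        · exact Or.inl (hm z h hz)
        · exact Or.inr ⟨hitKernel_of_lt ξ W (by omega), hitKernel_of_lt ξ W (by omega)⟩
    refine (Finset.sum_le_sum hstep).trans ?_
    rw [← lintegral_finsetSum _ fun n _ => by
      exact ((Measurable.tsum (hfm n)).const_mul 2).mul (by fun_prop)]
    set B := massOn ξ W t
    have hInteg : ∀ r ∈ Set.Icc 0 s, ∑ n ∈ Finset.range (m + 1), 2 * (∑' z, f n z r) *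
          ENNReal.ofReal (Real.exp ((M - d - 2) * (s - r)))
        ≤ (4 * ENNReal.ofReal (Real.exp (-(M - 2) * t)) * B) *
          (ENNReal.ofReal (Real.exp ((M - 2) * r)) *
            ENNReal.ofReal (Real.exp ((M - d - 2) * (s - r)))) := by
      intro r hr
      have hrt : r ≤ t := hr.2.trans hst
      have e1 : ENNReal.ofReal (Real.exp ((M - 2) * (r - t)))
          = ENNReal.ofReal (Real.exp (-(M - 2) * t)) * ENNReal.ofReal (Real.exp ((M - 2) * r)) := by
        rw [← ENNReal.ofReal_mul (Real.exp_pos _).le, ← Real.exp_add]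
        congr 2; ring
      have h1 := ih (fun z hz => hm z (by omega)) hr.1 hrt
      have h2 := (sum_tsum_indicator_killedKernel_le ξ W (m + 1) hr.1).trans
        (massOn_le_exp_mul hM hr.1 hrt)
      have h3 : ∑ n ∈ Finset.range (m + 1), ∑' z, f n z r
          ≤ 2 * (ENNReal.ofReal (Real.exp ((M - 2) * (r - t))) * B) := by
        simp only [hf, Pi.add_apply, ENNReal.tsum_add, Finset.sum_add_distrib]
        rw [two_mul]
        refine add_le_add (h1.trans ?_) h2
        -- Here `4 ≤ d` closes the induction: mass off `W` does not exceed mass on `W`.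
        refine mul_le_of_le_one_left zero_le ?_
        rw [ENNReal.ofReal_le_one, div_le_one hd0]
        exact hd
      rw [← Finset.sum_mul, ← Finset.mul_sum]
      calc _ ≤ 2 * (2 * (ENNReal.ofReal (Real.exp ((M - 2) * (r - t))) * B)) *
            ENNReal.ofReal (Real.exp ((M - d - 2) * (s - r))) := by gcongr
        _ = _ := by rw [e1]; ring
    refine (setLIntegral_mono' measurableSet_Icc hInteg).trans ?_
    rw [lintegral_const_mul _ (by fun_prop)]
    calc _ ≤ (4 * ENNReal.ofReal (Real.exp (-(M - 2) * t)) * B) *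
          ENNReal.ofReal (Real.exp ((M - 2) * s) / (M - 2 - (M - d - 2))) := by
          gcongr
          exact lintegral_exp_mul_exp_le (by linarith) s
      _ = _ := by
          have e2 : M - 2 - (M - d - 2) = d := by ring
          have e3 : (4 : ℝ≥0∞) = ENNReal.ofReal 4 := by simp
          have e4 : ENNReal.ofReal 4 * ENNReal.ofReal (Real.exp (-(M - 2) * t)) *
              ENNReal.ofReal (Real.exp ((M - 2) * s) / d)
              = ENNReal.ofReal (4 / d) * ENNReal.ofReal (Real.exp ((M - 2) * (s - t))) := by
            rw [← ENNReal.ofReal_mul (by norm_num), ← ENNReal.ofReal_mul (by positivity),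
              ← ENNReal.ofReal_mul (by positivity)]
            congr 1
            rw [show (M - 2) * (s - t) = -(M - 2) * t + (M - 2) * s by ring, Real.exp_add]
            ring
          rw [e2, e3, ← mul_assoc, ← e4]
          ring

/-- Paths that avoid `W` are governed by `Q n` alone. Paths that visit `W` and leave fall under the
preceding estimate as long as no site off `W` within reach comes within `d` of `M`. Beyond such a
distance, `M` itself is at most `Q n + d`, so the crude bound applies to all paths at once; this is
the source of `2 * d`. -/
theorem massOn_compl_le {ξ : ℤ → ℝ} {W : Set ℤ} {M d : ℝ} (hM : ∀ x ∈ W, ξ x = M) (hd : 4 ≤ d)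
    {Q : ℕ → ℝ} (hQ : ∀ n : ℕ, ∀ z : ℤ, z ∉ W → z.natAbs ≤ n → ξ z ≤ Q n) {t : ℝ} (ht : 0 ≤ t) :
    massOn ξ Wᶜ t ≤ ENNReal.ofReal (4 / d) * massOn ξ W t +
      ∑' n, ENNReal.ofReal ((2 / d) ^ n * Real.exp ((Q n + 2 * d) * t)) := by
  classical
  have hd0 : 0 < d := by linarith
  set good : ℕ → Prop := fun m => ∀ z : ℤ, z.natAbs ≤ m → z ∉ W → ξ z ≤ M - d with hgood
  have h1 : massOn ξ Wᶜ t = ∑' n, ∑' z, Wᶜ.indicator (fun z => killedKernel ξ Set.univ n z t) z := by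
    rw [ENNReal.tsum_comm, massOn]
    refine tsum_congr fun z => ?_
    by_cases hz : z ∈ Wᶜ
    · simp_rw [Set.indicator_of_mem hz]
      rw [solution_eq_tsum ξ ht]
    · simp_rw [Set.indicator_of_notMem hz]; simp
  have h2 : ∀ n, ∑' z, Wᶜ.indicator (fun z => killedKernel ξ Set.univ n z t) z
      ≤ (if good n then ∑' z, hitKernel ξ W n z t else 0) +
        ENNReal.ofReal ((2 / d) ^ n * Real.exp ((Q n + 2 * d) * t)) := by
    intro n
    split_ifs with hg
    · calc _ ≤ ∑' z, (hitKernel ξ W n z t + killedKernel ξ Wᶜ n z t) := by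
            refine ENNReal.tsum_le_tsum fun z => ?_
            by_cases hz : z ∈ Wᶜ
            · rw [Set.indicator_of_mem hz, killedKernel_univ_eq_add ξ W n z,
                Set.indicator_of_notMem hz, add_zero, Pi.add_apply, add_comm]
            · rw [Set.indicator_of_notMem hz]; exact zero_le
        _ ≤ _ := by
            rw [ENNReal.tsum_add]
            gcongr
            refine (tsum_killedKernel_le (N := n) (q := Q n) hd0 (fun z hz hn => hQ n z hz hn) le_rfl
              ht).trans ?_
            gcongr
            linarith
    · rw [zero_add]
      simp only [hgood, not_forall, not_le] at hg
      obtain ⟨y, hy1, hy2, hy3⟩ := hg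
      have hy4 := hQ n y hy2 hy1
      refine (ENNReal.tsum_le_tsum fun z => Set.indicator_le_self _ _ z).trans ?_
      refine (tsum_killedKernel_le (N := n) (q := Q n + d) hd0 (fun z _ hn => ?_) le_rfl ht).trans ?_
      · by_cases hz : z ∈ W
        · rw [hM z hz]; linarith
        · linarith [hQ n z hz hn]
      · rw [add_assoc, ← two_mul]
  have h3 : ∀ N, ∑ n ∈ Finset.range N, (if good n then ∑' z, hitKernel ξ W n z t else 0)
      ≤ ENNReal.ofReal (4 / d) * massOn ξ W t := by
    intro N
    -- `good` is inherited by smaller indices, so the sum effectively stops at the last good index,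
    -- where `sum_tsum_hitKernel_le` bounds all the terms together.
    induction N with
    | zero => simp
    | succ N ih =>
      by_cases hg : good N
      · have hle := sum_tsum_hitKernel_le hM hd hg ht le_rfl
        rw [sub_self, mul_zero, Real.exp_zero, ENNReal.ofReal_one, one_mul] at hle
        refine le_trans (Finset.sum_le_sum fun n _ => ?_) hle
        split_ifs
        · exact le_rfl
        · exact zero_le
      · rw [Finset.sum_range_succ, if_neg hg, add_zero]; exact ih
  rw [h1]
  refine (ENNReal.tsum_le_tsum h2).trans ?_
  rw [ENNReal.tsum_add]
  gcongr
  exact ENNReal.tsum_le_of_sum_range_le h3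

/-! ### The contribution of the direct path -/

/-- The potential is nonnegative, so dropping it leaves the probability that a walk makes `k`
prescribed steps by time `t`: the Poisson weight `exp(-2t) t^k / k!`. -/
lemma le_killedKernel_direct {ξ : ℤ → ℝ} (hξ : ∀ z, 0 ≤ ξ z) {σ : ℤ} (hσ : σ = 1 ∨ σ = -1) (k : ℕ)
    {t : ℝ} (ht : 0 ≤ t) :
    ENNReal.ofReal (Real.exp (-2 * t) * (t ^ k / k.factorial))
      ≤ killedKernel ξ Set.univ k (σ * k) t := by
  induction k generalizing t with
  | zero =>
    rw [killedKernel, Set.indicator_univ]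
    simp only [Nat.cast_zero, mul_zero, if_true, expKer]
    rw [Set.indicator_of_mem (by exact ht)]
    simp only [pow_zero, Nat.factorial_zero, Nat.cast_one, div_one, mul_one]
    gcongr
    linarith [hξ 0]
  | succ k ih =>
    rw [killedKernel_succ_apply ξ k (Set.mem_univ _)]
    have hy : ∀ s, killedKernel ξ Set.univ k (σ * k) s
        ≤ killedKernel ξ Set.univ k (σ * (k + 1 : ℕ) + 1) s
          + killedKernel ξ Set.univ k (σ * (k + 1 : ℕ) - 1) s := by
      intro s
      rcases hσ with rfl | rfl
      · refine le_trans (le_of_eq ?_) le_add_self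
        congr 1; push_cast; ring
      · refine le_trans (le_of_eq ?_) le_self_add
        congr 1; push_cast; ring
    calc ENNReal.ofReal (Real.exp (-2 * t) * (t ^ (k + 1) / (k + 1).factorial))
        = ∫⁻ s in Set.Icc 0 t, ENNReal.ofReal (Real.exp (-2 * t) * (s ^ k / k.factorial)) := by
          rw [← ofReal_integral_eq_lintegral_ofReal]
          · congr 1
            rw [integral_Icc_eq_integral_Ioc, ← intervalIntegral.integral_of_le ht,
              intervalIntegral.integral_const_mul, intervalIntegral.integral_div, integral_pow,
              Nat.factorial_succ]
            push_cast
            field_simp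
            simp
          · exact Continuous.integrableOn_Icc (by fun_prop)
          · rw [EventuallyLE, ae_restrict_iff' measurableSet_Icc]
            refine ae_of_all _ fun s hs => ?_
            have := hs.1
            simp only [Pi.zero_apply]
            positivity
      _ ≤ _ := by
          refine setLIntegral_mono' measurableSet_Icc fun s hs => ?_
          have h1 := (ih hs.1).trans (hy s)
          refine le_trans ?_ (mul_le_mul_left h1 _)
          rw [← ENNReal.ofReal_mul (mul_nonneg (Real.exp_pos _).le
            (div_nonneg (pow_nonneg hs.1 _) (Nat.cast_nonneg _)))]
          apply ENNReal.ofReal_le_ofReal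
          have h2 : Real.exp (-2 * t) ≤ Real.exp (-2 * s) *
              Real.exp ((ξ (σ * (k + 1 : ℕ)) - 2) * (t - s)) := by
            rw [← Real.exp_add]
            apply Real.exp_le_exp.2
            nlinarith [mul_nonneg (hξ (σ * (k + 1 : ℕ))) (sub_nonneg.2 hs.2)]
          calc _ ≤ (Real.exp (-2 * s) * Real.exp ((ξ (σ * (k + 1 : ℕ)) - 2) * (t - s))) *
                (s ^ k / k.factorial) := by
                have := hs.1
                gcongr
            _ = _ := by ring

/-- Run straight to the neighbour of `z`, make the last jump in the time window `[a, 2a]` with `a =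
|z|/ξ(z)`, then stay at `z`. This value of `a` balances the lost time `a ξ(z)` against the entropy
`|z| log(1/a)`; hypothesis `h` says that the window fits into `[0,t]`. -/
theorem le_solution {ξ : ℤ → ℝ} (hξ : ∀ z, 0 ≤ ξ z) {z : ℤ} {t : ℝ} (ht : 0 ≤ t) (hz : 0 < ξ z)
    (h : 2 * |(z : ℝ)| ≤ ξ z * t) :
    ENNReal.ofReal (Real.exp (t * ξ z - |(z : ℝ)| * Real.log (ξ z) - 2 * t - 2 * |(z : ℝ)|))
      ≤ solution ξ t z := by
  obtain ⟨σ, hσ, hzσ⟩ : ∃ σ : ℤ, (σ = 1 ∨ σ = -1) ∧ z = σ * z.natAbs := by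
    rcases le_total 0 z with h0 | h0
    · exact ⟨1, Or.inl rfl, by omega⟩
    · exact ⟨-1, Or.inr rfl, by omega⟩
  have habs : |(z : ℝ)| = z.natAbs := by
    rw [← Int.cast_abs, Int.abs_eq_natAbs]; rfl
  rw [solution_eq_tsum ξ ht]
  refine le_trans ?_ (ENNReal.le_tsum z.natAbs)
  rw [habs] at h ⊢
  generalize hk : z.natAbs = n at *
  cases n with
  | zero =>
    rw [killedKernel, Set.indicator_univ]
    have h0 : z = 0 := by omega
    subst h0
    simp only [if_true, expKer]
    rw [Set.indicator_of_mem (by exact ht)]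
    apply ENNReal.ofReal_le_ofReal
    apply Real.exp_le_exp.2
    simp only [Nat.cast_zero]
    linarith
  | succ k =>
    rw [killedKernel_succ_apply ξ k (Set.mem_univ _)]
    set M := ξ z
    set a : ℝ := ((k + 1 : ℕ) : ℝ) / M with ha
    have ha0 : 0 < a := by positivity
    have haM : a * M = ((k + 1 : ℕ) : ℝ) := by rw [ha]; field_simp
    have hat : 2 * a ≤ t := by
      have : 2 * a * M ≤ t * M := by rw [mul_assoc, haM]; linarith
      exact le_of_mul_le_mul_right this hz
    have hy : ∀ s, killedKernel ξ Set.univ k (σ * k) s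
        ≤ killedKernel ξ Set.univ k (z + 1) s + killedKernel ξ Set.univ k (z - 1) s := by
      intro s
      rcases hσ with rfl | rfl
      · refine le_trans (le_of_eq ?_) le_add_self
        congr 1; omega
      · refine le_trans (le_of_eq ?_) le_self_add
        congr 1; omega
    set c : ℝ := Real.exp (-2 * t) * (a ^ k / k.factorial) * Real.exp (M * (t - 2 * a)) with hc
    calc _ ≤ ENNReal.ofReal (c * a) := by
          apply ENNReal.ofReal_le_ofReal
          have h1 : Real.exp (((k + 1 : ℕ) : ℝ) * Real.log M) = M ^ (k + 1) := by
            rw [Real.exp_nat_mul, Real.exp_log hz]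
          -- Since `a M = k + 1`, the weight `a^(k+1)/k!` equals `M^(-(k+1))` times this quotient,
          -- so no Stirling estimate is needed.
          have h2 : (1 : ℝ) ≤ ((k + 1 : ℕ) : ℝ) ^ (k + 1) / k.factorial := by
            rw [one_le_div (by positivity)]
            exact_mod_cast (Nat.factorial_le (Nat.le_succ k)).trans (Nat.factorial_le_pow (k + 1))
          have h3 : c * a = Real.exp (-2 * t) * Real.exp (M * (t - 2 * a)) *
              (((k + 1 : ℕ) : ℝ) ^ (k + 1) / k.factorial) / M ^ (k + 1) := by
            rw [← haM, mul_pow, hc]; field_simp; ring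
          rw [h3, show t * M - ((k + 1 : ℕ) : ℝ) * Real.log M - 2 * t - 2 * ((k + 1 : ℕ) : ℝ)
            = -2 * t + M * (t - 2 * a) - ((k + 1 : ℕ) : ℝ) * Real.log M by rw [← haM]; ring,
            Real.exp_sub, Real.exp_add, h1]
          have h4 : 0 < Real.exp (-2 * t) * Real.exp (M * (t - 2 * a)) := by positivity
          exact div_le_div_of_nonneg_right (le_mul_of_one_le_right h4.le h2) (by positivity)
      _ = ∫⁻ s in Set.Icc a (2 * a), ENNReal.ofReal c := by
          rw [setLIntegral_const, Real.volume_Icc, ← ENNReal.ofReal_mul (by positivity)]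
          congr 2; ring
      _ ≤ ∫⁻ s in Set.Icc a (2 * a), (killedKernel ξ Set.univ k (z + 1) s +
            killedKernel ξ Set.univ k (z - 1) s) * ENNReal.ofReal (Real.exp ((M - 2) * (t - s))) := by
          refine setLIntegral_mono' measurableSet_Icc fun s hs => ?_
          have hs0 : 0 ≤ s := ha0.le.trans hs.1
          have h1 := (le_killedKernel_direct hξ hσ k hs0).trans (hy s)
          refine le_trans ?_ (mul_le_mul_left h1 _)
          rw [← ENNReal.ofReal_mul (by positivity)]
          apply ENNReal.ofReal_le_ofReal
          have h2 : Real.exp (-2 * t) * Real.exp (M * (t - 2 * a))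
              ≤ Real.exp (-2 * s) * Real.exp ((M - 2) * (t - s)) := by
            rw [← Real.exp_add, ← Real.exp_add]
            apply Real.exp_le_exp.2
            nlinarith [mul_le_mul_of_nonneg_left hs.2 hz.le]
          calc c = (Real.exp (-2 * t) * Real.exp (M * (t - 2 * a))) * (a ^ k / k.factorial) := by
                rw [hc]; ring
            _ ≤ (Real.exp (-2 * s) * Real.exp ((M - 2) * (t - s))) * (s ^ k / k.factorial) := by
                have := hs.1
                gcongr
            _ = _ := by ring
      _ ≤ _ := lintegral_mono_set (Set.Icc_subset_Icc ha0.le hat)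

/-! ### Deterministic localisation -/

lemma natAbs_le_cast {z : ℤ} {n : ℕ} (h : z.natAbs ≤ n) : |(z : ℝ)| ≤ n := by
  rw [← Int.cast_abs, Int.abs_eq_natAbs]; exact_mod_cast h

/-- If every site outside `W` is much worse than those of `W` for the functional `Psi`, then `W`
carries almost all the mass. The numbers `a`, `r`, `L` stand for the scales of the potential, of the
space and for `log t`. -/
lemma massOn_compl_le_of_gap {ξ : ℤ → ℝ} {W : Set ℤ} {z₀ : ℤ}
    {t a r L K β κ c θ E R ε : ℝ} (hz₀ : z₀ ∈ W)
    (hW : ∀ x ∈ W, ξ x = ξ z₀) (hξ1 : ∀ z, 1 ≤ ξ z)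
    (hgrow : ∀ z : ℤ, ξ z ≤ K * a * (1 + |(z : ℝ)| / r) ^ β)
    (htop : c * a ≤ Psi ξ t z₀) (hgap : ∀ y ∉ W, Psi ξ t y ≤ Psi ξ t z₀ - κ * a)
    (ht : 0 < t) (ha : 0 < a) (hr : 0 < r) (hL : 0 < L) (hrL : r * L = a * t) (hβ : 0 ≤ β)
    (hK : 0 < K) (hκ : 0 < κ) (hκc : κ ≤ c / 2) (hθ : 0 < θ) (hε : 0 < ε) (hE0 : 0 ≤ E)
    (hE : ∀ x : ℝ, 0 ≤ x → K * (1 + x) ^ β ≤ θ / 4 * x + E) (hR : R * θ = 4 * E)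
    (n1 : θ * L ≤ Real.log (κ / 8 * a / 2)) (n2 : 2 * R ≤ c * L)
    (n3 : 4 ≤ κ / 8 * a) (n3' : 4 / (κ / 8 * a) ≤ ε / 2)
    (n4 : R * |Real.log (4 * K * (1 + R) ^ β / (κ / 8))| ≤ κ / 4 * L)
    (n5 : Real.log 2 ≤ θ / 2 * L)
    (n6 : 2 * t + 2 * (R * r) + Real.log (4 / ε) ≤ κ / 2 * (a * t)) :
    massOn ξ Wᶜ t ≤ ENNReal.ofReal ε * massOn ξ W t := by
  set M := ξ z₀ with hM
  set Ψ := Psi ξ t z₀ with hΨ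
  -- The gap `κ a t` is budgeted in quarters: one pays for `2 d t`, one for the logarithms in the
  -- near range of `n`, and a half remains as the decisive gain.
  set d := κ / 8 * a with hd
  have hd0 : 0 < d := by positivity
  have hR0 : 0 ≤ R := by
    by_contra h
    nlinarith [not_le.1 h]
  have hc : 0 < c := by linarith
  have hM1 : 1 ≤ M := hξ1 z₀
  have hat : 0 < a * t := mul_pos ha ht
  have hΨM : Ψ = M - |(z₀ : ℝ)| / t * Real.log M := rfl
  have hlogM0 : 0 ≤ Real.log M := Real.log_nonneg hM1
  have hMc : c * a ≤ M := by
    have : 0 ≤ |(z₀ : ℝ)| / t * Real.log M := by positivity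
    linarith
  have hlogM : θ * L ≤ Real.log M := by
    refine n1.trans (Real.log_le_log (by positivity) ?_)
    have : κ / 8 * a / 2 ≤ c * a := by
      rw [mul_div_right_comm]; gcongr; linarith
    linarith
  -- the distance of the top site
  have hZ : |(z₀ : ℝ)| ≤ R * r := by
    set x := |(z₀ : ℝ)| / r with hx
    have hx0 : 0 ≤ x := by positivity
    have hxr : |(z₀ : ℝ)| = x * r := by rw [hx]; field_simp
    have h1 : |(z₀ : ℝ)| / t * Real.log M ≤ K * a * (1 + x) ^ β := by
      have h2 := hgrow z₀
      have h3 : 0 < c * a := by positivity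
      linarith
    have h2 : |(z₀ : ℝ)| / t * (θ * L) ≤ a * (θ / 4 * x + E) := by
      calc _ ≤ |(z₀ : ℝ)| / t * Real.log M := by gcongr
        _ ≤ a * (K * (1 + x) ^ β) := by linarith
        _ ≤ _ := by gcongr; exact hE x hx0
    have h3 : |(z₀ : ℝ)| / t * (θ * L) = a * (θ * x) := by
      rw [hxr, div_mul_eq_mul_div, div_eq_iff ht.ne']
      linear_combination (x * θ) * hrL
    rw [h3] at h2
    have h4 : θ * x ≤ θ / 4 * x + E := le_of_mul_le_mul_left h2 ha
    rw [hxr]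
    gcongr
    nlinarith [mul_nonneg hθ.le hx0]
  -- lower bound
  have hlow : ENNReal.ofReal (Real.exp (t * Ψ - 2 * t - 2 * (R * r))) ≤ massOn ξ W t := by
    have h1 : 2 * |(z₀ : ℝ)| ≤ ξ z₀ * t := by
      calc 2 * |(z₀ : ℝ)| ≤ 2 * R * r := by linarith
        _ ≤ c * L * r := by gcongr
        _ = c * a * t := by linear_combination c * hrL
        _ ≤ _ := by gcongr
    have h2 := le_solution (fun z => zero_le_one.trans (hξ1 z)) ht.le (by linarith) h1
    refine le_trans ?_ (h2.trans ?_)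
    · apply ENNReal.ofReal_le_ofReal
      apply Real.exp_le_exp.2
      have h3 : t * Ψ = t * M - |(z₀ : ℝ)| * Real.log M := by
        rw [hΨM]; field_simp
      rw [h3]
      linarith
    · refine le_trans (le_of_eq ?_) (ENNReal.le_tsum z₀)
      rw [Set.indicator_of_mem hz₀]
  -- upper bound
  set G : ℕ → ℝ := fun n => K * a * (1 + n / r) ^ β with hG
  -- The growth bound serves for large `n`. The other bound solves the gap inequality for `ξ`, with
  -- the logarithm estimated by the growth bound; it serves for `n` up to order `r`.
  set Q : ℕ → ℝ := fun n => min (G n) (Ψ - κ * a + n / t * Real.log (G n)) with hQdef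
  have hQ : ∀ n : ℕ, ∀ z : ℤ, z ∉ W → z.natAbs ≤ n → ξ z ≤ Q n := by
    intro n z hz hzn
    have hzn' := natAbs_le_cast hzn
    have h1 : ξ z ≤ G n := by
      refine (hgrow z).trans ?_
      simp only [hG]
      gcongr
    refine le_min h1 ?_
    have h2 := hgap z hz
    have h3 : |(z : ℝ)| / t * Real.log (ξ z) ≤ n / t * Real.log (G n) := by
      have h4 : Real.log (ξ z) ≤ Real.log (G n) :=
        Real.log_le_log (by linarith [hξ1 z]) h1
      have h5 : 0 ≤ Real.log (ξ z) := Real.log_nonneg (hξ1 z)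
      gcongr
    have h4 : Psi ξ t z = ξ z - |(z : ℝ)| / t * Real.log (ξ z) := rfl
    linarith
  have hterm : ∀ n : ℕ, (2 / d) ^ n * Real.exp ((Q n + 2 * d) * t)
      ≤ Real.exp (t * Ψ - κ / 2 * (a * t)) * (1 / 2) ^ n := by
    intro n
    have e1 : (2 / d) ^ n = Real.exp (-(n * Real.log (d / 2))) := by
      rw [Real.exp_neg, Real.exp_nat_mul, Real.exp_log (by positivity), ← inv_pow, inv_div]
    have e2 : (1 / 2 : ℝ) ^ n = Real.exp (-(n * Real.log 2)) := by
      rw [Real.exp_neg, Real.exp_nat_mul, Real.exp_log (by positivity), ← inv_pow, one_div]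
    rw [e1, e2, ← Real.exp_add, ← Real.exp_add]
    apply Real.exp_le_exp.2
    set x : ℝ := n / r with hx
    have hx0 : 0 ≤ x := by positivity
    have hxr : (n : ℝ) = x * r := by rw [hx]; field_simp
    have hdt : 2 * d * t = κ / 4 * (a * t) := by rw [hd]; ring
    -- For `n ≤ R r` both `G n` and `d` are of order `a`, so `(2/d)^n` cancels `n log (G n)` up to
    -- `O(r)`, negligible against `a t = r L`. For `n > R r` the growth is sublinear and `n log(d/2)
    -- ≥ θ n L` alone beats `Q n * t`.
    rcases le_or_gt x R with hxR | hxR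
    · have h1 : Q n * t ≤ t * Ψ - κ * (a * t) + n * Real.log (G n) := by
        calc Q n * t ≤ (Ψ - κ * a + n / t * Real.log (G n)) * t := by
              gcongr; exact min_le_right _ _
          _ = _ := by field_simp
      have h2 : Real.log (G n) - Real.log (d / 2) + Real.log 2
          ≤ |Real.log (4 * K * (1 + R) ^ β / (κ / 8))| := by
        have hGpos : 0 < G n := by simp only [hG]; positivity
        rw [← Real.log_div hGpos.ne' (by positivity), ← Real.log_mul (by positivity) (by norm_num)]
        refine le_trans (Real.log_le_log (by positivity) ?_) (le_abs_self _)
        have : G n / (d / 2) * 2 = 4 * K * (1 + x) ^ β / (κ / 8) := by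
          simp only [hG, hd, ← hx]; field_simp; norm_num
        rw [this]
        gcongr
      have h3 : n * (Real.log (G n) - Real.log (d / 2) + Real.log 2) ≤ κ / 4 * (a * t) := by
        calc _ ≤ (n : ℝ) * |Real.log (4 * K * (1 + R) ^ β / (κ / 8))| := by gcongr
          _ = r * (x * |Real.log (4 * K * (1 + R) ^ β / (κ / 8))|) := by rw [hxr]; ring
          _ ≤ r * (R * |Real.log (4 * K * (1 + R) ^ β / (κ / 8))|) := by gcongr
          _ ≤ r * (κ / 4 * L) := by gcongr
          _ = _ := by linear_combination (κ / 4) * hrL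
      linarith
    · have h1 : Q n * t ≤ (θ / 4 * x + E) * (r * L) := by
        calc Q n * t ≤ G n * t := by gcongr; exact min_le_left _ _
          _ = (K * (1 + x) ^ β) * (a * t) := by simp only [hG, ← hx]; ring
          _ ≤ (θ / 4 * x + E) * (a * t) := by gcongr; exact hE x hx0
          _ = _ := by rw [hrL]
      have h2 : E ≤ θ / 4 * x := by
        have : R * θ ≤ x * θ := by gcongr
        linarith
      have h3 : Q n * t ≤ θ / 2 * (n * L) := by
        calc Q n * t ≤ (θ / 4 * x + E) * (r * L) := h1
          _ ≤ (θ / 4 * x + θ / 4 * x) * (r * L) := by gcongr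
          _ = _ := by rw [hxr]; ring
      have h4 : (n : ℝ) * (θ * L) ≤ n * Real.log (d / 2) := by gcongr
      have h5 : (n : ℝ) * Real.log 2 ≤ n * (θ / 2 * L) := by gcongr
      have h6 : c * (a * t) ≤ t * Ψ := by
        calc c * (a * t) = t * (c * a) := by ring
          _ ≤ _ := by gcongr
      have h7 : κ * (a * t) ≤ c / 2 * (a * t) := by gcongr
      have h8 : 0 < κ * (a * t) := by positivity
      linarith
  have hsum : ∑' n, ENNReal.ofReal ((2 / d) ^ n * Real.exp ((Q n + 2 * d) * t))
      ≤ ENNReal.ofReal (ε / 2) * massOn ξ W t := by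
    calc _ ≤ ∑' n : ℕ, ENNReal.ofReal (Real.exp (t * Ψ - κ / 2 * (a * t)) * (1 / 2) ^ n) :=
          ENNReal.tsum_le_tsum fun n => ENNReal.ofReal_le_ofReal (hterm n)
      _ = ENNReal.ofReal (Real.exp (t * Ψ - κ / 2 * (a * t)) * 2) := by
          rw [← ENNReal.ofReal_tsum_of_nonneg (fun n => by positivity)
            (summable_geometric_two.mul_left _), tsum_mul_left, tsum_geometric_two]
      _ ≤ ENNReal.ofReal (ε / 2 * Real.exp (t * Ψ - 2 * t - 2 * (R * r))) := by
          apply ENNReal.ofReal_le_ofReal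
          have h1 : Real.exp (t * Ψ - κ / 2 * (a * t))
              ≤ Real.exp (t * Ψ - 2 * t - 2 * (R * r) - Real.log (4 / ε)) := by
            apply Real.exp_le_exp.2; linarith
          rw [Real.exp_sub _ (Real.log (4 / ε)), Real.exp_log (by positivity)] at h1
          calc _ ≤ Real.exp (t * Ψ - 2 * t - 2 * (R * r)) / (4 / ε) * 2 := by gcongr
            _ = _ := by field_simp; ring
      _ ≤ _ := by
          rw [ENNReal.ofReal_mul (by positivity)]
          gcongr
  calc massOn ξ Wᶜ t ≤ ENNReal.ofReal (4 / d) * massOn ξ W t +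
        ∑' n, ENNReal.ofReal ((2 / d) ^ n * Real.exp ((Q n + 2 * d) * t)) :=
        massOn_compl_le hW n3 hQ ht.le
    _ ≤ ENNReal.ofReal (ε / 2) * massOn ξ W t + ENNReal.ofReal (ε / 2) * massOn ξ W t := by
        gcongr
    _ = _ := by
        rw [← add_mul, ← ENNReal.ofReal_add (by positivity) (by positivity), add_halves]

/-! ### From the mass off the maximisers to the localised share. -/

lemma totalMass_eq_add (ξ : ℤ → ℝ) (W : Set ℤ) (t : ℝ) :
    totalMass ξ t = massOn ξ W t + massOn ξ Wᶜ t := by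
  rw [massOn, massOn, ← ENNReal.tsum_add, totalMass]
  refine tsum_congr fun z => ?_
  rw [Set.indicator_self_add_compl_apply]

lemma localisedShare_eq (ξ : ℤ → ℝ) (t : ℝ) :
    localisedShare ξ t = massOn ξ (maximisers ξ t) t /
      (massOn ξ (maximisers ξ t) t + massOn ξ (maximisers ξ t)ᶜ t) := by
  rw [← totalMass_eq_add, localisedShare, massOn, tsum_subtype (maximisers ξ t) (solution ξ t)]

lemma abs_localisedShare_sub_one_le {ξ : ℤ → ℝ} {t ε : ℝ} (hε : 0 < ε)
    (hfin : totalMass ξ t ≠ ∞) (hpos : totalMass ξ t ≠ 0)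
    (h : massOn ξ (maximisers ξ t)ᶜ t ≤ ENNReal.ofReal ε * massOn ξ (maximisers ξ t) t) :
    |(localisedShare ξ t).toReal - 1| ≤ ε := by
  rw [localisedShare_eq]
  rw [totalMass_eq_add ξ (maximisers ξ t)] at hfin hpos
  set B := massOn ξ (maximisers ξ t) t
  set C := massOn ξ (maximisers ξ t)ᶜ t
  have hB : B ≠ ∞ := fun hB => hfin (by simp [hB])
  have hC : C ≠ ∞ := fun hC => hfin (by simp [hC])
  have hB0 : B ≠ 0 := by
    intro hB0
    rw [hB0, mul_zero] at h
    exact hpos (by rw [hB0, nonpos_iff_eq_zero.1 h, add_zero])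
  have hBr : 0 < B.toReal := ENNReal.toReal_pos hB0 hB
  have hCr : C.toReal ≤ ε * B.toReal := by
    have := ENNReal.toReal_mono (ENNReal.mul_ne_top ENNReal.ofReal_ne_top hB) h
    rwa [ENNReal.toReal_mul, ENNReal.toReal_ofReal hε.le] at this
  have hC0 : 0 ≤ C.toReal := ENNReal.toReal_nonneg
  rw [ENNReal.toReal_div, ENNReal.toReal_add hB hC, abs_sub_comm, abs_of_nonneg]
  · rw [sub_le_iff_le_add, ← sub_le_iff_le_add', le_div_iff₀ (by linarith)]
    nlinarith
  · rw [sub_nonneg, div_le_one (by linarith)]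
    linarith

/-! ### Scales -/

/-- The scale of the maximum of `Psi` at time `t`. -/
def potScale (α t : ℝ) : ℝ := (t / Real.log t) ^ (1 / (α - 1))

/-- The spatial scale of the maximisers of `Psi` at time `t`. -/
def spaceScale (α t : ℝ) : ℝ := potScale α t ^ α

lemma tendsto_div_log_atTop : Tendsto (fun t : ℝ => t / Real.log t) atTop atTop := by
  have h : Tendsto (fun t : ℝ => Real.log t / t) atTop (𝓝[>] 0) := by
    refine tendsto_nhdsWithin_iff.2 ⟨?_, ?_⟩
    · simpa using Real.isLittleO_log_id_atTop.tendsto_div_nhds_zero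
    · filter_upwards [eventually_gt_atTop 1] with t ht
      exact div_pos (Real.log_pos ht) (by linarith)
  refine (tendsto_inv_nhdsGT_zero.comp h).congr fun t => ?_
  simp

lemma tendsto_potScale {α : ℝ} (hα : 1 < α) : Tendsto (potScale α) atTop atTop :=
  (tendsto_rpow_atTop (by have := sub_pos.2 hα; positivity)).comp tendsto_div_log_atTop

lemma potScale_pos (α : ℝ) {t : ℝ} (ht : 1 < t) : 0 < potScale α t :=
  Real.rpow_pos_of_pos (div_pos (by linarith) (Real.log_pos ht)) _

/-- The balance that fixes both scales: `r = a^α` is the range over which values of order `a` occur,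
and `a^(α-1) = t/log t` makes the cost `(r/t) log t` of travelling that far comparable with `a`. -/
lemma spaceScale_mul_log {α t : ℝ} (hα : 1 < α) (ht : 1 < t) :
    spaceScale α t * Real.log t = potScale α t * t := by
  have hl := Real.log_pos ht
  have hpos : 0 < t / Real.log t := div_pos (by linarith) hl
  have h1 : spaceScale α t = potScale α t * (t / Real.log t) := by
    have h2 : α = 1 + (α - 1) := by ring
    have h3 : potScale α t ^ (α - 1) = t / Real.log t := by
      rw [potScale, ← Real.rpow_mul hpos.le, one_div, inv_mul_cancel₀ (sub_pos.2 hα).ne',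
        Real.rpow_one]
    rw [spaceScale, ← h3, ← Real.rpow_one_add' (potScale_pos α ht).le (by linarith), ← h2]
  rw [h1]; field_simp

lemma tendsto_spaceScale {α : ℝ} (hα : 1 < α) : Tendsto (spaceScale α) atTop atTop :=
  (tendsto_rpow_atTop (by linarith)).comp (tendsto_potScale hα)

/-- The true order is `log t/(α-1)`; the factor `2` in the lower bound absorbs the correction `log
log t`. -/
lemma eventually_log_potScale {α : ℝ} (hα : 1 < α) :
    ∀ᶠ t in atTop, Real.log t / (2 * (α - 1)) ≤ Real.log (potScale α t) ∧
      Real.log (potScale α t) ≤ Real.log t / (α - 1) := by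
  have h1 : ∀ᶠ t : ℝ in atTop, Real.log t ≤ t ^ (1 / 2 : ℝ) := by
    filter_upwards [(isLittleO_log_rpow_atTop (r := 1 / 2) (by norm_num)).bound one_pos,
      eventually_gt_atTop 1] with t h ht
    rw [one_mul, Real.norm_of_nonneg (Real.log_pos ht).le,
      Real.norm_of_nonneg (Real.rpow_nonneg (by linarith) _)] at h
    exact h
  have h2 : ∀ᶠ t : ℝ in atTop, 1 ≤ Real.log t := Real.tendsto_log_atTop.eventually_ge_atTop 1
  filter_upwards [h1, h2, eventually_gt_atTop 1] with t h1 h2 ht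
  have hα1 : 0 < α - 1 := sub_pos.2 hα
  have ht0 : 0 < t := by linarith
  have hl : 0 < Real.log t := by linarith
  rw [potScale, Real.log_rpow (by positivity), Real.log_div ht0.ne' hl.ne']
  have h3 : Real.log (Real.log t) ≤ 1 / 2 * Real.log t := by
    rw [← Real.log_rpow ht0]
    exact Real.log_le_log hl h1
  have h4 : 0 ≤ Real.log (Real.log t) := Real.log_nonneg h2
  constructor
  · rw [div_le_iff₀ (by positivity)]
    have : 1 / (α - 1) * (Real.log t - Real.log (Real.log t)) * (2 * (α - 1))
        = 2 * (Real.log t - Real.log (Real.log t)) := by field_simp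
    rw [this]; linarith
  · rw [one_div, div_eq_inv_mul]
    gcongr
    linarith

/-! ### Good realisations of the auxiliary field -/

/-- The value of `Psi` at `z` when the potential there is `x`. -/
def level (t : ℝ) (z : ℤ) (x : ℝ) : ℝ := x - |(z : ℝ)| / t * Real.log x

lemma level_neg (t : ℝ) (z : ℤ) (x : ℝ) : level t (-z) x = level t z x := by simp [level]

/-- The site whose auxiliary value is used by the potential at `z`. -/
def source (b : ℕ → Bool) : ℤ → ℤ
  | Int.ofNat n => n
  | Int.negSucc n => if b n = true then (n : ℤ) + 1 else -((n : ℤ) + 1)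

lemma potential_eq (f : ℤ → ℝ) (b : ℕ → Bool) (z : ℤ) : potential f b z = f (source b z) := by
  cases z with
  | ofNat n => rfl
  | negSucc n => simp only [potential, source]; split_ifs <;> rfl

lemma source_eq_or (b : ℕ → Bool) (z : ℤ) : source b z = z ∨ source b z = -z := by
  cases z with
  | ofNat n => exact Or.inl rfl
  | negSucc n =>
    simp only [source]
    split_ifs
    · right; omega
    · left; omega

lemma natAbs_source (b : ℕ → Bool) (z : ℤ) : (source b z).natAbs = z.natAbs := by
  rcases source_eq_or b z with h | h <;> rw [h]
  exact Int.natAbs_neg z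

lemma abs_source (b : ℕ → Bool) (z : ℤ) : |((source b z : ℤ) : ℝ)| = |(z : ℝ)| := by
  rcases source_eq_or b z with h | h <;> simp [h]

lemma source_natCast (b : ℕ → Bool) (n : ℕ) : source b n = n := rfl

lemma source_succ (b : ℕ → Bool) (n : ℕ) : source b ((n : ℤ) + 1) = (n : ℤ) + 1 :=
  source_natCast b (n + 1)

lemma source_neg_succ (b : ℕ → Bool) (n : ℕ) :
    source b (-((n : ℤ) + 1)) = if b n = true then (n : ℤ) + 1 else -((n : ℤ) + 1) := by
  rw [← Int.negSucc_eq]; rfl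

/-- Since `Ψ` depends on `z` only through `|z|` and the value there, it factors through the source.
Duplicated sites tie exactly, and all comparisons reduce to levels of the independent field. -/
lemma psi_potential (f : ℤ → ℝ) (b : ℕ → Bool) (t : ℝ) (z : ℤ) :
    Psi (potential f b) t z = level t (source b z) (f (source b z)) := by
  rw [Psi, level, potential_eq, abs_source]

/-- The typical properties of the auxiliary field at time `t`. -/
structure IsGoodField (α β c K κ t : ℝ) (f : ℤ → ℝ) : Prop where
  one_le : ∀ z, 1 ≤ f z
  growth : ∀ z : ℤ, f z ≤ K * potScale α t * (1 + |(z : ℝ)| / spaceScale α t) ^ β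
  even : ∃ n : ℕ, c * potScale α t ≤ level t ((2 * n : ℕ) : ℤ) (f ((2 * n : ℕ) : ℤ))
  odd : ∃ n : ℕ, c * potScale α t ≤ level t ((2 * n + 1 : ℕ) : ℤ) (f ((2 * n + 1 : ℕ) : ℤ))
  gap : ∀ x y : ℤ, x ≠ y → c / 2 * potScale α t ≤ level t x (f x) →
    c / 2 * potScale α t ≤ level t y (f y) → κ * potScale α t ≤ |level t x (f x) - level t y (f y)|
  not_both : ∀ x : ℤ, c / 2 * potScale α t ≤ level t x (f x) →
    ¬ c / 2 * potScale α t ≤ level t (-x) (f (-x))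

/-- The top of the functional `Psi` for the potential built from a good field. -/
structure IsTopSite (α c κ t : ℝ) (ξ : ℤ → ℝ) (z₀ : ℤ) : Prop where
  mem : z₀ ∈ maximisers ξ t
  value : ∀ x ∈ maximisers ξ t, ξ x = ξ z₀
  high : c * potScale α t ≤ Psi ξ t z₀
  gap : ∀ y ∉ maximisers ξ t, Psi ξ t y ≤ Psi ξ t z₀ - κ * potScale α t

lemma potential_growth {α β c K κ t : ℝ} {f : ℤ → ℝ} (hf : IsGoodField α β c K κ t f)
    (b : ℕ → Bool) (z : ℤ) :
    potential f b z ≤ K * potScale α t * (1 + |(z : ℝ)| / spaceScale α t) ^ β := by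
  rw [potential_eq, ← abs_source b z]; exact hf.growth _

/-- The gap separates distinct sources, so a near-tie between high sites is possible only by
duplication. -/
lemma IsGoodField.source_eq {α β c K κ t : ℝ} {f : ℤ → ℝ} (hf : IsGoodField α β c K κ t f)
    {b : ℕ → Bool} {x y : ℤ}
    (hx : c / 2 * potScale α t ≤ Psi (potential f b) t x)
    (hxy : |Psi (potential f b) t x - Psi (potential f b) t y| < κ * potScale α t)
    (hy : c / 2 * potScale α t ≤ Psi (potential f b) t y) : source b x = source b y := by
  by_contra h
  rw [psi_potential] at hx hy
  rw [psi_potential, psi_potential] at hxy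
  exact absurd (hf.gap _ _ h hx hy) (not_le.2 hxy)

/-- Sites with a high value of `Psi` are not far away. -/
lemma eventually_finite_high {α β c K : ℝ} (hα : 1 < α) (hβ0 : 0 ≤ β) (hβ1 : β < 1) (hc : 0 < c) :
    ∀ᶠ t in atTop, ∀ ξ : ℤ → ℝ,
      (∀ z : ℤ, ξ z ≤ K * potScale α t * (1 + |(z : ℝ)| / spaceScale α t) ^ β) →
      (∀ z, 1 ≤ ξ z) → {z : ℤ | c * potScale α t ≤ Psi ξ t z}.Finite := by
  filter_upwards [eventually_gt_atTop 1, (tendsto_potScale hα).eventually_ge_atTop (Real.exp 1 / c),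
    (tendsto_spaceScale hα).eventually_ge_atTop 1] with t ht ha hr ξ hgrow h1
  set a := potScale α t
  set r := spaceScale α t
  have ht0 : 0 < t := by linarith
  have ha0 : 0 < a := lt_of_lt_of_le (by positivity) ha
  have hr0 : 0 < r := by linarith
  obtain ⟨E, hE⟩ := exists_rpow_le_add hβ0 hβ1 (K * a) (e := r / (2 * t)) (by positivity)
  have hbound : ∀ z : ℤ, c * a ≤ Psi ξ t z → |(z : ℝ)| ≤ 2 * t * E := by
    intro z hz
    have hPsi : Psi ξ t z = ξ z - |(z : ℝ)| / t * Real.log (ξ z) := rfl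
    have hlog0 : 0 ≤ Real.log (ξ z) := Real.log_nonneg (h1 z)
    have hca : Real.exp 1 ≤ c * a := by rw [div_le_iff₀ hc] at ha; linarith
    have hξ : Real.exp 1 ≤ ξ z := by
      have : 0 ≤ |(z : ℝ)| / t * Real.log (ξ z) := by positivity
      linarith
    have hlog : 1 ≤ Real.log (ξ z) := by
      rw [Real.le_log_iff_exp_le (by linarith [h1 z])]; exact hξ
    have h3 : |(z : ℝ)| / t * 1 ≤ |(z : ℝ)| / t * Real.log (ξ z) := by gcongr
    have h4 := hE (|(z : ℝ)| / r) (by positivity)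
    have h5 := hgrow z
    have h6 : r / (2 * t) * (|(z : ℝ)| / r) = |(z : ℝ)| / t / 2 := by field_simp
    have h7 : 0 < Real.exp 1 := Real.exp_pos 1
    have h8 : |(z : ℝ)| / t ≤ 2 * E := by linarith
    rw [div_le_iff₀ ht0] at h8
    linarith
  refine (Set.finite_Icc (-⌈2 * t * E⌉) ⌈2 * t * E⌉).subset fun z hz => ?_
  have h := abs_le.1 (hbound z hz)
  constructor
  · have : -((⌈2 * t * E⌉ : ℤ) : ℝ) ≤ z := by linarith [Int.le_ceil (2 * t * E)]
    exact_mod_cast this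
  · have : (z : ℝ) ≤ ((⌈2 * t * E⌉ : ℤ) : ℝ) := by linarith [Int.le_ceil (2 * t * E)]
    exact_mod_cast this

/-- Finitely many sites are high and at least one is, since nonnegative sites always carry their own
auxiliary value. So the maximum is attained; anything closer to it than the gap shares its source
and is itself a maximiser. -/
lemma eventually_exists_isTopSite {α β c K κ : ℝ} (hα : 1 < α) (hβ0 : 0 ≤ β) (hβ1 : β < 1)
    (hc : 0 < c) (hκ : 0 < κ) (hκc : κ ≤ c / 2) :
    ∀ᶠ t in atTop, ∀ f : ℤ → ℝ, IsGoodField α β c K κ t f → ∀ b : ℕ → Bool,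
      ∃ z₀, IsTopSite α c κ t (potential f b) z₀ := by
  filter_upwards [eventually_finite_high (K := K) hα hβ0 hβ1 hc, eventually_gt_atTop 1]
    with t hfin ht f hf b
  have ha := potScale_pos α ht
  set ξ := potential f b with hξ
  have hfin' := hfin ξ (potential_growth hf b) fun z => by rw [hξ, potential_eq]; exact hf.one_le _
  obtain ⟨n, hn⟩ := hf.even
  have hne : {z : ℤ | c * potScale α t ≤ Psi ξ t z}.Nonempty := by
    refine ⟨((2 * n : ℕ) : ℤ), ?_⟩
    change c * potScale α t ≤ Psi ξ t _
    rw [hξ, psi_potential, source_natCast]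
    exact hn
  obtain ⟨z₀, hz₀, hmax⟩ := hfin'.exists_maximalFor (Psi ξ t) _ hne
  have hz₀' : c * potScale α t ≤ Psi ξ t z₀ := hz₀
  have htop : ∀ y, Psi ξ t y ≤ Psi ξ t z₀ := by
    intro y
    rcases le_or_gt (c * potScale α t) (Psi ξ t y) with h | h
    · by_contra hlt
      exact hlt (hmax h (not_le.1 hlt).le)
    · exact h.le.trans hz₀
  have hcc : c / 2 * potScale α t ≤ c * potScale α t := by gcongr; linarith
  refine ⟨z₀, htop, fun x hx => ?_, hz₀, fun y hy => ?_⟩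
  · have hxe : Psi ξ t x = Psi ξ t z₀ := le_antisymm (htop x) (hx z₀)
    rw [hξ, potential_eq, potential_eq]
    congr 1
    refine hf.source_eq (by rw [← hξ, hxe]; linarith) ?_ (by rw [← hξ]; linarith)
    rw [← hξ, hxe, sub_self, abs_zero]
    positivity
  · by_contra hlt
    rw [not_le] at hlt
    apply hy
    have hy1 : c / 2 * potScale α t ≤ Psi ξ t y := by
      have : κ * potScale α t ≤ c / 2 * potScale α t := by gcongr
      linarith
    have hs : source b y = source b z₀ := by
      refine hf.source_eq hy1 ?_ (by rw [← hξ]; linarith)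
      rw [← hξ, abs_sub_comm, abs_of_nonneg (by linarith [htop y])]
      linarith
    intro x
    have : Psi ξ t y = Psi ξ t z₀ := by rw [hξ, psi_potential, psi_potential, hs]
    rw [this]; exact htop x

/-- The threshold in `t` depends only on the constants, not on the field or the switches, which is
what convergence in probability requires. -/
theorem eventually_localisedShare {α β c K κ ε : ℝ} (hα : 1 < α) (hβ0 : 0 ≤ β) (hβ1 : β < 1)
    (hc : 0 < c) (hK : 0 < K) (hκ : 0 < κ) (hκc : κ ≤ c / 2) (hε : 0 < ε) :
    ∀ᶠ t in atTop, ∀ f : ℤ → ℝ, IsGoodField α β c K κ t f → ∀ b : ℕ → Bool,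
      |(localisedShare (potential f b) t).toReal - 1| ≤ ε := by
  have hα1 : 0 < α - 1 := sub_pos.2 hα
  -- With this value `log (potScale α t) ≥ 2 θ log t`, and half of it absorbs the constant `log
  -- (κ/16)`.
  set θ : ℝ := 1 / (4 * (α - 1)) with hθ
  have hθ0 : 0 < θ := by positivity
  obtain ⟨E, hE⟩ : ∃ E : ℝ, 0 ≤ E ∧ ∀ x : ℝ, 0 ≤ x → K * (1 + x) ^ β ≤ θ / 4 * x + E := by
    obtain ⟨E, hE⟩ := exists_rpow_le_add hβ0 hβ1 K (e := θ / 4) (by positivity)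
    exact ⟨max E 0, le_max_right _ _, fun x hx => (hE x hx).trans (by gcongr; exact le_max_left _ _)⟩
  -- Beyond `R` the constant `E` is at most `θ/4 * x`, so the linear term dominates.
  set R : ℝ := 4 * E / θ with hR
  have hlog := Real.tendsto_log_atTop
  have hpot := tendsto_potScale hα
  filter_upwards [eventually_exists_isTopSite (K := K) hα hβ0 hβ1 hc hκ hκc, eventually_gt_atTop 1,
    (tendsto_spaceScale hα).eventually_ge_atTop 1, eventually_log_potScale hα,
    hlog.eventually_ge_atTop (-Real.log (κ / 8 / 2) / θ), hlog.eventually_ge_atTop (2 * R / c),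
    hpot.eventually_ge_atTop (32 / κ), hpot.eventually_ge_atTop (64 / (κ * ε)),
    hlog.eventually_ge_atTop (R * |Real.log (4 * K * (1 + R) ^ β / (κ / 8))| / (κ / 4)),
    hlog.eventually_ge_atTop (Real.log 2 / (θ / 2)), hlog.eventually_ge_atTop (2 * R / (κ / 8)),
    hpot.eventually_ge_atTop (2 / (κ / 8)), hpot.eventually_ge_atTop (Real.log (4 / ε) / (κ / 8)),
    hlog.eventually_gt_atTop 0]
    with t htop ht hr1 hla n1 n2 n3 n3' n4 n5 n6 n6' n6'' hL f hf b
  obtain ⟨z₀, hz₀⟩ := htop f hf b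
  set a := potScale α t
  set r := spaceScale α t
  set L := Real.log t
  have ha := potScale_pos α ht
  have hξ1 : ∀ z, 1 ≤ potential f b z := fun z => by rw [potential_eq]; exact hf.one_le _
  have hrL : r * L = a * t := spaceScale_mul_log hα ht
  have hr0 : 0 < r := by linarith
  rw [div_le_iff₀ (by positivity)] at n1 n2 n3 n3' n4 n5 n6 n6' n6''
  have hmass : massOn (potential f b) (maximisers (potential f b) t)ᶜ t
      ≤ ENNReal.ofReal ε * massOn (potential f b) (maximisers (potential f b) t) t := by
    refine massOn_compl_le_of_gap hz₀.mem hz₀.value hξ1 (potential_growth hf b) hz₀.high hz₀.gap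
      (by linarith) ha hr0 hL hrL hβ0 hK hκ hκc hθ0 hε hE.1 hE.2 (R := R)
      (by rw [hR]; field_simp) ?_ (by linarith) (by linarith) ?_ (by linarith) (by linarith) ?_
    · rw [show κ / 8 * potScale α t / 2 = κ / 8 / 2 * potScale α t by ring,
        Real.log_mul (by positivity) ha.ne']
      have h1 : L / (2 * (α - 1)) = 2 * (θ * L) := by rw [hθ]; field_simp; norm_num
      have h2 := hla.1
      rw [h1] at h2
      linarith
    · rw [div_le_iff₀ (by positivity)]
      have : 64 ≤ a * (κ * ε) := n3'
      linarith
    · have h1 : 2 * t ≤ a * (κ / 8) * t := by gcongr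
      have h2 : 2 * (R * r) ≤ κ / 8 * (a * t) := by
        rw [← hrL]
        calc 2 * (R * r) = (2 * R) * r := by ring
          _ ≤ (L * (κ / 8)) * r := by gcongr
          _ = _ := by ring
      have h3 : Real.log (4 / ε) ≤ a * (κ / 8) * t := by
        refine n6''.trans (le_mul_of_one_le_right (by positivity) ht.le)
      have h4 : 0 < a * t := by positivity
      have h5 : 0 < κ * (a * t) := by positivity
      nlinarith
  have hfin : totalMass (potential f b) t ≠ ∞ := by
    obtain ⟨B, hB, h⟩ := exists_totalMass_le (ξ := potential f b) (C := K * a) hβ0 hβ1 (by positivity)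
      (fun z => (potential_growth hf b z).trans (by
        gcongr
        exact div_le_self (abs_nonneg _) hr1)) t
    exact ne_top_of_le_ne_top hB (h t (by linarith) le_rfl)
  have hpos : totalMass (potential f b) t ≠ 0 := by
    have h1 := solution_le_totalMass (potential f b) t 0
    have h2 := le_solution (ξ := potential f b) (z := 0) (t := t)
      (fun z => zero_le_one.trans (hξ1 z)) (by linarith) (zero_lt_one.trans_le (hξ1 0))
      (by simpa using mul_nonneg (zero_le_one.trans (hξ1 0)) (by linarith))
    intro h0
    rw [h0] at h1
    have h3 := ENNReal.ofReal_eq_zero.1 (nonpos_iff_eq_zero.1 (h2.trans h1))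
    exact absurd h3 (not_le.2 (Real.exp_pos _))
  exact abs_localisedShare_sub_one_le hε hfin hpos hmass

/-! ### Pareto estimates -/

lemma paretoMeasure_Ici {α x : ℝ} (hα : 0 < α) (hx : 1 ≤ x) :
    paretoMeasure 1 α (Set.Ici x) = ENNReal.ofReal (x ^ (-α)) := by
  have hx0 : 0 < x := by linarith
  rw [paretoMeasure, withDensity_apply _ measurableSet_Ici, ← setLIntegral_congr Ioi_ae_eq_Ici]
  have h1 : ∫⁻ y in Set.Ioi x, paretoPDF 1 α y
      = ∫⁻ y in Set.Ioi x, ENNReal.ofReal (α * y ^ (-(α + 1))) := by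
    refine setLIntegral_congr_fun measurableSet_Ioi fun y hy => ?_
    have : (1 : ℝ) ≤ y := hx.trans (le_of_lt hy)
    simp [paretoPDF_of_le this]
  rw [h1, ← ofReal_integral_eq_lintegral_ofReal]
  · congr 1
    rw [integral_const_mul, integral_Ioi_rpow_of_lt (by linarith) hx0]
    rw [show -(α + 1) + 1 = -α by ring]
    field_simp
  · exact (integrableOn_Ioi_rpow_of_lt (by linarith) hx0).const_mul _
  · rw [EventuallyLE, ae_restrict_iff' measurableSet_Ioi]
    refine ae_of_all _ fun y hy => ?_
    have : 0 < y := hx0.trans hy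
    simp only [Pi.zero_apply]
    positivity

lemma paretoMeasure_Iio_one {α : ℝ} : paretoMeasure 1 α (Set.Iio 1) = 0 := by
  rw [paretoMeasure, withDensity_apply _ measurableSet_Iio]
  exact lintegral_paretoPDF_of_le le_rfl

lemma paretoMeasure_Icc_le {α x y : ℝ} (hα : 0 < α) (hx : 0 < x) :
    paretoMeasure 1 α (Set.Icc x y) ≤ ENNReal.ofReal (α * x ^ (-(α + 1)) * (y - x)) := by
  rw [paretoMeasure, withDensity_apply _ measurableSet_Icc]
  calc _ ≤ ∫⁻ _ in Set.Icc x y, ENNReal.ofReal (α * x ^ (-(α + 1))) := by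
        refine setLIntegral_mono' measurableSet_Icc fun u hu => ?_
        rw [paretoPDF_eq]
        apply ENNReal.ofReal_le_ofReal
        split_ifs
        · rw [Real.one_rpow, mul_one]
          gcongr ?_ * ?_
          exact Real.rpow_le_rpow_of_nonpos hx hu.1 (by linarith)
        · positivity
    _ = _ := by rw [setLIntegral_const, Real.volume_Icc, ← ENNReal.ofReal_mul (by positivity)]

/-! ### Summable spatial weights -/

/-- The weight `r⁻¹ (1 + |z| / r)^(-γ)`. -/
def weight (γ r : ℝ) (z : ℤ) : ℝ := r⁻¹ * (1 + |(z : ℝ)| / r) ^ (-γ)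

lemma weight_nonneg (γ : ℝ) {r : ℝ} (hr : 0 < r) (z : ℤ) : 0 ≤ weight γ r z := by
  unfold weight; positivity

lemma weight_le {γ r : ℝ} (hγ : 0 ≤ γ) (hr : 0 < r) (z : ℤ) : weight γ r z ≤ r⁻¹ := by
  unfold weight
  refine mul_le_of_le_one_right (by positivity) ?_
  refine Real.rpow_le_one_of_one_le_of_nonpos ?_ (by linarith)
  have : 0 ≤ |(z : ℝ)| / r := by positivity
  linarith

/-- A discrete integral test for `x ↦ x^(-γ)`: it bounds one cell by a difference that telescopes,
obtained from `log u ≤ u - 1` and `1 + v ≤ e^v`. -/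
lemma rpow_neg_telescope {γ y s : ℝ} (hγ : 1 < γ) (hy : 0 < y) (hs : 0 ≤ s) :
    (γ - 1) * (s * (y + s) ^ (-γ)) ≤ y ^ (1 - γ) - (y + s) ^ (1 - γ) := by
  have hys : 0 < y + s := by linarith
  have h1 : y ^ (1 - γ) = (y + s) ^ (1 - γ) * (y / (y + s)) ^ (1 - γ) := by
    rw [← Real.mul_rpow hys.le (by positivity), mul_div_cancel₀ _ hys.ne']
  have h2 : 1 + (γ - 1) * (s / (y + s)) ≤ (y / (y + s)) ^ (1 - γ) := by
    have hq : 0 < y / (y + s) := by positivity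
    rw [Real.rpow_def_of_pos hq]
    have h3 := Real.log_le_sub_one_of_pos hq
    have h4 : y / (y + s) - 1 = -(s / (y + s)) := by field_simp; ring
    rw [h4] at h3
    refine le_trans ?_ (Real.add_one_le_exp _)
    nlinarith
  have h5 : (y + s) ^ (1 - γ) * (s / (y + s)) = s * (y + s) ^ (-γ) := by
    rw [sub_eq_neg_add, Real.rpow_add_one hys.ne']; field_simp
  have h6 : 0 < (y + s) ^ (1 - γ) := by positivity
  rw [h1, ← h5]
  nlinarith

lemma sum_weight_le {γ r : ℝ} (hγ : 1 < γ) (hr : 0 < r) (N : ℕ) :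
    (γ - 1) * ∑ n ∈ Finset.range N, weight γ r ((n : ℤ) + 1) ≤ 1 - (1 + N / r) ^ (1 - γ) := by
  induction N with
  | zero => simp
  | succ N ih =>
    rw [Finset.sum_range_succ, mul_add]
    have h := rpow_neg_telescope (y := 1 + N / r) (s := r⁻¹) hγ (by positivity) (by positivity)
    have e1 : 1 + (N : ℝ) / r + r⁻¹ = 1 + ((N + 1 : ℕ) : ℝ) / r := by push_cast; field_simp; ring
    have e2 : weight γ r ((N : ℤ) + 1) = r⁻¹ * (1 + ((N + 1 : ℕ) : ℝ) / r) ^ (-γ) := by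
      rw [weight]
      congr 4
      push_cast
      rw [abs_of_nonneg (by positivity)]
    rw [e1] at h
    rw [e2]
    linarith

/-- What matters is uniformity in `r`: each half-line contributes at most `∫₀^∞ (1+x)^(-γ) dx =
1/(γ-1)`, and the origin at most `1`. -/
lemma tsum_weight_le {γ r : ℝ} (hγ : 1 < γ) (hr : 1 ≤ r) :
    ∑' z : ℤ, ENNReal.ofReal (weight γ r z) ≤ ENNReal.ofReal (1 + 2 / (γ - 1)) := by
  have hr0 : 0 < r := by linarith
  have hγ1 : 0 < γ - 1 := by linarith
  have h1 : ∑' n : ℕ, ENNReal.ofReal (weight γ r ((n : ℤ) + 1)) ≤ ENNReal.ofReal (1 / (γ - 1)) := by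
    refine ENNReal.tsum_le_of_sum_range_le fun N => ?_
    rw [← ENNReal.ofReal_sum_of_nonneg fun n _ => weight_nonneg γ hr0 _]
    apply ENNReal.ofReal_le_ofReal
    rw [le_div_iff₀' hγ1]
    have := sum_weight_le hγ hr0 N
    have h2 : 0 < (1 + N / r) ^ (1 - γ) := by positivity
    linarith
  have h2 : ∀ n : ℕ, weight γ r (-((n : ℤ) + 1)) = weight γ r ((n : ℤ) + 1) := by
    intro n; simp only [weight, Int.cast_neg, abs_neg]
  rw [tsum_of_nat_of_neg_add_one ENNReal.summable ENNReal.summable,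
    tsum_eq_zero_add' ENNReal.summable]
  simp_rw [h2]
  have h3 : ENNReal.ofReal (weight γ r ((0 : ℕ) : ℤ)) ≤ ENNReal.ofReal 1 := by
    apply ENNReal.ofReal_le_ofReal
    exact (weight_le (by linarith) hr0 _).trans (inv_le_one_of_one_le₀ hr)
  calc _ ≤ ENNReal.ofReal 1 + ENNReal.ofReal (1 / (γ - 1)) + ENNReal.ofReal (1 / (γ - 1)) := by
        push_cast at h3 ⊢
        gcongr
    _ = _ := by
        rw [← ENNReal.ofReal_add (by positivity) (by positivity),
          ← ENNReal.ofReal_add (by positivity) (by positivity)]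
        congr 1; ring

/-! ### Tail and window estimates for the levels -/

lemma measurable_level (t : ℝ) (z : ℤ) : Measurable (level t z) := by
  unfold level
  exact measurable_id.sub (measurable_const.mul Real.measurable_log)

/-- A high level means `x ≥ c a + (|z|/t) log x`. Then `x ≥ c a` forces `log x ≥ θ log t`, and `(log
t)/t = a/r` turns the travelling cost into `θ a |z|/r`. This linear growth in `|z|` makes the
probabilities of high levels summable. -/
lemma eventually_le_of_le_level {α c : ℝ} (hα : 1 < α) (hc : 0 < c) :
    ∃ c₁ > 0, ∀ᶠ t in atTop, 1 ≤ c₁ * potScale α t ∧ ∀ (z : ℤ) (x : ℝ), 1 ≤ x →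
      c * potScale α t ≤ level t z x →
      Real.exp 1 ≤ x ∧ c₁ * potScale α t * (1 + |(z : ℝ)| / spaceScale α t) ≤ x := by
  have hα1 : 0 < α - 1 := sub_pos.2 hα
  set θ : ℝ := 1 / (4 * (α - 1)) with hθ
  have hθ0 : 0 < θ := by positivity
  refine ⟨min c θ / 2, by positivity, ?_⟩
  filter_upwards [eventually_gt_atTop 1, eventually_log_potScale hα,
    (tendsto_potScale hα).eventually_ge_atTop (1 / (min c θ / 2)),
    (tendsto_potScale hα).eventually_ge_atTop (Real.exp 1 / c),
    Real.tendsto_log_atTop.eventually_ge_atTop (-Real.log c / θ),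
    (tendsto_spaceScale hα).eventually_gt_atTop 0] with t ht hla h1 h2 h3 hr
  rw [div_le_iff₀ (by positivity)] at h1 h2 h3
  refine ⟨by linarith, fun z x hx hlev => ?_⟩
  set a := potScale α t
  set r := spaceScale α t
  set L := Real.log t
  have ha : 0 < a := potScale_pos α ht
  have ht0 : 0 < t := by linarith
  have hL : 0 < L := Real.log_pos ht
  have hrL : r * L = a * t := spaceScale_mul_log hα ht
  have hlev' : c * a + |(z : ℝ)| / t * Real.log x ≤ x := by
    have : level t z x = x - |(z : ℝ)| / t * Real.log x := rfl
    linarith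
  have hlog0 : 0 ≤ Real.log x := Real.log_nonneg hx
  have h5 : 0 ≤ |(z : ℝ)| / t * Real.log x := by positivity
  have hca : c * a ≤ x := by linarith
  have hlog : θ * L ≤ Real.log x := by
    refine le_trans ?_ (Real.log_le_log (by positivity) hca)
    rw [Real.log_mul hc.ne' ha.ne']
    have h6 : L / (2 * (α - 1)) = 2 * (θ * L) := by rw [hθ]; field_simp; norm_num
    have h7 := hla.1
    rw [h6] at h7
    linarith
  refine ⟨by linarith, ?_⟩
  have h8 : θ * (a * (|(z : ℝ)| / r)) ≤ |(z : ℝ)| / t * Real.log x := by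
    calc θ * (a * (|(z : ℝ)| / r)) = |(z : ℝ)| / t * (θ * L) := by
          field_simp; linear_combination (-|(z : ℝ)|) * hrL
      _ ≤ _ := by gcongr
  have h9 : 0 ≤ a * (|(z : ℝ)| / r) := by positivity
  have h10 : min c θ * a ≤ c * a := by gcongr; exact min_le_left _ _
  have h11 : min c θ * (a * (|(z : ℝ)| / r)) ≤ θ * (a * (|(z : ℝ)| / r)) := by
    gcongr; exact min_le_right _ _
  nlinarith

lemma threshold_rpow {α c₁ a r : ℝ} (hc₁ : 0 < c₁) (ha : 0 < a) (hr : r = a ^ α) (z : ℤ) :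
    (c₁ * a * (1 + |(z : ℝ)| / r)) ^ (-α) = c₁ ^ (-α) * weight α r z := by
  have hr0 : 0 < r := by rw [hr]; positivity
  rw [Real.mul_rpow (by positivity) (by positivity), Real.mul_rpow hc₁.le ha.le, weight, hr,
    Real.rpow_neg ha.le α, mul_assoc]

/-- Points whose levels are in a short window have comparable size. -/
lemma le_mul_of_level_window {t : ℝ} {z : ℤ} {l h x y : ℝ} (ht : 0 < t) (hl : 0 < l)
    (hx : Real.exp 1 ≤ x) (hxl : l ≤ level t z x) (hxy : x ≤ y) (hy : level t z y ≤ l + h) :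
    y ≤ x * (1 + h / l) := by
  have hx0 : 0 < x := (Real.exp_pos 1).trans_le hx
  have hy0 : 0 < y := by linarith
  set k := |(z : ℝ)| / t with hk
  have hk0 : 0 ≤ k := by positivity
  have e1 : level t z x = x - k * Real.log x := rfl
  have e2 : level t z y = y - k * Real.log y := rfl
  have hlogx : 1 ≤ Real.log x := by rw [Real.le_log_iff_exp_le hx0]; exact hx
  have hlog : Real.log y - Real.log x ≤ (y - x) / x := by
    rw [← Real.log_div hy0.ne' hx0.ne']
    have := Real.log_le_sub_one_of_pos (div_pos hy0 hx0)
    rw [sub_div, div_self hx0.ne']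
    exact this
  have h1 : level t z y - level t z x ≥ (y - x) * (1 - k / x) := by
    have : k * (Real.log y - Real.log x) ≤ k * ((y - x) / x) := by gcongr
    rw [e1, e2]
    have e3 : (y - x) * (1 - k / x) = (y - x) - k * ((y - x) / x) := by field_simp
    rw [e3]; linarith
  have h2 : l / x ≤ 1 - k / x := by
    rw [div_le_iff₀ hx0, sub_mul, div_mul_cancel₀ _ hx0.ne', one_mul]
    have : k * 1 ≤ k * Real.log x := by gcongr
    linarith
  have h3 : (y - x) * (l / x) ≤ h := by
    have : (y - x) * (l / x) ≤ (y - x) * (1 - k / x) := by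
      apply mul_le_mul_of_nonneg_left h2; linarith
    linarith
  have h4 : y - x ≤ h / (l / x) := by rw [le_div_iff₀ (by positivity)]; exact h3
  have h5 : h / (l / x) = x * (h / l) := by field_simp
  rw [mul_add, mul_one]
  linarith

/-- Any two points of the window differ by a factor at most `1 + h/l`, so the window fits into an
interval starting at its infimum with relative length `h/l`. The Pareto density is largest at the
left end. -/
lemma paretoMeasure_window_le {α t : ℝ} {z : ℤ} {l h m : ℝ} (hα : 0 < α) (ht : 0 < t) (hl : 0 < l)
    (hh : 0 ≤ h) (hm0 : 0 < m)
    (hm : ∀ x, 1 ≤ x → l ≤ level t z x → Real.exp 1 ≤ x ∧ m ≤ x) :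
    paretoMeasure 1 α {x | 1 ≤ x ∧ l ≤ level t z x ∧ level t z x ≤ l + h}
      ≤ ENNReal.ofReal (α * (h / l) * m ^ (-α)) := by
  set T : Set ℝ := {x | 1 ≤ x ∧ l ≤ level t z x ∧ level t z x ≤ l + h} with hT
  rcases T.eq_empty_or_nonempty with h0 | hne
  · rw [h0, measure_empty]; exact zero_le
  have hbdd : BddBelow T := ⟨1, fun x hx => hx.1⟩
  set x₀ := sInf T with hx₀
  have hmx : m ≤ x₀ := le_csInf hne fun x hx => (hm x hx.1 hx.2.1).2
  have hx₀0 : 0 < x₀ := hm0.trans_le hmx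
  have hhl : 0 ≤ h / l := by positivity
  have hsub : T ⊆ Set.Icc x₀ (x₀ * (1 + h / l)) := by
    intro y hy
    refine ⟨csInf_le hbdd hy, ?_⟩
    rw [← div_le_iff₀ (by positivity)]
    refine le_csInf hne fun x hx => ?_
    rw [div_le_iff₀ (by positivity)]
    rcases le_total x y with hxy | hxy
    · exact le_mul_of_level_window ht hl (hm x hx.1 hx.2.1).1 hx.2.1 hxy hy.2.2
    · have hx0 : 0 ≤ x := by linarith [hx.1]
      have := mul_nonneg hx0 hhl
      linarith
  refine (measure_mono hsub).trans ((paretoMeasure_Icc_le hα hx₀0).trans ?_)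
  · apply ENNReal.ofReal_le_ofReal
    have e1 : α * x₀ ^ (-(α + 1)) * (x₀ * (1 + h / l) - x₀) = α * (h / l) * x₀ ^ (-α) := by
      have : x₀ ^ (-α) = x₀ ^ (-(α + 1)) * x₀ := by
        rw [← Real.rpow_add_one hx₀0.ne']; congr 1; ring
      rw [this]; ring
    rw [e1]
    have : x₀ ^ (-α) ≤ m ^ (-α) := Real.rpow_le_rpow_of_nonpos hm0 hmx (by linarith)
    gcongr

/-! ### Probability estimates for the auxiliary field -/

section Field

variable {S : Type*} [MeasurableSpace S] {P : Measure S} {α : ℝ}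
  {X : ℤ → S → ℝ}

lemma ae_one_le (hl : ∀ z, HasLaw (X z) (paretoMeasure 1 α) P) : ∀ᵐ ω ∂P, ∀ z, 1 ≤ X z ω := by
  rw [ae_all_iff]
  intro z
  rw [ae_iff]
  have h := (hl z).measure_eq (p := fun x => x < 1) measurableSet_Iio
  simp only [not_le]
  rw [h]
  exact paretoMeasure_Iio_one

/-- Union bound: since `a^(-α) = 1/r`, the tail at `z` is `K^(-α)` times a weight with exponent `αβ
> 1`. -/
lemma measure_growth_le (hα : 0 < α) (hl : ∀ z, HasLaw (X z) (paretoMeasure 1 α) P)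
    {β K a r : ℝ} (hβ0 : 0 ≤ β) (hβ : 1 < α * β) (ha : 0 < a) (hr : r = a ^ α) (hr1 : 1 ≤ r)
    (hK : 0 < K) (hKa : 1 ≤ K * a) :
    P {ω | ∃ z : ℤ, K * a * (1 + |(z : ℝ)| / r) ^ β < X z ω}
      ≤ ENNReal.ofReal (K ^ (-α) * (1 + 2 / (α * β - 1))) := by
  have hr0 : 0 < r := by linarith
  rw [Set.ofPred_exists]
  refine (measure_iUnion_le _).trans ?_
  calc _ ≤ ∑' z : ℤ, ENNReal.ofReal (K ^ (-α)) * ENNReal.ofReal (weight (α * β) r z) := by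
        refine ENNReal.tsum_le_tsum fun z => ?_
        set y := 1 + |(z : ℝ)| / r with hy
        have hy1 : 1 ≤ y := by
          have : 0 ≤ |(z : ℝ)| / r := by positivity
          linarith
        have hT : 1 ≤ K * a * y ^ β := by
          have := Real.one_le_rpow hy1 hβ0
          nlinarith
        rw [(hl z).measure_eq (p := fun x => K * a * y ^ β < x) measurableSet_Ioi]
        refine (measure_mono (Set.Ioi_subset_Ici_self)).trans ?_
        rw [paretoMeasure_Ici hα hT, ← ENNReal.ofReal_mul (by positivity)]
        apply ENNReal.ofReal_le_ofReal
        rw [Real.mul_rpow (by positivity) (by positivity), Real.mul_rpow hK.le ha.le, weight, hr,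
          Real.rpow_neg ha.le α, mul_assoc, ← hr, ← hy, ← Real.rpow_mul (by linarith)]
        rw [show β * -α = -(α * β) by ring]
    _ ≤ _ := by
        rw [ENNReal.tsum_mul_left, ENNReal.ofReal_mul (by positivity)]
        gcongr
        exact tsum_weight_le hβ hr1

/-- About `θ r/4` independent sites lie close enough that a value `2 c a` keeps at least half of
itself after the travelling cost. All miss it with probability at most `exp(-N T^(-α))`, whose
exponent is of order `c^(1-α)` and diverges as `c → 0`. The map `g` enumerates the even or the odd
sites. -/
lemma eventually_measure_no_high_le (hα : 1 < α)
    (hl : ∀ z, HasLaw (X z) (paretoMeasure 1 α) P) (hi : iIndepFun X P) {c : ℝ} (hc : 0 < c)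
    {g : ℕ → ℕ} (hg : Function.Injective g) (hg2 : ∀ n, g n ≤ 2 * n + 1) :
    ∀ᶠ t in atTop, P {ω | ∀ n : ℕ, level t (g n : ℤ) (X (g n : ℤ) ω) < c * potScale α t}
      ≤ ENNReal.ofReal (Real.exp (-((α - 1) * 2 ^ (-α) / 16 * c ^ (1 - α)))) := by
  have hα1 : 0 < α - 1 := sub_pos.2 hα
  -- Chosen so that `θ log T ≤ c log t`, which makes the cost at distance `θ r` at most half the
  -- value.
  set θ : ℝ := c * (α - 1) / 2 with hθ
  have hθ0 : 0 < θ := by positivity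
  filter_upwards [eventually_gt_atTop 1, eventually_log_potScale hα,
    (tendsto_potScale hα).eventually_ge_atTop (Real.exp 1 / (2 * c)),
    (tendsto_spaceScale hα).eventually_ge_atTop (8 / θ),
    Real.tendsto_log_atTop.eventually_ge_atTop (Real.log (2 * c) * (α - 1))]
    with t ht hla h1 h2 h3
  rw [div_le_iff₀ (by positivity)] at h1 h2
  have hrdef : spaceScale α t = potScale α t ^ α := rfl
  have hrL : spaceScale α t * Real.log t = potScale α t * t := spaceScale_mul_log hα ht
  have ha : 0 < potScale α t := potScale_pos α ht
  set a := potScale α t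
  set r := spaceScale α t
  set L := Real.log t
  have hr0 : 0 < r := by rw [hrdef]; positivity
  have ht0 : 0 < t := by linarith
  have hL : 0 < L := Real.log_pos ht
  set T : ℝ := 2 * c * a with hT
  have hTe : Real.exp 1 ≤ T := by rw [hT]; linarith
  have hT0 : 0 < T := (Real.exp_pos 1).trans_le hTe
  have hT1 : 1 ≤ T := (Real.one_le_exp zero_le_one).trans hTe
  have hlogT : θ * Real.log T ≤ c * L := by
    have h4 : Real.log T ≤ 2 * L / (α - 1) := by
      rw [hT, Real.log_mul (by positivity) ha.ne']
      have h5 : Real.log (2 * c) ≤ L / (α - 1) := by rw [le_div_iff₀ hα1]; exact h3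
      have h6 := hla.2
      have h7 : 2 * L / (α - 1) = L / (α - 1) + L / (α - 1) := by ring
      linarith
    calc θ * Real.log T ≤ θ * (2 * L / (α - 1)) := by gcongr
      _ = c * L := by rw [hθ]; field_simp
  set N : ℕ := ⌊θ * r / 4⌋₊ with hN
  have hNle : (N : ℝ) ≤ θ * r / 4 := Nat.floor_le (by positivity)
  have hNge : θ * r / 8 ≤ N := by
    have := Nat.lt_floor_add_one (θ * r / 4)
    rw [← hN] at this
    linarith
  have hhigh : ∀ k < N, ∀ x, T ≤ x → c * a ≤ level t (g k : ℤ) x := by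
    intro k hk x hx
    have hx0 : 0 < x := by linarith
    -- Larger values are also sufficient because `log x / x` decreases on `[e, ∞)`; this is why `T ≥
    -- e` was secured.
    have h4 : Real.log x / x ≤ Real.log T / T :=
      Real.log_div_self_antitoneOn hTe (hTe.trans hx) hx
    have h5 : |((g k : ℤ) : ℝ)| ≤ θ * r := by
      have h6 : g k ≤ 2 * N := (hg2 k).trans (by omega)
      have h7 : ((g k : ℕ) : ℝ) ≤ 2 * N := by exact_mod_cast h6
      rw [Int.cast_natCast, abs_of_nonneg (Nat.cast_nonneg _)]
      have : 0 < θ * r := by positivity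
      linarith
    have hlogx : 0 ≤ Real.log x := Real.log_nonneg (hT1.trans hx)
    have hlogT0 : 0 ≤ Real.log T := Real.log_nonneg hT1
    have h6 : |((g k : ℤ) : ℝ)| / t * Real.log x ≤ x / 2 := by
      calc |((g k : ℤ) : ℝ)| / t * Real.log x ≤ θ * r / t * Real.log x := by gcongr
        _ = θ * r / t * (Real.log x / x) * x := by field_simp
        _ ≤ θ * r / t * (Real.log T / T) * x := by gcongr
        _ = (θ * Real.log T) * (r / (t * T)) * x := by ring
        _ ≤ (c * L) * (r / (t * T)) * x := by gcongr
        _ = x / 2 := by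
          rw [hT]; field_simp; linear_combination hrL
    have h7 : level t (g k : ℤ) x = x - |((g k : ℤ) : ℝ)| / t * Real.log x := rfl
    have h8 : T = 2 * (c * a) := by rw [hT]; ring
    linarith
  have hprob := isProbabilityMeasure_paretoMeasure one_pos (by linarith : 0 < α)
  have hsub : {ω | ∀ n : ℕ, level t (g n : ℤ) (X (g n : ℤ) ω) < c * a}
      ⊆ ⋂ k ∈ Finset.range N, X (g k : ℤ) ⁻¹' Set.Iio T := by
    intro ω hω
    simp only [Set.mem_iInter, Finset.mem_range, Set.mem_preimage, Set.mem_Iio]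
    intro k hk
    by_contra hle
    exact absurd (hhigh k hk _ (not_lt.1 hle)) (not_le.2 (hω k))
  have hi' : iIndepFun (fun k : ℕ => X (g k : ℤ)) P :=
    hi.precomp (Nat.cast_injective.comp hg)
  refine (measure_mono hsub).trans ?_
  rw [hi'.measure_inter_preimage_eq_mul (Finset.range N) (sets := fun _ => Set.Iio T)
    fun _ _ => measurableSet_Iio]
  have hone : ∀ k : ℕ, P (X (g k : ℤ) ⁻¹' Set.Iio T) = ENNReal.ofReal (1 - T ^ (-α)) := by
    intro k
    have h4 := (hl (g k : ℤ)).measure_eq (p := fun x => x < T) measurableSet_Iio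
    have h5 : paretoMeasure 1 α (Set.Iio T) = 1 - paretoMeasure 1 α (Set.Ici T) := by
      rw [← Set.compl_Ici]; exact prob_compl_eq_one_sub measurableSet_Ici
    rw [paretoMeasure_Ici (by linarith) hT1] at h5
    refine h4.trans (h5.trans ?_)
    rw [ENNReal.ofReal_sub _ (by positivity), ENNReal.ofReal_one]
  rw [Finset.prod_congr rfl fun k _ => hone k, Finset.prod_const, Finset.card_range]
  have hle1 : 0 ≤ 1 - T ^ (-α) := by
    have := Real.rpow_le_one_of_one_le_of_nonpos hT1 (by linarith : -α ≤ 0)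
    linarith
  rw [← ENNReal.ofReal_pow hle1]
  apply ENNReal.ofReal_le_ofReal
  calc (1 - T ^ (-α)) ^ N ≤ Real.exp (-(T ^ (-α))) ^ N := by
        gcongr
        exact Real.one_sub_le_exp_neg _
    _ = Real.exp (-(N * T ^ (-α))) := by rw [← Real.exp_nat_mul]; congr 1; ring
    _ ≤ _ := by
        apply Real.exp_le_exp.2
        apply neg_le_neg
        have h4 : T ^ (-α) = 2 ^ (-α) * c ^ (-α) / r := by
          rw [hT, Real.mul_rpow (by positivity) ha.le, Real.mul_rpow (by norm_num) hc.le, hrdef,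
            Real.rpow_neg ha.le, div_eq_mul_inv]
        have h5 : c ^ (1 - α) = c * c ^ (-α) := by
          rw [sub_eq_add_neg, Real.rpow_add hc, Real.rpow_one]
        calc (α - 1) * 2 ^ (-α) / 16 * c ^ (1 - α) = θ * r / 8 * T ^ (-α) := by
              rw [h4, h5, hθ]; field_simp; norm_num
          _ ≤ N * T ^ (-α) := by gcongr

/-- The event that the value at `z` reaches the level `l`. -/
def highSet (t : ℝ) (l : ℝ) (z : ℤ) : Set ℝ := {x | 1 ≤ x ∧ l ≤ level t z x}

lemma measurableSet_highSet (t l : ℝ) (z : ℤ) : MeasurableSet (highSet t l z) :=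
  measurableSet_Ici.inter (measurableSet_le measurable_const (measurable_level t z))

/-! ### Union bounds over high sites at a fixed time. -/

section Fixed

variable {t l c₁ a r : ℝ}

lemma paretoMeasure_highSet_le (hα : 0 < α) (hc₁ : 0 < c₁) (ha : 0 < a) (hr : r = a ^ α)
    (hca : 1 ≤ c₁ * a)
    (hlev : ∀ (z : ℤ) (x : ℝ), 1 ≤ x → l ≤ level t z x →
      Real.exp 1 ≤ x ∧ c₁ * a * (1 + |(z : ℝ)| / r) ≤ x) (z : ℤ) :
    paretoMeasure 1 α (highSet t l z) ≤ ENNReal.ofReal (c₁ ^ (-α) * weight α r z) := by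
  have hr0 : 0 < r := by rw [hr]; positivity
  rw [← threshold_rpow hc₁ ha hr, ← paretoMeasure_Ici hα]
  · exact measure_mono fun x hx => (hlev z x hx.1 hx.2).2
  · have : 0 ≤ |(z : ℝ)| / r := by positivity
    nlinarith

lemma map_pair_eq [IsProbabilityMeasure P] (hm : ∀ z, Measurable (X z)) (hl : ∀ z, HasLaw (X z) (paretoMeasure 1 α) P)
    (hi : iIndepFun X P) {x y : ℤ} (hxy : x ≠ y) :
    P.map (fun ω => (X x ω, X y ω)) = (paretoMeasure 1 α).prod (paretoMeasure 1 α) := by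
  rw [(hi.indepFun hxy).map_prod_eq_prod_map_map (hm x).aemeasurable (hm y).aemeasurable,
    (hl x).map_eq, (hl y).map_eq]

/-- Fubini: given the value at `x`, the level at `y` must fall in a window of length at most `2h`,
which is independent of that value's being high. Hence the product of two weights times `h/l`. -/
lemma measure_close_pair_le [IsProbabilityMeasure P] (hα : 0 < α) (hm : ∀ z, Measurable (X z))
    (hl : ∀ z, HasLaw (X z) (paretoMeasure 1 α) P) (hi : iIndepFun X P)
    (ht : 0 < t) (hl0 : 0 < l) (hc₁ : 0 < c₁) (ha : 0 < a) (hr : r = a ^ α) (hca : 1 ≤ c₁ * a)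
    (hlev : ∀ (z : ℤ) (x : ℝ), 1 ≤ x → l ≤ level t z x →
      Real.exp 1 ≤ x ∧ c₁ * a * (1 + |(z : ℝ)| / r) ≤ x) {h : ℝ} (hh : 0 ≤ h)
    {x y : ℤ} (hxy : x ≠ y) :
    P {ω | X x ω ∈ highSet t l x ∧ X y ω ∈ highSet t l y ∧
        |level t x (X x ω) - level t y (X y ω)| < h}
      ≤ ENNReal.ofReal (c₁ ^ (-α) * weight α r x) *
        ENNReal.ofReal (α * (2 * h / l) * (c₁ ^ (-α) * weight α r y)) := by
  have hr0 : 0 < r := by rw [hr]; positivity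
  have hprob := isProbabilityMeasure_paretoMeasure one_pos hα
  set D : Set (ℝ × ℝ) := {q | q.1 ∈ highSet t l x ∧ q.2 ∈ highSet t l y ∧
    |level t x q.1 - level t y q.2| < h} with hD
  have hDm : MeasurableSet D := by
    refine (measurable_fst (measurableSet_highSet t l x)).inter
      ((measurable_snd (measurableSet_highSet t l y)).inter ?_)
    have habs : Measurable fun q : ℝ × ℝ => |level t x q.1 - level t y q.2| :=
      (((measurable_level t x).comp measurable_fst).sub
        ((measurable_level t y).comp measurable_snd)).abs
    exact measurableSet_lt habs measurable_const
  have h1 : P {ω | X x ω ∈ highSet t l x ∧ X y ω ∈ highSet t l y ∧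
        |level t x (X x ω) - level t y (X y ω)| < h}
      = ((paretoMeasure 1 α).prod (paretoMeasure 1 α)) D := by
    rw [← map_pair_eq hm hl hi hxy, Measure.map_apply ((hm x).prodMk (hm y)) hDm]
    rfl
  rw [h1, Measure.prod_apply hDm]
  calc _ ≤ ∫⁻ u, (highSet t l x).indicator
          (fun _ => ENNReal.ofReal (α * (2 * h / l) * (c₁ ^ (-α) * weight α r y))) u
          ∂(paretoMeasure 1 α) := by
        refine lintegral_mono fun u => ?_
        by_cases hu : u ∈ highSet t l x
        · rw [Set.indicator_of_mem hu]
          -- Cutting the window at `l` keeps its lower end high, as the window estimate requires.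
          set l' := max l (level t x u - h) with hl'
          have hll' : l ≤ l' := le_max_left _ _
          refine (measure_mono (t := {v | 1 ≤ v ∧ l' ≤ level t y v ∧ level t y v ≤ l' + 2 * h})
            ?_).trans ?_
          · rintro v ⟨_, hv1, hv2⟩
            rw [abs_lt] at hv2
            simp only at hv1 hv2
            refine ⟨hv1.1, max_le hv1.2 (by linarith), ?_⟩
            have : level t x u - h ≤ l' := le_max_right _ _
            linarith
          · have hy0 : 0 ≤ |(y : ℝ)| / r := by positivity
            refine (paretoMeasure_window_le hα ht (hl0.trans_le hll') (by positivity)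
              (m := c₁ * a * (1 + |(y : ℝ)| / r)) (by positivity)
              fun v hv hv' => hlev y v hv (hll'.trans hv')).trans ?_
            rw [threshold_rpow hc₁ ha hr]
            have := weight_nonneg α hr0 y
            gcongr
        · rw [Set.indicator_of_notMem hu]
          refine le_of_eq ?_
          convert measure_empty (μ := paretoMeasure 1 α)
          ext v
          simp only [hD, Set.mem_preimage, Set.mem_ofPred_eq, Set.mem_empty_iff_false, iff_false]
          exact fun h => hu h.1
    _ ≤ _ := by
        rw [lintegral_indicator_const (measurableSet_highSet t l x), mul_comm]
        gcongr
        exact paretoMeasure_highSet_le hα hc₁ ha hr hca hlev x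

lemma measure_exists_close_pair_le [IsProbabilityMeasure P] (hα : 1 < α) (hm : ∀ z, Measurable (X z))
    (hl : ∀ z, HasLaw (X z) (paretoMeasure 1 α) P) (hi : iIndepFun X P)
    (ht : 0 < t) (hl0 : 0 < l) (hc₁ : 0 < c₁) (ha : 0 < a) (hr : r = a ^ α) (hr1 : 1 ≤ r)
    (hca : 1 ≤ c₁ * a)
    (hlev : ∀ (z : ℤ) (x : ℝ), 1 ≤ x → l ≤ level t z x →
      Real.exp 1 ≤ x ∧ c₁ * a * (1 + |(z : ℝ)| / r) ≤ x) {h : ℝ} (hh : 0 ≤ h) :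
    P {ω | ∃ x y : ℤ, x ≠ y ∧ X x ω ∈ highSet t l x ∧ X y ω ∈ highSet t l y ∧
        |level t x (X x ω) - level t y (X y ω)| < h}
      ≤ ENNReal.ofReal (α * (2 * h / l) * (c₁ ^ (-α) * (1 + 2 / (α - 1))) ^ 2) := by
  have hr0 : 0 < r := by linarith
  have hα1 : 0 < α - 1 := sub_pos.2 hα
  set C := c₁ ^ (-α) with hC
  have hC0 : 0 < C := by positivity
  have hsum : ∑' z : ℤ, ENNReal.ofReal (C * weight α r z)
      ≤ ENNReal.ofReal (C * (1 + 2 / (α - 1))) := by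
    simp_rw [ENNReal.ofReal_mul hC0.le]
    rw [ENNReal.tsum_mul_left]
    gcongr
    exact tsum_weight_le hα hr1
  simp_rw [Set.ofPred_exists]
  calc _ ≤ ∑' x : ℤ, ∑' y : ℤ, P {ω | x ≠ y ∧ X x ω ∈ highSet t l x ∧ X y ω ∈ highSet t l y ∧
        |level t x (X x ω) - level t y (X y ω)| < h} :=
        (measure_iUnion_le _).trans (ENNReal.tsum_le_tsum fun x => measure_iUnion_le _)
    _ ≤ ∑' x : ℤ, ∑' y : ℤ, ENNReal.ofReal (C * weight α r x) *
        (ENNReal.ofReal (α * (2 * h / l)) * ENNReal.ofReal (C * weight α r y)) := by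
        refine ENNReal.tsum_le_tsum fun x => ENNReal.tsum_le_tsum fun y => ?_
        rw [← ENNReal.ofReal_mul (p := α * (2 * h / l)) (by positivity)]
        by_cases hxy : x = y
        · simp [hxy]
        · refine (measure_mono fun ω hω => ?_).trans (measure_close_pair_le (by linarith) hm hl hi
            ht hl0 hc₁ ha hr hca hlev hh hxy)
          exact hω.2
    _ = ENNReal.ofReal (α * (2 * h / l)) * ((∑' x : ℤ, ENNReal.ofReal (C * weight α r x)) *
        ∑' y : ℤ, ENNReal.ofReal (C * weight α r y)) := by
        simp_rw [ENNReal.tsum_mul_left]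
        rw [ENNReal.tsum_mul_right]
        ring
    _ ≤ ENNReal.ofReal (α * (2 * h / l)) * (ENNReal.ofReal (C * (1 + 2 / (α - 1))) *
        ENNReal.ofReal (C * (1 + 2 / (α - 1)))) := by gcongr
    _ = _ := by
        rw [← ENNReal.ofReal_mul (by positivity), ← ENNReal.ofReal_mul (by positivity), sq]

/-- For `x ≠ 0` independence gives a product of two weights, one of them at most `1/r`, so the sum
is `O(1/r)`. The case `x = 0` is a single site and is `O(1/r)` as well. -/
lemma measure_exists_mirror_pair_le (hα : 1 < α)
    (hl : ∀ z, HasLaw (X z) (paretoMeasure 1 α) P) (hi : iIndepFun X P)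
    (hc₁ : 0 < c₁) (ha : 0 < a) (hr : r = a ^ α) (hr1 : 1 ≤ r) (hca : 1 ≤ c₁ * a)
    (hlev : ∀ (z : ℤ) (x : ℝ), 1 ≤ x → l ≤ level t z x →
      Real.exp 1 ≤ x ∧ c₁ * a * (1 + |(z : ℝ)| / r) ≤ x) :
    P {ω | ∃ x : ℤ, X x ω ∈ highSet t l x ∧ X (-x) ω ∈ highSet t l (-x)}
      ≤ ENNReal.ofReal ((c₁ ^ (-α) + c₁ ^ (-α) * (c₁ ^ (-α) * (1 + 2 / (α - 1)))) * r⁻¹) := by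
  have hr0 : 0 < r := by linarith
  have hα1 : 0 < α - 1 := sub_pos.2 hα
  set C := c₁ ^ (-α) with hC
  have hC0 : 0 < C := by positivity
  have hone : ∀ z, P (X z ⁻¹' highSet t l z) ≤ ENNReal.ofReal (C * weight α r z) := fun z => by
    have h1 := (hl z).measure_eq (p := fun x => x ∈ highSet t l z) (measurableSet_highSet t l z)
    refine (le_of_eq h1).trans ?_
    exact paretoMeasure_highSet_le (by linarith) hc₁ ha hr hca hlev z
  have hsub : {ω | ∃ x : ℤ, X x ω ∈ highSet t l x ∧ X (-x) ω ∈ highSet t l (-x)}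
      ⊆ X 0 ⁻¹' highSet t l 0 ∪ ⋃ x : {x : ℤ // x ≠ 0},
        (X x ⁻¹' highSet t l x ∩ X (-x) ⁻¹' highSet t l (-x)) := by
    rintro ω ⟨x, h1, h2⟩
    by_cases hx : x = 0
    · left; subst hx; exact h1
    · right; exact Set.mem_iUnion.2 ⟨⟨x, hx⟩, h1, h2⟩
  refine (measure_mono hsub).trans ((measure_union_le _ _).trans ?_)
  rw [add_mul, ENNReal.ofReal_add (by positivity) (by positivity)]
  gcongr
  · refine (hone 0).trans (ENNReal.ofReal_le_ofReal ?_)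
    gcongr
    exact weight_le (by linarith) hr0 0
  · refine (measure_iUnion_le _).trans ?_
    calc _ ≤ ∑' x : {x : ℤ // x ≠ 0}, ENNReal.ofReal (C * r⁻¹) *
          ENNReal.ofReal (C * weight α r x) := by
          refine ENNReal.tsum_le_tsum fun x => ?_
          have hx : (-(x : ℤ)) ≠ x := by have := x.2; omega
          rw [Set.inter_comm, (hi.indepFun hx).measure_inter_preimage_eq_mul _ _
            (measurableSet_highSet t l _) (measurableSet_highSet t l _)]
          gcongr
          · refine (hone _).trans (ENNReal.ofReal_le_ofReal ?_)
            gcongr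
            exact weight_le (by linarith) hr0 _
          · exact hone _
      _ ≤ ENNReal.ofReal (C * r⁻¹) * ENNReal.ofReal (C * (1 + 2 / (α - 1))) := by
          rw [ENNReal.tsum_mul_left]
          gcongr
          refine (ENNReal.tsum_comp_le_tsum_of_injective Subtype.val_injective
            (fun x : ℤ => ENNReal.ofReal (C * weight α r x))).trans ?_
          simp_rw [ENNReal.ofReal_mul hC0.le]
          rw [ENNReal.tsum_mul_left]
          gcongr
          exact tsum_weight_le hα hr1
      _ = _ := by
          rw [← ENNReal.ofReal_mul (by positivity)]
          congr 1; ring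

end Fixed

/-- Five failures are given `η/5` each: small `c` produces high levels at even and at odd sites,
large `K` controls growth, then `κ`, small depending on `c`, produces the gap, and large `t`
excludes mirror pairs. -/
theorem exists_eventually_measure_not_isGoodField_le [IsProbabilityMeasure P] (hα : 1 < α) (hm : ∀ z, Measurable (X z))
    (hl : ∀ z, HasLaw (X z) (paretoMeasure 1 α) P) (hi : iIndepFun X P) {β : ℝ} (hβ0 : 0 ≤ β)
    (hβ : 1 < α * β) {η : ℝ} (hη : 0 < η) :
    ∃ c > 0, ∃ K > 0, ∃ κ > 0, κ ≤ c / 2 ∧ ∀ᶠ t in atTop,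
      P {ω | ¬ IsGoodField α β c K κ t fun z => X z ω} ≤ ENNReal.ofReal η := by
  have hα1 : 0 < α - 1 := sub_pos.2 hα
  have hα0 : 0 < α := by linarith
  -- choice of `c`
  obtain ⟨c, hc, hcη⟩ : ∃ c > 0,
      Real.exp (-((α - 1) * 2 ^ (-α) / 16 * c ^ (1 - α))) ≤ η / 5 := by
    set A : ℝ := (α - 1) * 2 ^ (-α) / 16
    have hA : 0 < A := by positivity
    set b : ℝ := max 1 (-Real.log (η / 5) / A)
    have hb : 0 < b := lt_of_lt_of_le one_pos (le_max_left _ _)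
    -- The power is chosen so that `c^(1-α) = b`.
    refine ⟨b ^ (-(1 / (α - 1))), by positivity, ?_⟩
    rw [← Real.rpow_mul hb.le, show -(1 / (α - 1)) * (1 - α) = 1 by field_simp; ring, Real.rpow_one]
    have h1 : -Real.log (η / 5) ≤ A * b := by
      have := le_max_right 1 (-Real.log (η / 5) / A)
      rw [div_le_iff₀ hA] at this
      linarith
    rw [← Real.le_log_iff_exp_le (by positivity)]
    linarith
  -- choice of `K`
  set V : ℝ := 1 + 2 / (α * β - 1) with hV
  have hV0 : 0 < V := by
    have : 0 < α * β - 1 := by linarith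
    positivity
  obtain ⟨K, hK, hKη⟩ : ∃ K > 0, K ^ (-α) * V ≤ η / 5 := by
    refine ⟨(η / 5 / V) ^ (-(1 / α)), by positivity, ?_⟩
    rw [← Real.rpow_mul (by positivity), show -(1 / α) * -α = 1 by field_simp, Real.rpow_one,
      div_mul_cancel₀ _ hV0.ne']
  -- choice of `κ`
  obtain ⟨c₁, hc₁, hlev⟩ := eventually_le_of_le_level hα (half_pos hc)
  set D : ℝ := α * (2 / (c / 2)) * (c₁ ^ (-α) * (1 + 2 / (α - 1))) ^ 2 with hD
  have hD0 : 0 < D := by positivity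
  set κ : ℝ := min (c / 2) (η / 5 / D) with hκ
  have hκ0 : 0 < κ := by positivity
  have hκD : κ * D ≤ η / 5 := by
    rw [← le_div_iff₀ hD0]; exact min_le_right _ _
  refine ⟨c, hc, K, hK, κ, hκ0, min_le_left _ _, ?_⟩
  set F : ℝ := c₁ ^ (-α) + c₁ ^ (-α) * (c₁ ^ (-α) * (1 + 2 / (α - 1))) with hF
  have hF0 : 0 < F := by positivity
  filter_upwards [eventually_gt_atTop 1, hlev, (tendsto_spaceScale hα).eventually_ge_atTop 1,
    (tendsto_spaceScale hα).eventually_ge_atTop (F / (η / 5)),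
    (tendsto_potScale hα).eventually_ge_atTop (1 / K),
    eventually_measure_no_high_le hα hl hi hc (g := fun n => 2 * n)
      (fun m n h => by simpa using h) (fun n => by simp),
    eventually_measure_no_high_le hα hl hi hc (g := fun n => 2 * n + 1)
      (fun m n h => by simpa using h) (fun n => le_rfl)]
    with t ht hlev hr1 hrF haK heven hodd
  have ha := potScale_pos α ht
  have hrdef : spaceScale α t = potScale α t ^ α := rfl
  rw [div_le_iff₀ hK] at haK
  rw [div_le_iff₀ (by positivity)] at hrF
  set a := potScale α t
  set r := spaceScale α t
  have hr0 : 0 < r := by linarith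
  have hgrow := measure_growth_le (P := P) (X := X) hα0 hl hβ0 hβ ha hrdef hr1 hK (by linarith)
  have hclose := measure_exists_close_pair_le hα hm hl hi (by linarith) (by positivity) hc₁ ha hrdef
    hr1 hlev.1 hlev.2 (h := κ * a) (by positivity)
  have hmirror := measure_exists_mirror_pair_le hα hl hi hc₁ ha hrdef hr1 hlev.1 hlev.2
  have hsub : {ω | ¬ IsGoodField α β c K κ t fun z => X z ω} ⊆
      (((({ω | ∃ z : ℤ, K * a * (1 + |(z : ℝ)| / r) ^ β < X z ω} ∪
        {ω | ∀ n : ℕ, level t ((2 * n : ℕ) : ℤ) (X ((2 * n : ℕ) : ℤ) ω) < c * a}) ∪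
        {ω | ∀ n : ℕ, level t ((2 * n + 1 : ℕ) : ℤ) (X ((2 * n + 1 : ℕ) : ℤ) ω) < c * a}) ∪
        {ω | ∃ x y : ℤ, x ≠ y ∧ X x ω ∈ highSet t (c / 2 * a) x ∧ X y ω ∈ highSet t (c / 2 * a) y ∧
          |level t x (X x ω) - level t y (X y ω)| < κ * a}) ∪
        {ω | ∃ x : ℤ, X x ω ∈ highSet t (c / 2 * a) x ∧ X (-x) ω ∈ highSet t (c / 2 * a) (-x)}) ∪
        {ω | ¬ ∀ z, 1 ≤ X z ω} := by
    intro ω hω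
    by_contra hnot
    simp only [Set.mem_union, not_or, Set.mem_ofPred_eq, not_exists, not_forall, not_lt, not_not,
      not_and] at hnot
    obtain ⟨⟨⟨⟨⟨h1, h2⟩, h3⟩, h4⟩, h5⟩, h6⟩ := hnot
    exact hω ⟨h6, h1, h2, h3, fun x y hxy hx hy => h4 x y hxy ⟨h6 x, hx⟩ ⟨h6 y, hy⟩,
      fun x hx hx' => h5 x ⟨h6 x, hx⟩ ⟨h6 _, hx'⟩⟩
  have hnull : P {ω | ¬ ∀ z, 1 ≤ X z ω} = 0 := ae_iff.1 (ae_one_le hl)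
  have hη5 : ENNReal.ofReal η = ENNReal.ofReal (η / 5) + ENNReal.ofReal (η / 5) +
      ENNReal.ofReal (η / 5) + ENNReal.ofReal (η / 5) + ENNReal.ofReal (η / 5) + 0 := by
    rw [← ENNReal.ofReal_add (by positivity) (by positivity),
      ← ENNReal.ofReal_add (by positivity) (by positivity),
      ← ENNReal.ofReal_add (by positivity) (by positivity),
      ← ENNReal.ofReal_add (by positivity) (by positivity), add_zero]
    congr 1; ring
  rw [hη5]
  refine (measure_mono hsub).trans ((measure_union_le _ _).trans (add_le_add ?_ hnull.le))
  refine (measure_union_le _ _).trans (add_le_add ?_ (hmirror.trans (ENNReal.ofReal_le_ofReal ?_)))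
  · refine (measure_union_le _ _).trans (add_le_add ?_ (hclose.trans (ENNReal.ofReal_le_ofReal ?_)))
    · refine (measure_union_le _ _).trans (add_le_add ?_ (hodd.trans (ENNReal.ofReal_le_ofReal hcη)))
      exact (measure_union_le _ _).trans (add_le_add (hgrow.trans (ENNReal.ofReal_le_ofReal hKη))
        (heven.trans (ENNReal.ofReal_le_ofReal hcη)))
    · refine le_trans (le_of_eq ?_) hκD
      rw [hD]; field_simp
  · rw [← div_eq_mul_inv, div_le_iff₀ hr0]
    linarith

end Field

/-! ### The winning pair of sites -/

/-- The auxiliary value at `n + 1` beats the potential outside `{-(n+1), n+1}`. -/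
def winPlus (t : ℝ) (n : ℕ) : Set ((ℤ → ℝ) × (ℕ → Bool)) :=
  {q | ∀ y : ℤ, y.natAbs ≠ n + 1 →
    Psi (potential q.1 q.2) t y < level t ((n : ℤ) + 1) (q.1 ((n : ℤ) + 1))}

/-- The auxiliary value at `-(n + 1)` beats the potential outside `{-(n+1), n+1}`. -/
def winMinus (t : ℝ) (n : ℕ) : Set ((ℤ → ℝ) × (ℕ → Bool)) :=
  {q | ∀ y : ℤ, y.natAbs ≠ n + 1 →
    Psi (potential q.1 q.2) t y < level t (-((n : ℤ) + 1)) (q.1 (-((n : ℤ) + 1)))}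

lemma measurable_potential (y : ℤ) :
    Measurable fun q : (ℤ → ℝ) × (ℕ → Bool) => potential q.1 q.2 y := by
  have hz : ∀ z : ℤ, Measurable fun q : (ℤ → ℝ) × (ℕ → Bool) => q.1 z := fun z =>
    (measurable_pi_apply z).comp measurable_fst
  cases y with
  | ofNat n => exact hz n
  | negSucc n =>
    simp only [potential]
    refine Measurable.ite ?_ (hz _) (hz _)
    have hb : Measurable fun q : (ℤ → ℝ) × (ℕ → Bool) => q.2 n :=
      (measurable_pi_apply n).comp measurable_snd
    exact measurableSet_eq_fun hb measurable_const

lemma measurable_psi_potential (t : ℝ) (y : ℤ) :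
    Measurable fun q : (ℤ → ℝ) × (ℕ → Bool) => Psi (potential q.1 q.2) t y :=
  (measurable_level t y).comp (measurable_potential y)

lemma measurableSet_forall_psi_lt (t : ℝ) (n : ℕ) (z : ℤ) :
    MeasurableSet {q : (ℤ → ℝ) × (ℕ → Bool) | ∀ y : ℤ, y.natAbs ≠ n + 1 →
      Psi (potential q.1 q.2) t y < level t z (q.1 z)} := by
  simp only [Set.ofPred_forall]
  refine MeasurableSet.iInter fun y => MeasurableSet.iInter fun _ => ?_
  exact measurableSet_lt (measurable_psi_potential t y)
    ((measurable_level t z).comp ((measurable_pi_apply z).comp measurable_fst))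

lemma measurableSet_winPlus (t : ℝ) (n : ℕ) : MeasurableSet (winPlus t n) :=
  measurableSet_forall_psi_lt t n _

lemma measurableSet_winMinus (t : ℝ) (n : ℕ) : MeasurableSet (winMinus t n) :=
  measurableSet_forall_psi_lt t n _

lemma source_update {b : ℕ → Bool} {n : ℕ} {v : Bool} {y : ℤ} (hy : y.natAbs ≠ n + 1) :
    source (Function.update b n v) y = source b y := by
  cases y with
  | ofNat k => rfl
  | negSucc k =>
    have hk : k ≠ n := by rintro rfl; exact hy rfl
    simp only [source, Function.update_of_ne hk]

lemma psi_potential_update {f : ℤ → ℝ} {b : ℕ → Bool} {n : ℕ} {v : Bool} {t : ℝ} {y : ℤ}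
    (hy : y.natAbs ≠ n + 1) :
    Psi (potential f (Function.update b n v)) t y = Psi (potential f b) t y := by
  rw [psi_potential, psi_potential, source_update hy]

/-- Switch `n` affects only the site `-(n+1)`, which the event leaves out. This gives independence
of the event from that switch. -/
lemma update_mem_winPlus {t : ℝ} {n : ℕ} {f : ℤ → ℝ} {b : ℕ → Bool} {v : Bool} :
    (f, Function.update b n v) ∈ winPlus t n ↔ (f, b) ∈ winPlus t n :=
  forall₂_congr fun y hy => by simp only [psi_potential_update hy]

lemma update_mem_winMinus {t : ℝ} {n : ℕ} {f : ℤ → ℝ} {b : ℕ → Bool} {v : Bool} :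
    (f, Function.update b n v) ∈ winMinus t n ↔ (f, b) ∈ winMinus t n :=
  forall₂_congr fun y hy => by simp only [psi_potential_update hy]

/-- No site outside the pair takes its value from the pair, and levels are even in the site, so
exchanging the two auxiliary values exchanges the two events. -/
lemma swap_mem_winPlus {t : ℝ} {n : ℕ} {f : ℤ → ℝ} {b : ℕ → Bool} :
    ((fun z => f (Equiv.swap ((n : ℤ) + 1) (-((n : ℤ) + 1)) z)), b) ∈ winPlus t n
      ↔ (f, b) ∈ winMinus t n := by
  refine forall₂_congr fun y hy => ?_
  have h1 : (source b y).natAbs ≠ n + 1 := by rwa [natAbs_source]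
  have h2 : Equiv.swap ((n : ℤ) + 1) (-((n : ℤ) + 1)) (source b y) = source b y :=
    Equiv.swap_apply_of_ne_of_ne (by omega) (by omega)
  simp only [psi_potential, h2, Equiv.swap_apply_left, level_neg]

/-- A pair of sites that contains all maximisers. -/
def IsWinner (ξ : ℤ → ℝ) (t : ℝ) (n : ℕ) : Prop :=
  ∃ y : ℤ, y.natAbs = n + 1 ∧ ∀ x : ℤ, x.natAbs ≠ n + 1 → Psi ξ t x < Psi ξ t y

lemma IsWinner.eq {ξ : ℤ → ℝ} {t : ℝ} {n m : ℕ} (hn : IsWinner ξ t n) (hm : IsWinner ξ t m) :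
    n = m := by
  obtain ⟨y, hy1, hy2⟩ := hn
  obtain ⟨x, hx1, hx2⟩ := hm
  by_contra h
  have h1 := hy2 x (by omega)
  have h2 := hx2 y (by omega)
  linarith

lemma isWinner_of_winPlus {f : ℤ → ℝ} {b : ℕ → Bool} {t : ℝ} {n : ℕ} (h : (f, b) ∈ winPlus t n) :
    IsWinner (potential f b) t n := by
  refine ⟨(n : ℤ) + 1, by omega, fun x hx => ?_⟩
  rw [psi_potential f b t ((n : ℤ) + 1), source_succ]
  exact h x hx

lemma isWinner_of_winMinus {f : ℤ → ℝ} {b : ℕ → Bool} {t : ℝ} {n : ℕ} (h : (f, b) ∈ winMinus t n)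
    (hb : b n = false) : IsWinner (potential f b) t n := by
  refine ⟨-((n : ℤ) + 1), by omega, fun x hx => ?_⟩
  rw [psi_potential f b t (-((n : ℤ) + 1)), source_neg_succ, if_neg (by simp [hb])]
  exact h x hx

lemma ncard_maximisers_of_winPlus {f : ℤ → ℝ} {b : ℕ → Bool} {t : ℝ} {n : ℕ}
    (h : (f, b) ∈ winPlus t n) (hb : b n = true) : (maximisers (potential f b) t).ncard = 2 := by
  set ξ := potential f b with hξ
  have h1 : Psi ξ t ((n : ℤ) + 1) = level t ((n : ℤ) + 1) (f ((n : ℤ) + 1)) := by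
    rw [hξ, psi_potential, source_succ]
  have h2 : Psi ξ t (-((n : ℤ) + 1)) = level t ((n : ℤ) + 1) (f ((n : ℤ) + 1)) := by
    rw [hξ, psi_potential, source_neg_succ, if_pos hb]
  have hle : ∀ y, Psi ξ t y ≤ level t ((n : ℤ) + 1) (f ((n : ℤ) + 1)) := by
    intro y
    by_cases hy : y.natAbs = n + 1
    · have : y = (n : ℤ) + 1 ∨ y = -((n : ℤ) + 1) := by omega
      rcases this with rfl | rfl
      · exact h1.le
      · exact h2.le
    · exact (h y hy).le
  have hset : maximisers ξ t = {(n : ℤ) + 1, -((n : ℤ) + 1)} := by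
    ext y
    simp only [Set.mem_insert_iff, Set.mem_singleton_iff]
    constructor
    · intro hy
      by_contra hne
      have h3 := h y (by omega)
      have h4 := hy ((n : ℤ) + 1)
      rw [h1] at h4
      exact absurd h3 (not_lt.2 h4)
    · rintro (rfl | rfl) x
      · rw [h1]; exact hle x
      · rw [h2]; exact hle x
  rw [hset]
  exact Set.ncard_pair (by omega)

/-! ### On a good field exactly one pair wins. -/

section Good

variable {α β c K κ t : ℝ} {f : ℤ → ℝ} {b : ℕ → Bool} {z₀ : ℤ}

lemma IsGoodField.psi_lt (hf : IsGoodField α β c K κ t f) (ha : 0 < potScale α t) (hc : 0 < c)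
    (hκ : 0 < κ) (hz₀ : IsTopSite α c κ t (potential f b) z₀) {y : ℤ}
    (hy : y.natAbs ≠ z₀.natAbs) : Psi (potential f b) t y < Psi (potential f b) t z₀ := by
  refine lt_of_le_of_ne (hz₀.mem y) fun he => hy ?_
  have hcc : c / 2 * potScale α t ≤ c * potScale α t := by gcongr; linarith
  have hs : source b y = source b z₀ := by
    refine hf.source_eq ?_ ?_ ?_
    · rw [he]; exact hcc.trans hz₀.high
    · rw [he, sub_self, abs_zero]; positivity
    · exact hcc.trans hz₀.high
  rw [← natAbs_source b y, hs, natAbs_source]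

/-- At `x = 0`, where `-x = x`, `not_both` says that the origin is not high; so the top belongs to a
genuine pair. -/
lemma IsGoodField.exists_natAbs (hf : IsGoodField α β c K κ t f) (ha : 0 < potScale α t)
    (hc : 0 < c) (hz₀ : IsTopSite α c κ t (potential f b) z₀) : ∃ n : ℕ, z₀.natAbs = n + 1 := by
  refine Nat.exists_eq_succ_of_ne_zero fun h0 => ?_
  have h0' : z₀ = 0 := by omega
  subst h0'
  have hcc : c / 2 * potScale α t ≤ c * potScale α t := by gcongr; linarith
  have h1 := hcc.trans hz₀.high
  rw [psi_potential, show source b 0 = 0 from rfl] at h1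
  exact hf.not_both 0 h1 (by simpa using h1)

lemma IsGoodField.exists_win (hf : IsGoodField α β c K κ t f) (ha : 0 < potScale α t) (hc : 0 < c)
    (hκ : 0 < κ) (hz₀ : IsTopSite α c κ t (potential f b) z₀) :
    ∃ n, (b n = true ∧ (f, b) ∈ winPlus t n) ∨
      (b n = false ∧ (f, b) ∈ winPlus t n ∪ winMinus t n) := by
  obtain ⟨n, hn⟩ := hf.exists_natAbs ha hc hz₀
  refine ⟨n, ?_⟩
  have hlt : ∀ y : ℤ, y.natAbs ≠ n + 1 →
      Psi (potential f b) t y < level t (source b z₀) (f (source b z₀)) := by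
    intro y hy
    rw [← psi_potential]
    exact hf.psi_lt ha hc hκ hz₀ (by rwa [hn])
  have hz : z₀ = (n : ℤ) + 1 ∨ z₀ = -((n : ℤ) + 1) := by omega
  cases hb : b n
  · right
    refine ⟨rfl, ?_⟩
    rcases hz with hz | hz
    · left; rw [hz, source_succ] at hlt; exact hlt
    · right
      rw [hz, source_neg_succ, if_neg (by simp [hb])] at hlt
      exact hlt
  · left
    refine ⟨rfl, ?_⟩
    rcases hz with hz | hz
    · rw [hz, source_succ] at hlt; exact hlt
    · rw [hz, source_neg_succ, if_pos hb] at hlt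
      exact hlt

/-- Two maximisers must be the two sites of the winning pair. As they tie, they share a source,
which means that the switch is on. -/
lemma IsGoodField.exists_win_of_ncard (hf : IsGoodField α β c K κ t f) (ha : 0 < potScale α t)
    (hc : 0 < c) (hκ : 0 < κ) (hz₀ : IsTopSite α c κ t (potential f b) z₀)
    (h2 : (maximisers (potential f b) t).ncard = 2) :
    ∃ n, b n = true ∧ (f, b) ∈ winPlus t n := by
  obtain ⟨n, hn⟩ := hf.exists_natAbs ha hc hz₀
  obtain ⟨x, y, hxy, hset⟩ := Set.ncard_eq_two.1 h2
  have hx : x ∈ maximisers (potential f b) t := by rw [hset]; simp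
  have hy : y ∈ maximisers (potential f b) t := by rw [hset]; simp
  have habs : ∀ u ∈ maximisers (potential f b) t, u.natAbs = n + 1 := by
    intro u hu
    by_contra hne
    exact absurd (hf.psi_lt ha hc hκ hz₀ (by rwa [hn])) (not_lt.2 (hu z₀))
  have hx1 := habs x hx
  have hy1 := habs y hy
  have hcc : c / 2 * potScale α t ≤ c * potScale α t := by gcongr; linarith
  have hpx : (n : ℤ) + 1 ∈ maximisers (potential f b) t := by
    rcases (by omega : x = (n : ℤ) + 1 ∨ y = (n : ℤ) + 1) with rfl | rfl
    · exact hx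
    · exact hy
  have hmx : -((n : ℤ) + 1) ∈ maximisers (potential f b) t := by
    rcases (by omega : x = -((n : ℤ) + 1) ∨ y = -((n : ℤ) + 1)) with rfl | rfl
    · exact hx
    · exact hy
  have hp := hz₀.high.trans (hpx z₀)
  have hm := hz₀.high.trans (hmx z₀)
  have he : Psi (potential f b) t ((n : ℤ) + 1) = Psi (potential f b) t (-((n : ℤ) + 1)) :=
    le_antisymm (hmx _) (hpx _)
  have hs := hf.source_eq (hcc.trans hp) (by rw [he, sub_self, abs_zero]; positivity) (hcc.trans hm)
  rw [source_succ, source_neg_succ] at hs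
  refine ⟨n, ?_, fun u hu => ?_⟩
  · by_contra hb
    rw [if_neg hb] at hs
    omega
  · have h3 := hf.psi_lt ha hc hκ hz₀ (y := u) (by rwa [hn])
    have h4 := hpx z₀
    rw [psi_potential f b t ((n : ℤ) + 1), source_succ] at h4
    exact h3.trans_le h4

/-- A high level of the parity opposite to `n + 1` exists outside the pair; beating it would make
both `n+1` and `-(n+1)` high. This is the purpose of asking for an even and an odd high site. -/
lemma IsGoodField.not_win_both (hf : IsGoodField α β c K κ t f) (ha : 0 < potScale α t)
    (hc : 0 < c) {n : ℕ} (hp : (f, b) ∈ winPlus t n) (hm : (f, b) ∈ winMinus t n) : False := by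
  have hcc : c / 2 * potScale α t ≤ c * potScale α t := by gcongr; linarith
  obtain ⟨y, hy, hhigh⟩ : ∃ y : ℤ, y.natAbs ≠ n + 1 ∧
      c * potScale α t ≤ Psi (potential f b) t y := by
    obtain ⟨k, hk⟩ := hf.even
    obtain ⟨j, hj⟩ := hf.odd
    by_cases h : 2 * k = n + 1
    · refine ⟨((2 * j + 1 : ℕ) : ℤ), by omega, ?_⟩
      rw [psi_potential, source_natCast]; exact hj
    · refine ⟨((2 * k : ℕ) : ℤ), by omega, ?_⟩
      rw [psi_potential, source_natCast]; exact hk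
  exact hf.not_both _ (hcc.trans (hhigh.trans (hp y hy).le)) (hcc.trans (hhigh.trans (hm y hy).le))

end Good

/-! ### Independence of the switches -/

section Law

variable {S : Type*} [MeasurableSpace S] {P : Measure S}
  {X : ℤ → S → ℝ} {B : ℕ → S → Bool}

lemma indepFun_update (hBm : ∀ n, Measurable (B n)) (hB : iIndepFun B P) (n : ℕ) :
    IndepFun (fun ω => Function.update (fun k => B k ω) n false) (B n) P := by
  have h := indep_iSup_of_disjoint (fun k => (hBm k).comap_le) hB.iIndep
    (S := {n}ᶜ) (T := {n}) disjoint_compl_left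
  rw [IndepFun_iff_Indep]
  refine indep_of_indep_of_le_left (indep_of_indep_of_le_right h ?_) ?_
  · exact le_iSup₂_of_le n (Set.mem_singleton n) le_rfl
  · rw [← measurable_iff_comap_le]
    refine @measurable_pi_lambda _ _ _ (_) _ _ fun k => ?_
    by_cases hk : k = n
    · subst hk
      simp only [Function.update_self]
      exact measurable_const
    · simp only [Function.update_of_ne hk]
      rw [measurable_iff_comap_le]
      exact le_iSup₂_of_le (f := fun k (_ : k ∈ ({n}ᶜ : Set ℕ)) =>
        MeasurableSpace.comap (B k) inferInstance) k hk le_rfl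

/-- For a fixed field the section of `F` is an event in the other switches only, by `hFn`. It is
therefore independent of switch `n`, and Fubini integrates over the field. -/
lemma measure_inter_switch [IsProbabilityMeasure P] (hXm : ∀ z, Measurable (X z)) (hBm : ∀ n, Measurable (B n))
    (hB : iIndepFun B P) (hXB : IndepFun (fun ω z => X z ω) (fun ω n => B n ω) P) (n : ℕ)
    {F : Set ((ℤ → ℝ) × (ℕ → Bool))} (hF : MeasurableSet F)
    (hFn : ∀ f b, (f, Function.update b n false) ∈ F ↔ (f, b) ∈ F) (v : Bool) :
    P {ω | ((fun z => X z ω), fun n => B n ω) ∈ F ∧ B n ω = v}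
      = P {ω | B n ω = v} * P {ω | ((fun z => X z ω), fun n => B n ω) ∈ F} := by
  have hX' : Measurable fun ω z => X z ω := measurable_pi_iff.2 hXm
  have hB' : Measurable fun ω n => B n ω := measurable_pi_iff.2 hBm
  have hlaw := hXB.map_prod_eq_prod_map_map hX'.aemeasurable hB'.aemeasurable
  have hpair : Measurable fun ω => ((fun z => X z ω), fun n => B n ω) := hX'.prodMk hB'
  have hbn : MeasurableSet {b : ℕ → Bool | b n = v} :=
    measurableSet_eq_fun (measurable_pi_apply n) measurable_const
  have hF' : MeasurableSet {q : (ℤ → ℝ) × (ℕ → Bool) | q ∈ F ∧ q.2 n = v} :=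
    hF.inter (measurable_snd hbn)
  have h1 : P {ω | ((fun z => X z ω), fun n => B n ω) ∈ F ∧ B n ω = v}
      = P.map (fun ω => ((fun z => X z ω), fun n => B n ω)) {q | q ∈ F ∧ q.2 n = v} := by
    rw [Measure.map_apply hpair hF']; rfl
  have h2 : P {ω | ((fun z => X z ω), fun n => B n ω) ∈ F}
      = P.map (fun ω => ((fun z => X z ω), fun n => B n ω)) F := by
    rw [Measure.map_apply hpair hF]; rfl
  rw [h1, h2, hlaw, Measure.prod_apply hF', Measure.prod_apply hF, ← lintegral_const_mul _
    (measurable_measure_prodMk_left hF)]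
  refine lintegral_congr fun f => ?_
  have hsec : MeasurableSet (Prod.mk f ⁻¹' F) := measurable_prodMk_left hF
  rw [Measure.map_apply hB' (measurable_prodMk_left hF'), Measure.map_apply hB' hsec]
  have h3 := (indepFun_update hBm hB n).measure_inter_preimage_eq_mul (Prod.mk f ⁻¹' F) {v} hsec
    (measurableSet_singleton v)
  have h4 : (fun ω => Function.update (fun k => B k ω) n false) ⁻¹' (Prod.mk f ⁻¹' F)
      = (fun ω n => B n ω) ⁻¹' (Prod.mk f ⁻¹' F) := by
    ext ω; exact hFn f _
  rw [h4, mul_comm] at h3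
  exact h3

/-- The i.i.d. field, jointly with the independent switches, has a law invariant under transposing
two coordinates. -/
lemma measure_winMinus_eq [IsProbabilityMeasure P] {μ : Measure ℝ} (hXm : ∀ z, Measurable (X z))
    (hBm : ∀ n, Measurable (B n)) (hl : ∀ z, HasLaw (X z) μ P) (hi : iIndepFun X P)
    (hXB : IndepFun (fun ω z => X z ω) (fun ω n => B n ω) P) (t : ℝ) (n : ℕ) :
    P {ω | ((fun z => X z ω), fun n => B n ω) ∈ winMinus t n}
      = P {ω | ((fun z => X z ω), fun n => B n ω) ∈ winPlus t n} := by
  have hX' : Measurable fun ω z => X z ω := measurable_pi_iff.2 hXm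
  have hB' : Measurable fun ω n => B n ω := measurable_pi_iff.2 hBm
  set σ := Equiv.swap ((n : ℤ) + 1) (-((n : ℤ) + 1)) with hσ
  have hsw : Measurable fun f : ℤ → ℝ => fun z => f (σ z) :=
    measurable_pi_iff.2 fun z => measurable_pi_apply (σ z)
  have hXs : Measurable fun ω z => X (σ z) ω := measurable_pi_iff.2 fun z => hXm (σ z)
  have hXsB : IndepFun (fun ω z => X (σ z) ω) (fun ω n => B n ω) P :=
    hXB.comp hsw measurable_id
  have e1 := hXB.map_prod_eq_prod_map_map hX'.aemeasurable hB'.aemeasurable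
  have e2 := hXsB.map_prod_eq_prod_map_map hXs.aemeasurable hB'.aemeasurable
  have e3 : P.map (fun ω z => X (σ z) ω) = P.map (fun ω z => X z ω) := by
    rw [hi.map_fun_eq_infinitePi_map hXm,
      (hi.precomp σ.injective).map_fun_eq_infinitePi_map fun z => hXm (σ z)]
    congr 1
    ext1 z
    rw [(hl (σ z)).map_eq, (hl z).map_eq]
  rw [e3, ← e1] at e2
  have h1 : P {ω | ((fun z => X z ω), fun n => B n ω) ∈ winPlus t n}
      = P.map (fun ω => ((fun z => X z ω), fun n => B n ω)) (winPlus t n) := by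
    rw [Measure.map_apply (hX'.prodMk hB') (measurableSet_winPlus t n)]; rfl
  rw [h1, ← e2, Measure.map_apply (hXs.prodMk hB') (measurableSet_winPlus t n)]
  congr 1
  ext ω
  exact swap_mem_winPlus.symm

end Law

/-! ### The probability of two maximisers -/

/-- The window for the growth exponent: `β < 1` gives sublinear growth, `αβ > 1` makes the tails
summable. -/
lemma exists_exponent {α : ℝ} (hα : 1 < α) : ∃ β : ℝ, 0 ≤ β ∧ β < 1 ∧ 1 < α * β := by
  have h0 : 0 < α := by linarith
  have h1 : α⁻¹ < 1 := inv_lt_one_of_one_lt₀ hα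
  refine ⟨(1 + α⁻¹) / 2, by positivity, by linarith, ?_⟩
  have : α * ((1 + α⁻¹) / 2) = (α + 1) / 2 := by field_simp
  linarith

section Events

variable {S : Type*} {X : ℤ → S → ℝ} {B : ℕ → S → Bool} {t : ℝ}

/-- Some pair wins through its positive site and is duplicated. -/
def dupEvent (X : ℤ → S → ℝ) (B : ℕ → S → Bool) (t : ℝ) : Set S :=
  ⋃ n, {ω | ((fun z => X z ω), fun n => B n ω) ∈ winPlus t n ∧ B n ω = true}

/-- Some pair wins and is not duplicated. -/
def nondupEvent (X : ℤ → S → ℝ) (B : ℕ → S → Bool) (t : ℝ) : Set S :=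
  ⋃ n, {ω | ((fun z => X z ω), fun n => B n ω) ∈ winPlus t n ∪ winMinus t n ∧ B n ω = false}

/-- Both sites of some pair that is not duplicated beat all other sites. -/
def tieEvent (X : ℤ → S → ℝ) (B : ℕ → S → Bool) (t : ℝ) : Set S :=
  ⋃ n, {ω | ((fun z => X z ω), fun n => B n ω) ∈ winPlus t n ∩ winMinus t n ∧ B n ω = false}

lemma isWinner_of_nondup {n : ℕ} {ω : S}
    (h : ((fun z => X z ω), fun n => B n ω) ∈ winPlus t n ∪ winMinus t n ∧ B n ω = false) :
    IsWinner (potential (fun z => X z ω) fun n => B n ω) t n :=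
  h.1.elim isWinner_of_winPlus fun hm => isWinner_of_winMinus hm h.2

lemma disjoint_dupEvent_nondupEvent : Disjoint (dupEvent X B t) (nondupEvent X B t) := by
  rw [Set.disjoint_left]
  intro ω h1 h2
  obtain ⟨n, hn, hb⟩ := Set.mem_iUnion.1 h1
  obtain ⟨m, hm⟩ := Set.mem_iUnion.1 h2
  obtain rfl := (isWinner_of_winPlus hn).eq (isWinner_of_nondup hm)
  rw [hm.2] at hb
  exact Bool.false_ne_true hb

variable [MeasurableSpace S] {P : Measure S}

lemma measurableSet_switch (hXm : ∀ z, Measurable (X z)) (hBm : ∀ n, Measurable (B n))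
    {F : Set ((ℤ → ℝ) × (ℕ → Bool))} (hF : MeasurableSet F) (n : ℕ) (v : Bool) :
    MeasurableSet {ω | ((fun z => X z ω), fun n => B n ω) ∈ F ∧ B n ω = v} :=
  (((measurable_pi_iff.2 hXm).prodMk (measurable_pi_iff.2 hBm)) hF).inter
    (measurableSet_eq_fun (hBm n) measurable_const)

lemma measurableSet_nondupEvent (hXm : ∀ z, Measurable (X z)) (hBm : ∀ n, Measurable (B n)) :
    MeasurableSet (nondupEvent X B t) :=
  MeasurableSet.iUnion fun n => measurableSet_switch hXm hBm
    ((measurableSet_winPlus t n).union (measurableSet_winMinus t n)) n false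

lemma measure_dupEvent [IsProbabilityMeasure P] {q : ℝ≥0∞} (hXm : ∀ z, Measurable (X z))
    (hBm : ∀ n, Measurable (B n)) (hB : iIndepFun B P)
    (hXB : IndepFun (fun ω z => X z ω) (fun ω n => B n ω) P)
    (hq : ∀ n, P {ω | B n ω = true} = q) :
    P (dupEvent X B t)
      = q * ∑' n, P {ω | ((fun z => X z ω), fun n => B n ω) ∈ winPlus t n} := by
  rw [dupEvent, measure_iUnion, ← ENNReal.tsum_mul_left]
  · refine tsum_congr fun n => ?_
    rw [measure_inter_switch hXm hBm hB hXB n (measurableSet_winPlus t n)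
      (fun f b => update_mem_winPlus) true, hq]
  · intro n m hnm
    rw [Function.onFun, Set.disjoint_left]
    exact fun ω h1 h2 => hnm ((isWinner_of_winPlus h1.1).eq (isWinner_of_winPlus h2.1))
  · exact fun n => measurableSet_switch hXm hBm (measurableSet_winPlus t n) n true

/-- Inclusion–exclusion for each pair, with both sites equally likely to win. Adding the tie event
gives an exact identity, and ties are impossible on good fields. -/
lemma measure_nondupEvent_add_tieEvent [IsProbabilityMeasure P] {μ : Measure ℝ} {q : ℝ≥0∞}
    (hXm : ∀ z, Measurable (X z)) (hBm : ∀ n, Measurable (B n)) (hl : ∀ z, HasLaw (X z) μ P)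
    (hi : iIndepFun X P) (hB : iIndepFun B P)
    (hXB : IndepFun (fun ω z => X z ω) (fun ω n => B n ω) P)
    (hq : ∀ n, P {ω | B n ω = false} = q) :
    P (nondupEvent X B t) + P (tieEvent X B t)
      = q * (2 * ∑' n, P {ω | ((fun z => X z ω), fun n => B n ω) ∈ winPlus t n}) := by
  have hu := fun n => (measurableSet_winPlus t n).union (measurableSet_winMinus t n)
  have hn := fun n => (measurableSet_winPlus t n).inter (measurableSet_winMinus t n)
  rw [nondupEvent, tieEvent, measure_iUnion, measure_iUnion, ← ENNReal.tsum_add,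
    ← ENNReal.tsum_mul_left, ← ENNReal.tsum_mul_left]
  · refine tsum_congr fun n => ?_
    rw [measure_inter_switch hXm hBm hB hXB n (hu n) (fun f b => or_congr update_mem_winPlus
        update_mem_winMinus) false,
      measure_inter_switch hXm hBm hB hXB n (hn n) (fun f b => and_congr update_mem_winPlus
        update_mem_winMinus) false, hq, ← mul_add]
    have h := measure_union_add_inter (μ := P)
      {ω | ((fun z => X z ω), fun n => B n ω) ∈ winPlus t n}
      (((measurable_pi_iff.2 hXm).prodMk (measurable_pi_iff.2 hBm)) (measurableSet_winMinus t n))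
    congr 1
    refine h.trans ?_
    rw [two_mul]
    congr 1
    exact measure_winMinus_eq hXm hBm hl hi hXB t n
  · intro n m hnm
    rw [Function.onFun, Set.disjoint_left]
    exact fun ω h1 h2 => hnm ((isWinner_of_winPlus h1.1.1).eq (isWinner_of_winPlus h2.1.1))
  · exact fun n => measurableSet_switch hXm hBm (hn n) n false
  · intro n m hnm
    rw [Function.onFun, Set.disjoint_left]
    exact fun ω h1 h2 => hnm ((isWinner_of_nondup h1).eq (isWinner_of_nondup h2))
  · exact fun n => measurableSet_switch hXm hBm (hu n) n false

lemma tendsto_measure_ncard_maximisers [IsProbabilityMeasure P] {α p : ℝ} (hα : 1 < α)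
    (hp : p ∈ Set.Ioo (0 : ℝ) 1) (hXm : ∀ z, Measurable (X z)) (hBm : ∀ n, Measurable (B n))
    (hl : ∀ z, HasLaw (X z) (paretoMeasure 1 α) P)
    (hq : ∀ n, P {ω | B n ω = true} = ENNReal.ofReal p) (hi : iIndepFun X P)
    (hB : iIndepFun B P) (hXB : IndepFun (fun ω z => X z ω) (fun ω n => B n ω) P) :
    Tendsto (fun t : ℝ => P {ω | (maximisers (potential (fun z => X z ω) fun n => B n ω) t).ncard
      = 2}) atTop (𝓝 (ENNReal.ofReal (p / (2 - p)))) := by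
  obtain ⟨hp0, hp1⟩ := hp
  obtain ⟨β, hβ0, hβ1, hβ⟩ := exists_exponent hα
  have hq' : ∀ n, P {ω | B n ω = false} = ENNReal.ofReal (1 - p) := by
    intro n
    have hm : MeasurableSet {ω | B n ω = true} := measurableSet_eq_fun (hBm n) measurable_const
    have : {ω | B n ω = false} = {ω | B n ω = true}ᶜ := by ext ω; simp
    rw [this, prob_compl_eq_one_sub hm, hq, ← ENNReal.ofReal_one, ENNReal.ofReal_sub _ hp0.le]
  rw [← ENNReal.tendsto_toReal_iff (fun _ => measure_ne_top _ _) ENNReal.ofReal_ne_top,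
    ENNReal.toReal_ofReal (div_nonneg hp0.le (by linarith)), Metric.tendsto_nhds]
  intro ε hε
  have hη : 0 < ε / 3 := by positivity
  obtain ⟨c, hc, K, hK, κ, hκ, hκc, hgood⟩ :=
    exists_eventually_measure_not_isGoodField_le hα hXm hl hi hβ0 hβ hη
  filter_upwards [hgood, eventually_exists_isTopSite (K := K) hα hβ0 hβ1 hc hκ hκc,
    eventually_gt_atTop 1] with t hG htop ht
  have ha := potScale_pos α ht
  set G := {ω | ¬ IsGoodField α β c K κ t fun z => X z ω} with hGdef
  set D := {ω | (maximisers (potential (fun z => X z ω) fun n => B n ω) t).ncard = 2} with hD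
  have hGr : P.real G ≤ ε / 3 := ENNReal.toReal_le_of_le_ofReal hη.le hG
  have htie : P.real (tieEvent X B t) ≤ P.real G := by
    refine measureReal_mono fun ω h hg => ?_
    obtain ⟨n, ⟨h1, h2⟩, -⟩ := Set.mem_iUnion.1 h
    exact hg.not_win_both ha hc h1 h2
  have hdup : P.real (dupEvent X B t) ≤ P.real D := by
    refine measureReal_mono fun ω h => ?_
    obtain ⟨n, h1, h2⟩ := Set.mem_iUnion.1 h
    exact ncard_maximisers_of_winPlus h1 h2
  have hdup' : P.real D ≤ P.real (dupEvent X B t) + P.real G := by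
    refine (measureReal_mono fun ω h => ?_).trans (measureReal_union_le _ _)
    by_cases hg : IsGoodField α β c K κ t fun z => X z ω
    · obtain ⟨z₀, hz₀⟩ := htop _ hg (fun n => B n ω)
      obtain ⟨n, h1, h2⟩ := hg.exists_win_of_ncard ha hc hκ hz₀ h
      exact Or.inl (Set.mem_iUnion.2 ⟨n, h2, h1⟩)
    · exact Or.inr hg
  have hunion := measureReal_union (μ := P) (disjoint_dupEvent_nondupEvent (X := X) (B := B)
    (t := t)) (measurableSet_nondupEvent hXm hBm)
  have hle : P.real (dupEvent X B t) + P.real (nondupEvent X B t) ≤ 1 := by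
    rw [← hunion]; exact measureReal_le_one
  have hge : 1 ≤ P.real (dupEvent X B t) + P.real (nondupEvent X B t) + P.real G := by
    rw [← hunion, ← probReal_univ (μ := P)]
    refine (measureReal_mono fun ω _ => ?_).trans (measureReal_union_le _ _)
    by_cases hg : IsGoodField α β c K κ t fun z => X z ω
    · obtain ⟨z₀, hz₀⟩ := htop _ hg (fun n => B n ω)
      obtain ⟨n, ⟨h1, h2⟩ | ⟨h1, h2⟩⟩ := hg.exists_win ha hc hκ hz₀
      · exact Or.inl (Or.inl (Set.mem_iUnion.2 ⟨n, h2, h1⟩))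
      · exact Or.inl (Or.inr (Set.mem_iUnion.2 ⟨n, h2, h1⟩))
    · exact Or.inr hg
  -- Eliminating the common sum over pairs. With `x`, `y`, `z` the probabilities of the duplicated,
  -- non-duplicated and tie events, this reads `(2-p) x = p (x + y + z)`, and `x + y + z` is within
  -- `P.real G` of `1`.
  have hbal : p * (P.real (nondupEvent X B t) + P.real (tieEvent X B t))
      = 2 * (1 - p) * P.real (dupEvent X B t) := by
    have h1 := measure_dupEvent (t := t) hXm hBm hB hXB hq
    have h2 := measure_nondupEvent_add_tieEvent (t := t) hXm hBm hl hi hB hXB hq'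
    have h3 : ENNReal.ofReal p * (P (nondupEvent X B t) + P (tieEvent X B t))
        = 2 * ENNReal.ofReal (1 - p) * P (dupEvent X B t) := by
      rw [h1, h2]; ring
    have h4 := congrArg ENNReal.toReal h3
    simpa [ENNReal.toReal_mul, ENNReal.toReal_add, measureReal_def, hp0.le, hp1.le] using h4
  have htie0 : 0 ≤ P.real (tieEvent X B t) := measureReal_nonneg
  have hd0 : 0 ≤ P.real G := measureReal_nonneg
  change dist (P.real D) _ < ε
  generalize P.real D = d at *
  generalize P.real G = g at *
  generalize P.real (dupEvent X B t) = x at *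
  generalize P.real (nondupEvent X B t) = y at *
  generalize P.real (tieEvent X B t) = z at *
  have h2p : 0 < 2 - p := by linarith
  have hxu : x ≤ p / (2 - p) + g := by
    rw [← sub_le_iff_le_add, le_div_iff₀ h2p]
    nlinarith
  have hxl : p / (2 - p) ≤ x + g := by
    rw [div_le_iff₀ h2p]
    nlinarith
  rw [Real.dist_eq, abs_lt]
  constructor <;> linarith

end Events

/-! ### Growth of the potential and convergence of the share -/

section Share

variable {S : Type*} [MeasurableSpace S] {P : Measure S}
  {X : ℤ → S → ℝ} {B : ℕ → S → Bool} {α β : ℝ}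

/-- The growth estimate at unit scales `a = r = 1` bounds the exceptional set for every `K`, and the
bound tends to `0` as `K → ∞`. -/
lemma ae_exists_growth (hα : 0 < α) (hl : ∀ z, HasLaw (X z) (paretoMeasure 1 α) P)
    (hβ0 : 0 ≤ β) (hβ : 1 < α * β) :
    ∀ᵐ ω ∂P, ∃ C : ℝ, 0 ≤ C ∧ ∀ z : ℤ, X z ω ≤ C * (1 + |(z : ℝ)|) ^ β := by
  refine ae_iff.2 (le_antisymm (ge_of_tendsto
    (f := fun K : ℝ => ENNReal.ofReal (K ^ (-α) * (1 + 2 / (α * β - 1)))) (x := atTop) ?_ ?_)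
    zero_le)
  · have := ((tendsto_rpow_neg_atTop hα).mul_const (1 + 2 / (α * β - 1)))
    rw [zero_mul] at this
    simpa using ENNReal.tendsto_ofReal this
  · filter_upwards [eventually_ge_atTop 1] with K hK
    refine le_trans (measure_mono fun ω hω => ?_) (measure_growth_le (a := 1) (r := 1) (K := K) hα hl
      hβ0 hβ one_pos (Real.one_rpow α).symm le_rfl (by linarith) (by linarith))
    by_contra hcon
    refine hω ⟨K, by linarith, fun z => ?_⟩
    by_contra hz
    exact hcon ⟨z, by simpa using hz⟩

lemma ae_solution (hα : 1 < α) (hl : ∀ z, HasLaw (X z) (paretoMeasure 1 α) P) :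
    ∀ᵐ ω ∂P, (∀ t, 0 ≤ t → ∀ z, solution (potential (fun z => X z ω) fun n => B n ω) t z ≠ ∞) ∧
      IsCauchySolution (potential (fun z => X z ω) fun n => B n ω)
        (fun t z => (solution (potential (fun z => X z ω) fun n => B n ω) t z).toReal) := by
  obtain ⟨β, hβ0, hβ1, hβ⟩ := exists_exponent hα
  filter_upwards [ae_exists_growth (by linarith) hl hβ0 hβ] with ω hω
  obtain ⟨C, hC, hX⟩ := hω
  have hb := exists_totalMass_le hβ0 hβ1 hC
    (ξ := potential (fun z => X z ω) fun n => B n ω) fun z => by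
      rw [potential_eq, ← abs_source (fun n => B n ω) z]
      exact hX _
  refine ⟨fun t ht z => ?_, isCauchySolution_of_totalMass_le hb⟩
  obtain ⟨K, hK, hle⟩ := hb t
  exact ((solution_le_totalMass _ t z).trans (hle t ht le_rfl)).trans_lt hK.lt_top |>.ne

lemma tendstoInMeasure_localisedShare [IsProbabilityMeasure P] (hα : 1 < α) (hXm : ∀ z, Measurable (X z))
    (hl : ∀ z, HasLaw (X z) (paretoMeasure 1 α) P) (hi : iIndepFun X P) :
    TendstoInMeasure P (fun (t : ℝ) ω =>
      (localisedShare (potential (fun z => X z ω) fun n => B n ω) t).toReal) atTop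
      (fun _ => (1 : ℝ)) := by
  obtain ⟨β, hβ0, hβ1, hβ⟩ := exists_exponent hα
  rw [tendstoInMeasure_iff_norm]
  intro ε hε
  rw [ENNReal.tendsto_nhds_zero]
  intro η hη
  obtain ⟨η', hη', hle⟩ : ∃ η' : ℝ, 0 < η' ∧ ENNReal.ofReal η' ≤ η := by
    obtain ⟨r, hr0, hr⟩ := ENNReal.lt_iff_exists_nnreal_btwn.1 hη
    exact ⟨r, by exact_mod_cast hr0, by rw [ENNReal.ofReal_coe_nnreal]; exact hr.le⟩
  obtain ⟨c, hc, K, hK, κ, hκ, hκc, hgood⟩ :=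
    exists_eventually_measure_not_isGoodField_le hα hXm hl hi hβ0 hβ hη'
  filter_upwards [hgood, eventually_localisedShare hα hβ0 hβ1 hc hK hκ hκc (half_pos hε)]
    with t hG hs
  refine (measure_mono fun ω hω hg => ?_).trans (hG.trans hle)
  have h1 := hs _ hg (fun n => B n ω)
  have h2 : ε ≤ |(localisedShare (potential (fun z => X z ω) fun n => B n ω) t).toReal - 1| := hω
  linarith

end Share

end PAM

end

theorem theorem1p1 {S : Type*} [MeasurableSpace S] (P : Measure S) [IsProbabilityMeasure P]
    (α p : ℝ) (hα : 1 < α) (hp : p ∈ Set.Ioo (0 : ℝ) 1)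
    (ξ₀ : ℤ → S → ℝ) (B : ℕ → S → Bool)
    (hξ₀_meas : ∀ z, Measurable (ξ₀ z)) (hB_meas : ∀ n, Measurable (B n))
    (hξ₀_law : ∀ z, HasLaw (ξ₀ z) (paretoMeasure 1 α) P)
    (hB_law : ∀ n, P {ω | B n ω = true} = ENNReal.ofReal p)
    (hξ₀_indep : iIndepFun ξ₀ P) (hB_indep : iIndepFun B P)
    (hξ₀B_indep : IndepFun (fun ω z => ξ₀ z ω) (fun ω n => B n ω) P)
    (ξ : S → ℤ → ℝ)
    (hξ : ∀ ω, ξ ω = PAM.potential (fun z => ξ₀ z ω) (fun n => B n ω)) :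
    (∀ᵐ ω ∂P, (∀ t, 0 ≤ t → ∀ z, PAM.solution (ξ ω) t z ≠ ∞) ∧
      PAM.IsCauchySolution (ξ ω) (fun t z => (PAM.solution (ξ ω) t z).toReal)) ∧
    TendstoInMeasure P (fun (t : ℝ) ω => (PAM.localisedShare (ξ ω) t).toReal) atTop
      (fun _ => (1 : ℝ)) ∧
    Tendsto (fun t : ℝ => P {ω | (PAM.maximisers (ξ ω) t).ncard = 2}) atTop
      (𝓝 (ENNReal.ofReal (p / (2 - p)))) := by
  obtain rfl : ξ = fun ω => PAM.potential (fun z => ξ₀ z ω) (fun n => B n ω) := funext hξ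
  exact ⟨PAM.ae_solution hα hξ₀_law,
    PAM.tendstoInMeasure_localisedShare hα hξ₀_meas hξ₀_law hξ₀_indep,
    PAM.tendsto_measure_ncard_maximisers hα hp hξ₀_meas hB_meas hξ₀_law hB_law hξ₀_indep hB_indep
      hξ₀B_indep⟩
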